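/- **Setting.** Let $V$ be a real Hilbert space, $W$ a separable real Banach space, $\frac13<\alpha\le\frac12$, $0<\beta<\alpha$, $\alpha+2\beta>1$. Let $(S(t))_{t\ge0}$ be an analytic $C_0$-semigroup on $W$ with generator $A$, let $\lambda\in\mathbb R$ be such that $e^{-\lambda t}S(t)$ is exponentially stable ($\lambda=0$ if $S$ is), and let $D_\beta=D((\lambda-A)^\beta)$, $|x|_{D_\beta}=|(\lambda-A)^\beta x|$. Let $G:W\to\mathcal L(V,D_\beta)$ be bounded and three times Fréchet differentiable with bounded derivatives. $V\otimes V$ is the completed projective tensor product and $\mathcal L(W\otimes V,W)=\mathcal L(W,\mathcal L(V,W))$. Write $(\delta y)_{ts}=y_t-y_s$, $\Delta_T=\{0\le s\le t\le T\}$. An $\alpha$-Hölder rough path on $[0,T]$ is a pair $(\omega,\omega^{(2)})$ with $\omega\in C^\alpha([0,T],V)$, $\omega^{(2)}\in C^{2\alpha}(\Delta_T,V\otimes V)$ and $\omega^{(2)}_{ts}-\omega^{(2)}_{us}-\omega^{(2)}_{tu}=(\delta\omega)_{us}\otimes(\delta\omega)_{tu}$ for $s\le u\le t$. Here $z\in C^{\gamma}(\Delta_T,X)$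 means $z_{tt}=0$, $\sup_t|z_{t0}|<\infty$ and $\sup_{0\le s<t\le T}|z_{ts}|(t-s)^{-\gamma}<\infty$; $C^{\gamma,\beta}(\Delta_T,X)$ is defined in the same way with $\sup_{0<s<t\le T}s^\beta|z_{ts}|(t-s)^{-\gamma}<\infty$; and $C^{\beta,\beta}([0,T],W)$ is the space of continuous $y$ with $\sup_{0<s<t\le T}s^\beta|(\delta y)_{ts}|(t-s)^{-\beta}<\infty$. The shift of the rough path is $(\theta_\tau\omega)_t=\omega_{t+\tau}-\omega_\tau$ together with $(\tilde\theta_\tau\omega^{(2)})_{ts}=\omega^{(2)}_{t+\tau,s+\tau}$. For $K\in\mathcal L(V,W)$, $E\in\mathcal L(W,\mathcal L(V,W))$, $x\in W$ put $$\omega^S_{ts}(K)=S(t-s)K(\delta\omega)_{ts}-\int_s^tAS(t-r)K(\delta\omega)_{tr}\,dr,$$ $$a_{ts}(E,x)=\omega^S_{ts}(ES(t-s)x)-\int_s^tS(t-r)\,\omega^S_{rs}(EAS(r-s)x)\,dr$$ (which equals $\omega^S_{ts}(Ex)+\int_s^t\omega^S_{tr}(EAS(r-s)x)\,dr$ whenever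 the latter integral converges absolutely), $$c_{ts}(E,K)=\omega^S_{ts}(EK(\delta\omega)_{ts})-S(t-s)EK\omega^{(2)}_{ts}+\int_s^tAS(t-r)EK\omega^{(2)}_{tr}\,dr,\qquad EK(v_1\otimes v_2):=E(Kv_2)v_1,$$ $$b_{ts}(E,K)=\lim_{|\mathcal P(s,t)|\to0}\sum_{[u,v]\in\mathcal P(s,t)}S(t-v)\big[\omega^S_{vu}(E\omega^S_{us}(K))+c_{vu}(E,K)\big].$$ $X_{\omega,T}$ is the set of pairs $(y,z)$ with $y\in C^{\beta,\beta}([0,T],W)$, $z\in C^\alpha(\Delta_T,Z)\cap C^{\alpha+\beta,\beta}(\Delta_T,Z)$, $Z=\mathcal L(\mathcal L(W\otimes V,W),W)$, and $z_{ts}(E)-z_{t\tau}(E)-S(t-\tau)z_{\tau s}(E)=\omega^S_{t\tau}(E(\delta y)_{\tau s})$ for $s\le\tau\le t$. For $\xi\in W$ the map $\mathcal M_{T,\omega,\xi}$ sends $(y,z)\in X_{\omega,T}$ to $(\tilde y,\tilde z)$ with $$\tilde y_t=S(t)\xi+\lim_{|\mathcal P(0,t)|\to0}\sum_{[u,v]\in\mathcal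 P(0,t)}S(t-v)\big[\omega^S_{vu}(G(y_u))+z_{vu}(DG(y_u))\big],$$ $$\tilde z_{ts}(E)=\lim_{|\mathcal P(s,t)|\to0}\sum_{[u,v]\in\mathcal P(s,t)}S(t-v)\big[b_{vu}(E,G(y_u))+a_{vu}(E,\tilde y_u)\big]-\omega^S_{ts}(E\tilde y_s).$$ A fixed point of $\mathcal M_{T,\omega,\xi}$ is a pair $(y,z)\in X_{\omega,T}$ for which these limits exist and $(\tilde y,\tilde z)=(y,z)$. **Lemma.** Let $T_1,T_2>0$, let $(\omega,\omega^{(2)})$ be an $\alpha$-Hölder rough path on $[0,T_1+T_2]$ and $\xi\in W$. Let $(y^1,z^1)$ be a fixed point of $\mathcal M_{T_1,\omega,\xi}$ and $(y^2,z^2)$ a fixed point of $\mathcal M_{T_2,\theta_{T_1}\omega,y^1_{T_1}}$ (formed with the shifted rough path $(\theta_{T_1}\omega,\tilde\theta_{T_1}\omega^{(2)})$). Then $$y_t=\begin{cases}y^1_t,&0\le t\le T_1,\\ y^2_{t-T_1},&T_1\le t\le T_1+T_2,\end{cases}$$ $$z_{ts}(E)=\begin{cases}z^1_{ts}(E),&0\le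 s\le t\le T_1,\\ \omega^S_{tT_1}(E(\delta y^1)_{T_1s})+z^2_{t-T_1,0}(E)+S(t-T_1)z^1_{T_1s}(E),&0\le s\le T_1\le t\le T_1+T_2,\\ z^2_{t-T_1,s-T_1}(E),&T_1\le s\le t\le T_1+T_2,\end{cases}$$ are well defined (the cases agree where they overlap) and $(y,z)$ is a fixed point of $\mathcal M_{T_1+T_2,\omega,\xi}$. -/

import Mathlib

set_option maxSynthPendingDepth 3

open Set Filter Topology MeasureTheory
open scoped TensorProduct

noncomputable section

namespace RoughEvolution

/-! ### Semigroups and fractional power spaces -/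

section Semigroup

variable {W : Type*} [NormedAddCommGroup W] [NormedSpace ℝ W]

/-- `S` (only its values at times `t ≥ 0` matter) is an analytic `C₀`-semigroup on the real
Banach space `W`: a `C₀`-semigroup that is norm differentiable at positive times, with
`‖A S(t)‖ ≤ M / t` for `0 < t ≤ 1`. Here `A` is the generator of `S`, and `deriv S t = A S(t)`
for `t > 0`. -/
structure IsAnalyticSemigroup (S : ℝ → W →L[ℝ] W) : Prop where
  zero : S 0 = ContinuousLinearMap.id ℝ W
  add : ∀ s t : ℝ, 0 ≤ s → 0 ≤ t → S (s + t) = (S s).comp (S t)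
  tendsto_zero : ∀ x : W, Tendsto (fun t : ℝ => S t x) (𝓝[>] 0) (𝓝 x)
  differentiableOn : DifferentiableOn ℝ S (Ioi 0)
  bound : ∃ M : ℝ, ∀ t ∈ Ioc (0 : ℝ) 1, ‖deriv S t‖ ≤ M / t

/-- The rescaled semigroup `exp (-lam * t) S(t)`, whose generator is `A - lam`, decays
exponentially. For `lam = 0` this says that `S` itself is exponentially stable. -/
def IsExpStable (lam : ℝ) (S : ℝ → W →L[ℝ] W) : Prop :=
  ∃ M δ : ℝ, 0 < δ ∧ ∀ t : ℝ, 0 ≤ t → ‖S t‖ ≤ M * Real.exp ((lam - δ) * t)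

/-- The negative fractional power
`(lam - A)^(-β) = Γ(β)⁻¹ ∫_0^∞ t^(β-1) exp (-lam * t) S(t) dt`. -/
def negFracPow (S : ℝ → W →L[ℝ] W) (lam β : ℝ) : W →L[ℝ] W :=
  (Real.Gamma β)⁻¹ • ∫ t in Ioi (0 : ℝ), (t ^ (β - 1) * Real.exp (-lam * t)) • S t

/-- The space `D_β = D((lam - A)^β)`, i.e. the range of `(lam - A)^(-β)`. -/
def FracDomain (S : ℝ → W →L[ℝ] W) (lam β : ℝ) : Type _ :=
  LinearMap.range (negFracPow S lam β : W →ₗ[ℝ] W)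

namespace FracDomain

variable (S : ℝ → W →L[ℝ] W) (lam β : ℝ)

instance instAddCommGroup : AddCommGroup (FracDomain S lam β) :=
  inferInstanceAs (AddCommGroup (LinearMap.range (negFracPow S lam β : W →ₗ[ℝ] W)))

instance instModule : Module ℝ (FracDomain S lam β) :=
  inferInstanceAs (Module ℝ (LinearMap.range (negFracPow S lam β : W →ₗ[ℝ] W)))

instance instIsClosedKer :
    IsClosed ((LinearMap.ker (negFracPow S lam β : W →ₗ[ℝ] W) : Submodule ℝ W) : Set W) :=
  (negFracPow S lam β).isClosed_ker

/-- The inverse of `(lam - A)^(-β)` on its range, with values in `W` modulo the kernel of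
`(lam - A)^(-β)` (this kernel is trivial for the semigroups considered, so that this is
`(lam - A)^β`). -/
def fracPow : FracDomain S lam β ≃ₗ[ℝ] W ⧸ LinearMap.ker (negFracPow S lam β : W →ₗ[ℝ] W) :=
  (LinearMap.quotKerEquivRange (negFracPow S lam β : W →ₗ[ℝ] W)).symm

/-- The norm of `D_β` is `|x|_{D_β} = |(lam - A)^β x|`. -/
instance instNormedAddCommGroup : NormedAddCommGroup (FracDomain S lam β) :=
  NormedAddCommGroup.induced (FracDomain S lam β)
    (W ⧸ LinearMap.ker (negFracPow S lam β : W →ₗ[ℝ] W))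
    (fracPow S lam β) (fracPow S lam β).injective

instance instNormedSpace : NormedSpace ℝ (FracDomain S lam β) :=
  NormedSpace.induced ℝ (FracDomain S lam β)
    (W ⧸ LinearMap.ker (negFracPow S lam β : W →ₗ[ℝ] W)) (fracPow S lam β)

/-- The underlying element of `W`, as a linear map. -/
def inclₗ : FracDomain S lam β →ₗ[ℝ] W :=
  (LinearMap.range (negFracPow S lam β : W →ₗ[ℝ] W)).subtype

theorem norm_inclₗ_le (x : FracDomain S lam β) :
    ‖inclₗ S lam β x‖ ≤ ‖negFracPow S lam β‖ * ‖x‖ := by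
  have key : ∀ w : W, (negFracPow S lam β) w = inclₗ S lam β x →
      fracPow S lam β x = Submodule.Quotient.mk w := by
    intro w hw
    have hx : x = (⟨(negFracPow S lam β : W →ₗ[ℝ] W) w, LinearMap.mem_range_self _ w⟩ :
        LinearMap.range (negFracPow S lam β : W →ₗ[ℝ] W)) := Subtype.ext hw.symm
    rw [hx]
    exact LinearMap.quotKerEquivRange_symm_apply_image _ _ _
  refine le_of_forall_pos_le_add fun ε hε => ?_
  have hJ : 0 < ‖negFracPow S lam β‖ + 1 := by positivity
  obtain ⟨w, hw, hlt⟩ := Submodule.Quotient.norm_mk_lt (fracPow S lam β x)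
    (div_pos hε hJ)
  have hwx : (negFracPow S lam β) w = inclₗ S lam β x := by
    obtain ⟨w₀, hw₀⟩ := x.2
    have h1 := key w₀ hw₀
    rw [h1] at hw
    have h2 := (Submodule.Quotient.eq _).1 hw
    have h3 : (negFracPow S lam β) (w - w₀) = 0 := h2
    rw [map_sub, sub_eq_zero] at h3
    exact h3.trans hw₀
  have hnorm : ‖fracPow S lam β x‖ = ‖x‖ := rfl
  rw [hnorm] at hlt
  calc ‖inclₗ S lam β x‖ = ‖(negFracPow S lam β) w‖ := by rw [hwx]
    _ ≤ ‖negFracPow S lam β‖ * ‖w‖ := (negFracPow S lam β).le_opNorm w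
    _ ≤ ‖negFracPow S lam β‖ * (‖x‖ + ε / (‖negFracPow S lam β‖ + 1)) := by gcongr
    _ = ‖negFracPow S lam β‖ * ‖x‖
        + ε * (‖negFracPow S lam β‖ / (‖negFracPow S lam β‖ + 1)) := by ring
    _ ≤ ‖negFracPow S lam β‖ * ‖x‖ + ε * 1 := by
        gcongr
        rw [div_le_one hJ]
        linarith
    _ = ‖negFracPow S lam β‖ * ‖x‖ + ε := by ring

/-- The continuous inclusion `D_β ↪ W`. -/
def incl : FracDomain S lam β →L[ℝ] W :=
  (inclₗ S lam β).mkContinuous ‖negFracPow S lam β‖ (norm_inclₗ_le S lam β)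

end FracDomain

end Semigroup

/-! ### Tensor products, rough paths and shifts -/

section RoughPath

variable {V W : Type*} [NormedAddCommGroup V] [NormedSpace ℝ V]
  [NormedAddCommGroup W] [NormedSpace ℝ W]

/-- The (completed) projective tensor product `V ⊗ V`. -/
abbrev Tensor (V : Type*) [NormedAddCommGroup V] [NormedSpace ℝ V] : Type _ :=
  UniformSpace.Completion (⨂[ℝ] _ : Fin 2, V)

/-- The elementary tensor `v₁ ⊗ v₂`. -/
def pureTensor (v₁ v₂ : V) : Tensor V :=
  ((PiTensorProduct.tprod ℝ (![v₁, v₂] : Fin 2 → V) : ⨂[ℝ] _ : Fin 2, V) : Tensor V)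

/-- A continuous bilinear map on `V × V` as a continuous multilinear map. -/
def bilinToMultilin (Φ : V →L[ℝ] V →L[ℝ] W) :
    ContinuousMultilinearMap ℝ (fun _ : Fin 2 => V) W :=
  Φ.uncurryBilinear.compContinuousLinearMap
    fun _ => (ContinuousLinearMap.id ℝ V).prod (ContinuousLinearMap.id ℝ V)

/-- The embedding `L(V, L(V, W)) ↪ L(V ⊗ V, W)`. -/
def tensorLift [CompleteSpace W] (Φ : V →L[ℝ] V →L[ℝ] W) : Tensor V →L[ℝ] W :=
  (PiTensorProduct.liftIsometry ℝ (fun _ : Fin 2 => V) W (bilinToMultilin Φ)).extend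
    (UniformSpace.Completion.toComplL : (⨂[ℝ] _ : Fin 2, V) →L[ℝ] Tensor V)

theorem tensorLift_pureTensor [CompleteSpace W] (Φ : V →L[ℝ] V →L[ℝ] W) (v₁ v₂ : V) :
    tensorLift Φ (pureTensor v₁ v₂) = Φ v₁ v₂ := by
  have h := ContinuousLinearMap.extend_eq
    (PiTensorProduct.liftIsometry ℝ (fun _ : Fin 2 => V) W (bilinToMultilin Φ))
    (e := (UniformSpace.Completion.toComplL : (⨂[ℝ] _ : Fin 2, V) →L[ℝ] Tensor V))
    UniformSpace.Completion.denseRange_coe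
    (UniformSpace.Completion.isUniformInducing_coe _)
    (PiTensorProduct.tprod ℝ (![v₁, v₂] : Fin 2 → V))
  refine h.trans ?_
  simp [bilinToMultilin]

/-- `z ∈ C^γ(Δ_T, X)` : `z_{tt} = 0`, `sup_t |z_{t0}| < ∞` and
`sup_{0 ≤ s < t ≤ T} |z_{ts}| / (t - s)^γ < ∞`. We write `z t s` for `z_{ts}`. -/
structure MemHolder₂ {X : Type*} [NormedAddCommGroup X] (γ T : ℝ) (z : ℝ → ℝ → X) : Prop where
  diag : ∀ t ∈ Icc 0 T, z t t = 0
  bounded : ∃ C : ℝ, ∀ t ∈ Icc 0 T, ‖z t 0‖ ≤ C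
  holder : ∃ C : ℝ, ∀ s t : ℝ, 0 ≤ s → s < t → t ≤ T → ‖z t s‖ ≤ C * (t - s) ^ γ

/-- `z ∈ C^{γ,β}(Δ_T, X)` : `z_{tt} = 0`, `sup_t |z_{t0}| < ∞` and
`sup_{0 < s < t ≤ T} s^β |z_{ts}| / (t - s)^γ < ∞`. -/
structure MemWeightedHolder₂ {X : Type*} [NormedAddCommGroup X] (γ β T : ℝ)
    (z : ℝ → ℝ → X) : Prop where
  diag : ∀ t ∈ Icc 0 T, z t t = 0
  bounded : ∃ C : ℝ, ∀ t ∈ Icc 0 T, ‖z t 0‖ ≤ C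
  holder : ∃ C : ℝ, ∀ s t : ℝ, 0 < s → s < t → t ≤ T →
    s ^ β * ‖z t s‖ ≤ C * (t - s) ^ γ

/-- `y ∈ C^{β,β}([0,T], X)` : `y` is continuous on `[0,T]` and
`sup_{0 < s < t ≤ T} s^β |y_t - y_s| / (t - s)^β < ∞`. -/
structure MemWeightedHolder {X : Type*} [NormedAddCommGroup X] (β T : ℝ)
    (y : ℝ → X) : Prop where
  continuousOn : ContinuousOn y (Icc 0 T)
  holder : ∃ C : ℝ, ∀ s t : ℝ, 0 < s → s < t → t ≤ T →
    s ^ β * ‖y t - y s‖ ≤ C * (t - s) ^ β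

/-- `(ω, ω2)` is an `α`-Hölder rough path on `[0,T]`, with second order process
`ω2 t s` (for `s ≤ t`). -/
structure IsRoughPath (α T : ℝ) (ω : ℝ → V) (ω2 : ℝ → ℝ → Tensor V) : Prop where
  holder : ∃ C : ℝ, ∀ s t : ℝ, 0 ≤ s → s ≤ t → t ≤ T → ‖ω t - ω s‖ ≤ C * (t - s) ^ α
  area : MemHolder₂ (2 * α) T ω2
  chen : ∀ s u t : ℝ, 0 ≤ s → s ≤ u → u ≤ t → t ≤ T →
    ω2 t s - ω2 u s - ω2 t u = pureTensor (ω u - ω s) (ω t - ω u)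

/-- The Wiener shift `(θ_τ ω)_t = ω_{t+τ} - ω_τ`. -/
def wienerShift (τ : ℝ) (ω : ℝ → V) : ℝ → V := fun t => ω (t + τ) - ω τ

/-- The shift `(θ̃_τ z)_{ts} = z_{t+τ,s+τ}`. -/
def shift₂ {X : Type*} (τ : ℝ) (z : ℝ → ℝ → X) : ℝ → ℝ → X := fun t s => z (t + τ) (s + τ)

end RoughPath

/-! ### Rough integrals and supporting processes -/

section Integral

variable {V W : Type*} [NormedAddCommGroup V] [NormedSpace ℝ V]
  [NormedAddCommGroup W] [NormedSpace ℝ W]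

/-- `s = u 0 < u 1 < ⋯ < u n = t`. -/
structure IsPartition (s t : ℝ) (n : ℕ) (u : ℕ → ℝ) : Prop where
  left : u 0 = s
  right : u n = t
  lt_succ : ∀ i < n, u i < u (i + 1)

/-- `lim_{|P(s,t)| → 0} ∑_{[u,v] ∈ P(s,t)} S(t-v) Ξ_{vu} = x`, the limit being taken over all
partitions of `[s,t]`, as their mesh tends to `0`. The value `x` is the increment
`(δ̂ I Ξ)_{ts} = I Ξ_t - S(t-s) I Ξ_s` of the rough integral `I Ξ` of `Ξ`, and it is `I Ξ_t`
for `s = 0`. -/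
def HasRoughIntegral (S : ℝ → W →L[ℝ] W) (Ξ : ℝ → ℝ → W) (s t : ℝ) (x : W) : Prop :=
  ∀ ε > 0, ∃ δ > 0, ∀ (n : ℕ) (u : ℕ → ℝ), IsPartition s t n u →
    (∀ i < n, u (i + 1) - u i < δ) →
    ‖∑ i ∈ Finset.range n, S (t - u (i + 1)) (Ξ (u (i + 1)) (u i)) - x‖ < ε

theorem HasRoughIntegral.unique {S : ℝ → W →L[ℝ] W} {Ξ : ℝ → ℝ → W} {s t : ℝ} {x x' : W}
    (hst : s ≤ t) (h : HasRoughIntegral S Ξ s t x) (h' : HasRoughIntegral S Ξ s t x') :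
    x = x' := by
  refine eq_of_forall_dist_le fun ε hε => ?_
  obtain ⟨δ, hδ, H⟩ := h (ε / 2) (by positivity)
  obtain ⟨δ', hδ', H'⟩ := h' (ε / 2) (by positivity)
  obtain ⟨n, u, hu, hm⟩ : ∃ (n : ℕ) (u : ℕ → ℝ), IsPartition s t n u ∧
      ∀ i < n, u (i + 1) - u i < min δ δ' := by
    rcases hst.eq_or_lt with rfl | hlt
    · exact ⟨0, fun _ => s, ⟨rfl, rfl, by simp⟩, by simp⟩
    · obtain ⟨n, hn⟩ := exists_nat_gt ((t - s) / min δ δ')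
      have hmin : 0 < min δ δ' := lt_min hδ hδ'
      have hn0 : (0 : ℝ) < n := lt_trans (div_pos (sub_pos.2 hlt) hmin) hn
      have hd : 0 < (t - s) / n := div_pos (sub_pos.2 hlt) hn0
      refine ⟨n, fun i => s + i * ((t - s) / n), ⟨by simp, ?_, fun i _ => ?_⟩, fun i _ => ?_⟩
      · field_simp
        ring
      · push_cast
        linarith
      · have : (t - s) / n < min δ δ' := by
          rw [div_lt_iff₀ hn0, mul_comm]
          exact (div_lt_iff₀ hmin).1 hn
        push_cast
        linarith
  have h1 := H n u hu fun i hi => (hm i hi).trans_le (min_le_left _ _)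
  have h2 := H' n u hu fun i hi => (hm i hi).trans_le (min_le_right _ _)
  rw [← dist_eq_norm] at h1 h2
  rw [dist_comm] at h1
  linarith [dist_triangle x
    (∑ i ∈ Finset.range n, S (t - u (i + 1)) (Ξ (u (i + 1)) (u i))) x']

open Classical in
/-- The value of the limit in `HasRoughIntegral`, if it exists (and `0` otherwise). -/
def roughIntegral (S : ℝ → W →L[ℝ] W) (Ξ : ℝ → ℝ → W) (s t : ℝ) : W :=
  if h : ∃ x, HasRoughIntegral S Ξ s t x then h.choose else 0

/-- `ω^S_{ts}(K) = ∫_s^t S(t-r) K dω_r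
  = S(t-s) K (ω_t - ω_s) - ∫_s^t A S(t-r) K (ω_t - ω_r) dr`,
as a continuous linear map in `K ∈ L(V, W)`. -/
def omegaS (S : ℝ → W →L[ℝ] W) (ω : ℝ → V) (t s : ℝ) : (V →L[ℝ] W) →L[ℝ] W :=
  (S (t - s)).comp (ContinuousLinearMap.apply ℝ W (ω t - ω s))
    - ∫ r in s..t, (deriv S (t - r)).comp (ContinuousLinearMap.apply ℝ W (ω t - ω r))

/-- `a_{ts}(E, x) = ∫_s^t S(t-r) E S(r-s) x dω_r`. For regular `x` this is
`ω^S_{ts}(E x) + ∫_s^t ω^S_{tr}(E A S(r-s) x) dr`; inserting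
`ω^S_{tr} = ω^S_{ts} - S(t-r) ω^S_{rs}` gives the form below, in which the integral converges
absolutely for every `x ∈ W`. -/
def procA (S : ℝ → W →L[ℝ] W) (ω : ℝ → V) (t s : ℝ) (E : W →L[ℝ] V →L[ℝ] W) (x : W) : W :=
  omegaS S ω t s (E (S (t - s) x))
    - ∫ r in s..t, S (t - r) (omegaS S ω r s (E (deriv S (r - s) x)))

/-- The operator `E K ∈ L(V ⊗ V, W)`. As integrating by parts
`∫_s^t S(t-r) E (K (ω_t - ω_r)) dω_r` with `d_r ω2_{tr} = - dω_r ⊗ (ω_t - ω_r)` requires,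
`K` acts on the second factor: `(E K)(v₁ ⊗ v₂) = E (K v₂) v₁`. -/
def tensorEK [CompleteSpace W] (E : W →L[ℝ] V →L[ℝ] W) (K : V →L[ℝ] W) : Tensor V →L[ℝ] W :=
  tensorLift (E.comp K).flip

/-- `c_{ts}(E, K) = ∫_s^t S(t-r) E (K (ω_r - ω_s)) dω_r
  = ω^S_{ts}(E K (ω_t - ω_s)) - S(t-s) E K ω2_{ts} + ∫_s^t A S(t-r) E K ω2_{tr} dr`. -/
def procC [CompleteSpace W] (S : ℝ → W →L[ℝ] W) (ω : ℝ → V) (ω2 : ℝ → ℝ → Tensor V) (t s : ℝ)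
    (E : W →L[ℝ] V →L[ℝ] W) (K : V →L[ℝ] W) : W :=
  omegaS S ω t s (E (K (ω t - ω s))) - S (t - s) (tensorEK E K (ω2 t s))
    + ∫ r in s..t, deriv S (t - r) (tensorEK E K (ω2 t r))

/-- `b_{ts}(E, K) = ∫_s^t S(t-r) E ∫_s^r S(r-q) K dω_q dω_r
  = lim_{|P(s,t)| → 0} ∑_{[u,v] ∈ P(s,t)} S(t-v) (ω^S_{vu}(E ω^S_{us}(K)) + c_{vu}(E, K))`. -/
def procB [CompleteSpace W] (S : ℝ → W →L[ℝ] W) (ω : ℝ → V) (ω2 : ℝ → ℝ → Tensor V) (t s : ℝ)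
    (E : W →L[ℝ] V →L[ℝ] W) (K : V →L[ℝ] W) : W :=
  roughIntegral S
    (fun v u => omegaS S ω v u (E (omegaS S ω u s K)) + procC S ω ω2 v u E K) s t

end Integral

/-! ### The solution map -/

section SolutionMap

variable {V W : Type*} [NormedAddCommGroup V] [NormedSpace ℝ V]
  [NormedAddCommGroup W] [NormedSpace ℝ W]

/-- `G : W → L(V, D)` is bounded and three times Fréchet differentiable with bounded
derivatives. -/
structure IsAdmissibleCoeff {D : Type*} [NormedAddCommGroup D] [NormedSpace ℝ D]
    (G : W → V →L[ℝ] D) : Prop where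
  differentiable : ∀ k < 3, Differentiable ℝ (iteratedFDeriv ℝ k G)
  bounded : ∀ k ≤ 3, ∃ C : ℝ, ∀ x : W, ‖iteratedFDeriv ℝ k G x‖ ≤ C

/-- `z_{ts} ∈ L(L(W ⊗ V, W), W)`, with `L(W ⊗ V, W) = L(W, L(V, W))`. -/
abbrev AreaSpace (V W : Type*) [NormedAddCommGroup V] [NormedSpace ℝ V]
    [NormedAddCommGroup W] [NormedSpace ℝ W] : Type _ :=
  (W →L[ℝ] V →L[ℝ] W) →L[ℝ] W

/-- Membership of the pair `(y, z)` in the space `X_{ω,T}`. -/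
structure MemX (α β : ℝ) (S : ℝ → W →L[ℝ] W) (ω : ℝ → V) (T : ℝ)
    (y : ℝ → W) (z : ℝ → ℝ → AreaSpace V W) : Prop where
  path : MemWeightedHolder β T y
  area : MemHolder₂ α T z
  area_weighted : MemWeightedHolder₂ (α + β) β T z
  algebraic : ∀ s τ t : ℝ, 0 ≤ s → s ≤ τ → τ ≤ t → t ≤ T → ∀ E : W →L[ℝ] V →L[ℝ] W,
    z t s E - z t τ E - S (t - τ) (z τ s E) = omegaS S ω t τ (E (y τ - y s))

/-- `Ξ^{(y)}(y, z)_{vu} = ω^S_{vu}(g(y_u)) + z_{vu}(Dg(y_u))`. -/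
def XiY (S : ℝ → W →L[ℝ] W) (g : W → V →L[ℝ] W) (ω : ℝ → V) (y : ℝ → W)
    (z : ℝ → ℝ → AreaSpace V W) (v u : ℝ) : W :=
  omegaS S ω v u (g (y u)) + z v u (fderiv ℝ g (y u))

/-- `Ξ^{(z)}(y, ỹ)_{vu}(E) = b_{vu}(E, g(y_u)) + a_{vu}(E, ỹ_u)`. -/
def XiZ [CompleteSpace W] (S : ℝ → W →L[ℝ] W) (g : W → V →L[ℝ] W) (ω : ℝ → V) (ω2 : ℝ → ℝ → Tensor V)
    (y y' : ℝ → W) (E : W →L[ℝ] V →L[ℝ] W) (v u : ℝ) : W :=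
  procB S ω ω2 v u E (g (y u)) + procA S ω v u E (y' u)

/-- The graph of the solution map: `M_{T,ω,ξ}(y, z) = (y', z')`, i.e.
`y'_t = S(t) ξ + I Ξ^{(y)}(y, z)_t` and
`z'_{ts}(E) = (δ̂ I Ξ^{(z)}(y, y'))_{ts}(E) - ω^S_{ts}(E y'_s)`. -/
structure IsImage [CompleteSpace W] (S : ℝ → W →L[ℝ] W) (g : W → V →L[ℝ] W) (ω : ℝ → V)
    (ω2 : ℝ → ℝ → Tensor V) (T : ℝ) (ξ : W) (y : ℝ → W) (z : ℝ → ℝ → AreaSpace V W)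
    (y' : ℝ → W) (z' : ℝ → ℝ → AreaSpace V W) : Prop where
  path : ∀ t ∈ Icc 0 T, HasRoughIntegral S (XiY S g ω y z) 0 t (y' t - S t ξ)
  area : ∀ s t : ℝ, 0 ≤ s → s ≤ t → t ≤ T → ∀ E : W →L[ℝ] V →L[ℝ] W,
    HasRoughIntegral S (XiZ S g ω ω2 y y' E) s t (z' t s E + omegaS S ω t s (E (y' s)))

/-- `(y, z) ∈ X_{ω,T}` is a fixed point of `M_{T,ω,ξ}`, for the coefficient
`G : W → L(V, D_β)`. -/
structure IsFixedPoint [CompleteSpace W] (α β lam : ℝ) (S : ℝ → W →L[ℝ] W)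
    (G : W → V →L[ℝ] FracDomain S lam β) (ω : ℝ → V) (ω2 : ℝ → ℝ → Tensor V) (T : ℝ) (ξ : W)
    (y : ℝ → W) (z : ℝ → ℝ → AreaSpace V W) : Prop where
  mem : MemX α β S ω T y z
  fixed : IsImage S (fun x => (FracDomain.incl S lam β).comp (G x)) ω ω2 T ξ y z y z

end SolutionMap

end RoughEvolution

end

/-!
The concatenation of two fixed points solves the fixed point equations because rough integrals over
adjacent intervals can be joined. A partition of `[s, t]` that misses `T₁` is refined by the point
`T₁`, which changes its sum by a single defect of additivity of the integrand
(`IsPartition.exists_cut`). Both integrands `Ξ^{(y)}_{vu}` and `Ξ^{(z)}_{vu}` are `O((v-u)^α)`, so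
that this defect vanishes as the mesh tends to `0` (`HasRoughIntegral.join_of_norm_le`). The middle case in the definition of `z` is what the algebraic
relation of `X_{ω,T}` imposes; with the additivity of `ω^S` (`Driven.omegaS_add`) it gives the
algebraic relation (`IsConcat.algebraic`) and the value of the joined integral
(`IsConcat.isImage`).

The difficult point is that `(y, z)` lies in `X_{ω,T₁+T₂}`. The weights in the norms of the second
piece allow a singularity at its initial time, whereas the weight `s^β` does not vanish at
`s = T₁`: the concatenation may be singular at time `0` only. It has to be shown that the evolution
on `[0, T₁]` has smoothed out the value `y₁ T₁` at which the second piece starts, and this follows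
from the equations, in three steps.

* Mild increments of a solution are `‖y_t - S(t-s) y_s‖ = O((t-s)^α)` up to time `0`
  (`exists_norm_increment_le`): away from `0` this is the sewing estimate
  (`HasRoughIntegral.norm_sub_le`), whose singular constant `s^(-2β)` is harmless on intervals that
  are shorter than their distance to `0`; an interval `[s, t]` is then halved towards `s`
  (`le_of_halving`). This bound passes to the concatenation.
* Such increments imply `‖A S(h) y_t‖ ≲ h^(α-1) + (h+t)⁻¹`
  (`IsAnalyticSemigroup.norm_deriv_apply_le`), by writing
  `A S(h) y_t = A S(h) (y_t - S(h) y_{t-h}) + A S(2h) y_{t-h}` and summing a geometric series. The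
  weighted Hölder condition on `y` follows (`Driven.exists_weighted_holder`), and `y` is
  `α`-regular, uniformly on `[T₁, T₁ + T₂]`.
* For a solution with regular path component, the area component is `O((t-s)^(α+β))` without any
  weight (`exists_norm_area_le`). The sewing lemma for `Ξ^{(z)}` uses the additivity relations of
  the processes `a`, `c` and `b` (`Driven.procA_add`, `RoughDriven.procC_add`,
  `RoughDriven.procB_add`), and bounds on `b_{ts}(E, K)` for operators `K` with values in the
  vectors `x` with `‖A S(h) x‖ ≲ h^(β-1)`. The range of `(lam - A)^(-β)` consists of such vectors
  (`FracDomain.exists_deriv_incl_le`), and this is the only property of `D_β` that is needed.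

The `α`-Hölder bounds of the two pieces, the unweighted bound on the area component of the second
one, and the weighted bound on that of the first one then add up to the bounds on the
concatenation (`IsConcat.memX`).
-/

namespace RoughEvolution

/-! ### Analytic semigroups -/

section SemigroupFacts

variable {W : Type*} [NormedAddCommGroup W] [NormedSpace ℝ W] {S : ℝ → W →L[ℝ] W}

theorem IsAnalyticSemigroup.add_apply (hS : IsAnalyticSemigroup S) {s t : ℝ} (hs : 0 ≤ s)
    (ht : 0 ≤ t) (x : W) : S (s + t) x = S s (S t x) := by
  rw [hS.add s t hs ht]; rfl

/-- The semigroup law in the form in which it occurs in partition sums. -/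
theorem IsAnalyticSemigroup.comp_apply (hS : IsAnalyticSemigroup S) {r s t : ℝ} (hs : r ≤ s)
    (ht : s ≤ t) (x : W) : S (t - s) (S (s - r) x) = S (t - r) x := by
  rw [← hS.add_apply (sub_nonneg.2 ht) (sub_nonneg.2 hs), sub_add_sub_cancel]

theorem IsAnalyticSemigroup.zero_apply (hS : IsAnalyticSemigroup S) (x : W) : S 0 x = x := by
  rw [hS.zero]; rfl

theorem IsAnalyticSemigroup.hasDerivAt (hS : IsAnalyticSemigroup S) {t : ℝ} (ht : 0 < t) :
    HasDerivAt S (deriv S t) t :=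
  ((hS.differentiableOn t ht).differentiableAt (Ioi_mem_nhds ht)).hasDerivAt

theorem IsAnalyticSemigroup.deriv_add (hS : IsAnalyticSemigroup S) {s t : ℝ} (hs : 0 ≤ s)
    (ht : 0 < t) : deriv S (s + t) = (S s).comp (deriv S t) := by
  have h1 : HasDerivAt (fun x => S (s + x)) (deriv S (s + t)) t :=
    (hS.hasDerivAt (by linarith : 0 < s + t)).comp_const_add s t
  have h2 : HasDerivAt (fun x => (S s).comp (S x)) ((S s).comp (deriv S t)) t :=
    ((ContinuousLinearMap.compL ℝ W W W (S s)).hasFDerivAt).comp_hasDerivAt t (hS.hasDerivAt ht)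
  refine h1.unique (h2.congr_of_eventuallyEq ?_)
  filter_upwards [Ioi_mem_nhds ht] with x hx
  exact hS.add s x hs (le_of_lt hx)

theorem IsAnalyticSemigroup.deriv_add' (hS : IsAnalyticSemigroup S) {s t : ℝ} (hs : 0 ≤ s)
    (ht : 0 < t) : deriv S (t + s) = (deriv S t).comp (S s) := by
  have h1 : HasDerivAt (fun x => S (x + s)) (deriv S (t + s)) t :=
    (hS.hasDerivAt (by linarith : 0 < t + s)).comp_add_const t s
  have h2 : HasDerivAt (fun x => (S x).comp (S s)) ((deriv S t).comp (S s)) t :=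
    (((ContinuousLinearMap.compL ℝ W W W).flip (S s)).hasFDerivAt).comp_hasDerivAt t
      (hS.hasDerivAt ht)
  refine h1.unique (h2.congr_of_eventuallyEq ?_)
  filter_upwards [Ioi_mem_nhds ht] with x hx
  exact hS.add x s (le_of_lt hx) hs

theorem IsAnalyticSemigroup.deriv_add_apply (hS : IsAnalyticSemigroup S) {s t : ℝ} (hs : 0 ≤ s)
    (ht : 0 < t) (x : W) : deriv S (s + t) x = S s (deriv S t x) := by
  rw [hS.deriv_add hs ht]; rfl

theorem IsAnalyticSemigroup.deriv_add_apply' (hS : IsAnalyticSemigroup S) {s t : ℝ} (hs : 0 ≤ s)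
    (ht : 0 < t) (x : W) : deriv S (t + s) x = deriv S t (S s x) := by
  rw [hS.deriv_add' hs ht]; rfl

theorem IsAnalyticSemigroup.continuousOn (hS : IsAnalyticSemigroup S) :
    ContinuousOn S (Ioi 0) := hS.differentiableOn.continuousOn

theorem IsAnalyticSemigroup.continuousOn_deriv (hS : IsAnalyticSemigroup S) :
    ContinuousOn (deriv S) (Ioi 0) := by
  intro t ht
  have ht' : (0 : ℝ) < t := ht
  have h2 : (0 : ℝ) < t / 2 := by positivity
  have h1 : ContinuousAt (fun x : ℝ => (S (x - t / 2)).comp (deriv S (t / 2))) t := by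
    have : ContinuousAt (fun x : ℝ => S (x - t / 2)) t := by
      refine ContinuousAt.comp (g := S) ?_ (by fun_prop)
      exact (hS.continuousOn _ (by simp; linarith)).continuousAt (Ioi_mem_nhds (by linarith))
    exact this.clm_comp continuousAt_const
  refine (h1.congr ?_).continuousWithinAt
  filter_upwards [Ioi_mem_nhds (by linarith : t / 2 < t)] with x hx
  rw [← hS.deriv_add (sub_nonneg.2 (le_of_lt hx)) h2, sub_add_cancel]

theorem IsAnalyticSemigroup.integral_deriv [CompleteSpace W] (hS : IsAnalyticSemigroup S)
    {a b : ℝ} (ha : 0 < a) (hab : a ≤ b) :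
    IntervalIntegrable (deriv S) volume a b ∧ ∫ r in a..b, deriv S r = S b - S a := by
  have hsub : uIcc a b ⊆ Ioi 0 := by
    rw [uIcc_of_le hab]; exact fun x hx => lt_of_lt_of_le ha hx.1
  have hi : IntervalIntegrable (deriv S) volume a b :=
    (hS.continuousOn_deriv.mono hsub).intervalIntegrable
  exact ⟨hi, intervalIntegral.integral_eq_sub_of_hasDerivAt
    (fun x hx => hS.hasDerivAt (hsub hx)) hi⟩

theorem IsAnalyticSemigroup.integral_deriv_sub [CompleteSpace W] (hS : IsAnalyticSemigroup S)
    {s m t : ℝ} (hsm : s ≤ m) (hmt : m < t) :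
    IntervalIntegrable (fun r => deriv S (t - r)) volume s m ∧
      ∫ r in s..m, deriv S (t - r) = S (t - s) - S (t - m) := by
  obtain ⟨h1, h2⟩ := hS.integral_deriv (sub_pos.2 hmt) (sub_le_sub_left hsm t)
  refine ⟨?_, by rw [intervalIntegral.integral_comp_sub_left (fun r => deriv S r) t, h2]⟩
  simpa using (h1.comp_sub_left t).symm

/-- Bounds `‖S(t)‖ ≤ M` and `‖A S(t)‖ ≤ M / t` on a finite time horizon. -/
structure SemigroupBound (S : ℝ → W →L[ℝ] W) (M L : ℝ) : Prop where
  nonneg : 0 ≤ M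
  norm_le : ∀ t : ℝ, 0 ≤ t → t ≤ L → ‖S t‖ ≤ M
  deriv_le : ∀ t : ℝ, 0 < t → t ≤ L → ‖deriv S t‖ ≤ M / t

/-- For all positive times, `‖A S(t)‖ ≤ C exp (lam * t) / t`; the margin in the exponential
stability of `exp (-lam * t) S(t)` absorbs the factor `1 / t`. -/
theorem IsAnalyticSemigroup.exists_deriv_bound (hS : IsAnalyticSemigroup S) {lam : ℝ}
    (hlam : IsExpStable lam S) :
    ∃ C : ℝ, 0 ≤ C ∧ (∀ t : ℝ, 0 ≤ t → ‖S t‖ ≤ C * Real.exp (lam * t)) ∧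
      ∀ t : ℝ, 0 < t → ‖deriv S t‖ ≤ C * Real.exp (lam * t) / t := by
  obtain ⟨M, δ, hδ, hM⟩ := hlam
  obtain ⟨N, hN⟩ := hS.bound
  have hM0 : 0 ≤ M := by
    have := (norm_nonneg _).trans (hM 0 le_rfl)
    simpa using this
  have hN0 : 0 ≤ N := by
    have := (norm_nonneg _).trans (hN 1 (by simp))
    simpa using this
  set c₁ := N * Real.exp |lam|
  set c₂ := N * M * (Real.exp (-(lam - δ)) * (1 / δ))
  have hc₁ : 0 ≤ c₁ := by positivity
  have hc₂ : 0 ≤ c₂ := by positivity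
  refine ⟨M + c₁ + c₂, by positivity, fun t ht => (hM t ht).trans ?_, fun t ht => ?_⟩
  · have : Real.exp ((lam - δ) * t) ≤ Real.exp (lam * t) :=
      Real.exp_le_exp.2 (by nlinarith)
    have h2 := Real.exp_pos (lam * t)
    nlinarith [mul_nonneg (add_nonneg hc₁ hc₂) h2.le, mul_le_mul_of_nonneg_left this hM0]
  · have key : ‖deriv S t‖ ≤ (c₁ + c₂) * Real.exp (lam * t) / t := by
      rw [le_div_iff₀ ht]
      rcases le_total t 1 with h | h
      · have h1 := hN t ⟨ht, h⟩
        rw [le_div_iff₀ ht] at h1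
        have h2 : 1 ≤ Real.exp |lam| * Real.exp (lam * t) := by
          rw [← Real.exp_add]
          apply Real.one_le_exp
          have : -(lam * t) ≤ |lam| := by
            calc -(lam * t) ≤ |lam * t| := neg_le_abs _
              _ = |lam| * t := by rw [abs_mul, abs_of_pos ht]
              _ ≤ |lam| * 1 := by gcongr
              _ = |lam| := mul_one _
          linarith
        calc ‖deriv S t‖ * t ≤ N * 1 := by linarith
          _ ≤ N * (Real.exp |lam| * Real.exp (lam * t)) := by gcongr
          _ = c₁ * Real.exp (lam * t) := by simp only [c₁]; ring
          _ ≤ (c₁ + c₂) * Real.exp (lam * t) := by gcongr; linarith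
      · have h1 : ‖deriv S t‖ ≤ N * (M * Real.exp ((lam - δ) * (t - 1))) := by
          have e : t = 1 + (t - 1) := by ring
          rw [e, hS.deriv_add' (sub_nonneg.2 h) one_pos]
          refine (ContinuousLinearMap.opNorm_comp_le _ _).trans ?_
          rw [← e]
          gcongr
          · simpa using hN 1 (by simp)
          · exact hM _ (sub_nonneg.2 h)
        have h2 : Real.exp (-(δ * t)) * t ≤ 1 / δ := by
          rw [le_div_iff₀ hδ, Real.exp_neg]
          have := Real.add_one_le_exp (δ * t)
          rw [mul_assoc, mul_comm t δ, inv_mul_le_iff₀ (Real.exp_pos _)]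
          linarith
        have h3 : Real.exp ((lam - δ) * (t - 1))
            = Real.exp (-(lam - δ)) * Real.exp (-(δ * t)) * Real.exp (lam * t) := by
          rw [← Real.exp_add, ← Real.exp_add]; congr 1; ring
        calc ‖deriv S t‖ * t ≤ N * (M * Real.exp ((lam - δ) * (t - 1))) * t := by gcongr
          _ = N * M * (Real.exp (-(lam - δ)) * (Real.exp (-(δ * t)) * t)) * Real.exp (lam * t) := by
            rw [h3]; ring
          _ ≤ N * M * (Real.exp (-(lam - δ)) * (1 / δ)) * Real.exp (lam * t) := by gcongr
          _ ≤ (c₁ + c₂) * Real.exp (lam * t) := by simp only [c₂] at *; gcongr; linarith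
    refine key.trans ?_
    gcongr
    linarith

theorem IsAnalyticSemigroup.exists_semigroupBound (hS : IsAnalyticSemigroup S) {lam : ℝ}
    (hlam : IsExpStable lam S) (L : ℝ) : ∃ M : ℝ, SemigroupBound S M L := by
  obtain ⟨C, hC, h1, h2⟩ := hS.exists_deriv_bound hlam
  have aux : ∀ t : ℝ, 0 ≤ t → t ≤ L → C * Real.exp (lam * t) ≤ C * Real.exp (|lam| * L) := by
    intro t ht htL
    gcongr
    exact le_abs_self lam
  refine ⟨C * Real.exp (|lam| * L), by positivity, fun t ht htL => (h1 t ht).trans (aux t ht htL),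
    fun t ht htL => (h2 t ht).trans ?_⟩
  have := aux t ht.le htL
  gcongr

/-- If `‖A S(r) x‖ ≤ N r^(γ-1)`, then `r ↦ S(r) x` is `γ`-Hölder at `0`. -/
theorem IsAnalyticSemigroup.norm_apply_sub_le [CompleteSpace W] (hS : IsAnalyticSemigroup S)
    {γ N h : ℝ} (hγ : 0 < γ) (hN : 0 ≤ N) (hh : 0 ≤ h) {x : W}
    (hx : ∀ r : ℝ, 0 < r → r ≤ h → ‖deriv S r x‖ ≤ N * r ^ (γ - 1)) :
    ‖S h x - x‖ ≤ N / γ * h ^ γ := by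
  rcases eq_or_lt_of_le hh with rfl | hpos
  · rw [hS.zero_apply]; simp [Real.zero_rpow hγ.ne']
  have hlim : Tendsto (fun ε => ‖S h x - S ε x‖) (𝓝[>] 0) (𝓝 ‖S h x - x‖) :=
    (tendsto_const_nhds.sub (hS.tendsto_zero x)).norm
  refine le_of_tendsto hlim ?_
  filter_upwards [Ioo_mem_nhdsGT hpos] with ε hε
  obtain ⟨hi, he⟩ := hS.integral_deriv hε.1 hε.2.le
  have e : S h x - S ε x = ∫ r in ε..h, deriv S r x := by
    have := congrArg (fun B : W →L[ℝ] W => B x) he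
    simp only [sub_apply] at this
    rw [← this, ContinuousLinearMap.intervalIntegral_apply hi]
  have hint : IntervalIntegrable (fun r : ℝ => N * r ^ (γ - 1)) volume ε h :=
    (intervalIntegral.intervalIntegrable_rpow' (by linarith)).const_mul _
  rw [e]
  calc ‖∫ r in ε..h, deriv S r x‖ ≤ ∫ r in ε..h, N * r ^ (γ - 1) := by
        refine intervalIntegral.norm_integral_le_of_norm_le hε.2.le ?_ hint
        filter_upwards with r hr
        exact hx r (hε.1.trans hr.1) hr.2
    _ = N * ((h ^ γ - ε ^ γ) / γ) := by
        rw [intervalIntegral.integral_const_mul, integral_rpow (Or.inl (by linarith))]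
        simp
    _ ≤ N * (h ^ γ / γ) := by
        have := Real.rpow_nonneg hε.1.le γ
        gcongr
        linarith
    _ = N / γ * h ^ γ := by ring

end SemigroupFacts

/-! ### Smoothing on fractional power spaces -/

section Smoothing

variable {W : Type*} [NormedAddCommGroup W] [NormedSpace ℝ W] {S : ℝ → W →L[ℝ] W}

theorem FracDomain.exists_preimage (lam β : ℝ) (x : FracDomain S lam β) {ε : ℝ} (hε : 0 < ε) :
    ∃ w : W, negFracPow S lam β w = FracDomain.incl S lam β x ∧ ‖w‖ < ‖x‖ + ε := by
  obtain ⟨w, hw, hlt⟩ := Submodule.Quotient.norm_mk_lt (FracDomain.fracPow S lam β x) hε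
  refine ⟨w, ?_, hlt⟩
  have h1 := congrArg (FracDomain.fracPow S lam β).symm hw
  rw [LinearEquiv.symm_apply_apply] at h1
  exact congrArg (FracDomain.inclₗ S lam β) h1

/-- The range of `(lam - A)^(-β)` consists of vectors `x` with `‖A S(t) x‖ = O(t^(β-1))`: split
the defining integral at `r = t` and use `‖A S(t + r)‖ ≲ t⁻¹` before and `≲ r⁻¹` after. -/
theorem IsAnalyticSemigroup.exists_deriv_negFracPow_le [CompleteSpace W]
    (hS : IsAnalyticSemigroup S)
    {lam β : ℝ} (hlam : IsExpStable lam S) (hβ : 0 < β) (hβ1 : β < 1) (L : ℝ) :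
    ∃ C : ℝ, 0 ≤ C ∧ ∀ t : ℝ, 0 < t → t ≤ L → ∀ w : W,
      ‖deriv S t (negFracPow S lam β w)‖ ≤ C * t ^ (β - 1) * ‖w‖ := by
  obtain ⟨C, hC, h1, h2⟩ := hS.exists_deriv_bound hlam
  set D := C * C * Real.exp (|lam| * L)
  have hD : 0 ≤ D := by positivity
  have hΓ : 0 ≤ (Real.Gamma β)⁻¹ := inv_nonneg.2 (Real.Gamma_pos_of_pos hβ).le
  have hβ1' : 0 < 1 - β := by linarith
  refine ⟨(Real.Gamma β)⁻¹ * (D * (1 / β + 1 / (1 - β))), by positivity, fun t ht htL w => ?_⟩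
  set f : ℝ → W →L[ℝ] W := fun r => (r ^ (β - 1) * Real.exp (-lam * r)) • S r
  have hrhs : 0 ≤ D * (1 / β + 1 / (1 - β)) * t ^ (β - 1) * ‖w‖ := by positivity
  set Λ : (W →L[ℝ] W) →L[ℝ] W := (deriv S t).comp (ContinuousLinearMap.apply ℝ W w)
  have hΛ : ∀ B : W →L[ℝ] W, Λ B = deriv S t (B w) := fun B => rfl
  suffices h : ‖Λ (∫ r in Ioi (0 : ℝ), f r)‖ ≤ D * (1 / β + 1 / (1 - β)) * t ^ (β - 1) * ‖w‖ by
    have e : deriv S t (negFracPow S lam β w)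
        = (Real.Gamma β)⁻¹ • Λ (∫ r in Ioi (0 : ℝ), f r) := by
      rw [hΛ, ← map_smul]; rfl
    rw [e, norm_smul, Real.norm_of_nonneg hΓ]
    calc _ ≤ (Real.Gamma β)⁻¹ * (D * (1 / β + 1 / (1 - β)) * t ^ (β - 1) * ‖w‖) := by gcongr
      _ = _ := by ring
  -- A non-integrable `f` has integral `0` by convention, and then the bound is trivial.
  by_cases hf : IntegrableOn f (Ioi 0)
  swap
  · have : ∫ r in Ioi (0 : ℝ), f r = 0 := integral_undef hf
    rw [this]; simpa using hrhs
  have hexp : Real.exp (lam * t) ≤ Real.exp (|lam| * L) := by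
    apply Real.exp_le_exp.2
    calc lam * t ≤ |lam| * t := by gcongr; exact le_abs_self _
      _ ≤ |lam| * L := by gcongr
  have hcancel : ∀ r : ℝ, Real.exp (-lam * r) * Real.exp (lam * r) = 1 := by
    intro r; rw [← Real.exp_add]; simp
  have hnorm : ∀ r : ℝ, 0 < r → ‖Λ (f r)‖
      = r ^ (β - 1) * Real.exp (-lam * r) * ‖deriv S t (S r w)‖ := by
    intro r hr
    have : 0 ≤ r ^ (β - 1) * Real.exp (-lam * r) := by positivity
    rw [hΛ]
    simp only [f, smul_apply, map_smul, norm_smul, Real.norm_of_nonneg this]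
  have b1 : ∀ r ∈ Ioc 0 t, ‖Λ (f r)‖ ≤ D / t * ‖w‖ * r ^ (β - 1) := by
    intro r hr
    rw [hnorm r hr.1]
    have : ‖deriv S t (S r w)‖ ≤ C * Real.exp (lam * t) / t * (C * Real.exp (lam * r) * ‖w‖) :=
      (deriv S t).le_of_opNorm_le_of_le (h2 t ht) ((S r).le_of_opNorm_le (h1 r hr.1.le) w)
    calc _ ≤ r ^ (β - 1) * Real.exp (-lam * r) *
            (C * Real.exp (lam * t) / t * (C * Real.exp (lam * r) * ‖w‖)) := by
          have := Real.rpow_nonneg hr.1.le (β - 1)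
          gcongr
      _ = C * C * Real.exp (lam * t) / t * ‖w‖ * r ^ (β - 1) *
            (Real.exp (-lam * r) * Real.exp (lam * r)) := by ring
      _ = C * C * Real.exp (lam * t) / t * ‖w‖ * r ^ (β - 1) := by rw [hcancel, mul_one]
      _ ≤ D / t * ‖w‖ * r ^ (β - 1) := by
          have := Real.rpow_nonneg hr.1.le (β - 1)
          simp only [D]
          gcongr
  have b2 : ∀ r ∈ Ioi t, ‖Λ (f r)‖ ≤ D * ‖w‖ * r ^ (β - 2) := by
    intro r hr
    have hr0 : 0 < r := ht.trans hr
    rw [hnorm r hr0, ← hS.deriv_add_apply' hr0.le ht, hS.deriv_add_apply ht.le hr0]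
    have : ‖S t (deriv S r w)‖ ≤ C * Real.exp (lam * t) * (C * Real.exp (lam * r) / r * ‖w‖) :=
      (S t).le_of_opNorm_le_of_le (h1 t ht.le) ((deriv S r).le_of_opNorm_le (h2 r hr0) w)
    have e : r ^ (β - 1) / r = r ^ (β - 2) := by
      rw [← Real.rpow_sub_one hr0.ne']; congr 1; ring
    calc _ ≤ r ^ (β - 1) * Real.exp (-lam * r) *
            (C * Real.exp (lam * t) * (C * Real.exp (lam * r) / r * ‖w‖)) := by
          have := Real.rpow_nonneg hr0.le (β - 1)
          gcongr
      _ = C * C * Real.exp (lam * t) * ‖w‖ * (r ^ (β - 1) / r) *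
            (Real.exp (-lam * r) * Real.exp (lam * r)) := by ring
      _ = C * C * Real.exp (lam * t) * ‖w‖ * r ^ (β - 2) := by rw [hcancel, mul_one, e]
      _ ≤ D * ‖w‖ * r ^ (β - 2) := by
          have := Real.rpow_nonneg hr0.le (β - 2)
          simp only [D]
          gcongr
  have hΛf : IntegrableOn (fun r => Λ (f r)) (Ioi 0) := Λ.integrable_comp hf
  have i1 : IntegrableOn (fun r : ℝ => D / t * ‖w‖ * r ^ (β - 1)) (Ioc 0 t) := by
    rw [← intervalIntegrable_iff_integrableOn_Ioc_of_le ht.le]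
    exact (intervalIntegral.intervalIntegrable_rpow' (by linarith)).const_mul _
  have i2 : IntegrableOn (fun r : ℝ => D * ‖w‖ * r ^ (β - 2)) (Ioi t) :=
    (integrableOn_Ioi_rpow_of_lt (by linarith) ht).const_mul _
  rw [← Λ.integral_comp_comm hf, ← Ioc_union_Ioi_eq_Ioi ht.le,
    setIntegral_union Ioc_disjoint_Ioi_same measurableSet_Ioi
      (hΛf.mono_set Ioc_subset_Ioi_self) (hΛf.mono_set (Ioi_subset_Ioi ht.le))]
  have n1 : ‖∫ r in Ioc 0 t, Λ (f r)‖ ≤ D / t * ‖w‖ * (t ^ β / β) := by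
    refine (norm_integral_le_of_norm_le i1
      ((ae_restrict_iff' measurableSet_Ioc).2 (.of_forall b1))).trans (le_of_eq ?_)
    rw [integral_const_mul, ← intervalIntegral.integral_of_le ht.le,
      integral_rpow (Or.inl (by linarith))]
    simp [Real.zero_rpow hβ.ne']
  have n2 : ‖∫ r in Ioi t, Λ (f r)‖ ≤ D * ‖w‖ * (t ^ (β - 1) / (1 - β)) := by
    refine (norm_integral_le_of_norm_le i2
      ((ae_restrict_iff' measurableSet_Ioi).2 (.of_forall b2))).trans (le_of_eq ?_)
    rw [integral_const_mul, integral_Ioi_rpow_of_lt (by linarith) ht]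
    rw [show β - 2 + 1 = β - 1 by ring, neg_div, ← div_neg, neg_sub]
  calc _ ≤ D / t * ‖w‖ * (t ^ β / β) + D * ‖w‖ * (t ^ (β - 1) / (1 - β)) :=
        (norm_add_le _ _).trans (add_le_add n1 n2)
    _ = _ := by rw [Real.rpow_sub_one ht.ne']; field_simp

theorem FracDomain.exists_deriv_incl_le [CompleteSpace W] (hS : IsAnalyticSemigroup S)
    {lam β : ℝ} (hlam : IsExpStable lam S) (hβ : 0 < β) (hβ1 : β < 1) (L : ℝ) :
    ∃ C : ℝ, 0 ≤ C ∧ ∀ t : ℝ, 0 < t → t ≤ L → ∀ x : FracDomain S lam β,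
      ‖deriv S t (FracDomain.incl S lam β x)‖ ≤ C * t ^ (β - 1) * ‖x‖ := by
  obtain ⟨C, hC, h⟩ := hS.exists_deriv_negFracPow_le hlam hβ hβ1 L
  refine ⟨C, hC, fun t ht htL x => le_of_forall_pos_le_add fun ε hε => ?_⟩
  set c := C * t ^ (β - 1)
  have hc : 0 ≤ c := mul_nonneg hC (Real.rpow_nonneg ht.le _)
  obtain ⟨w, hw, hlt⟩ := FracDomain.exists_preimage lam β x (div_pos hε (by linarith : 0 < c + 1))
  rw [← hw]
  calc _ ≤ c * ‖w‖ := h t ht htL w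
    _ ≤ c * (‖x‖ + ε / (c + 1)) := by gcongr
    _ = c * ‖x‖ + ε * (c / (c + 1)) := by ring
    _ ≤ c * ‖x‖ + ε * 1 := by
        gcongr
        exact (div_le_one (by linarith)).2 (by linarith)
    _ = c * ‖x‖ + ε := by ring

/-- If the increments `f_t - S(t-u) f_u` satisfy `‖A S(h) (f_t - S(t-u) f_u)‖ ≤ C h^(γ-1)` as
long as `t - u ≤ h`, then so does `f_t`, up to the contribution of the initial value. Indeed
`A S(h) f_t = A S(h) (f_t - S(h) f_{t-h}) + A S(2h) f_{t-h}`; iterating, `h` doubles, so that the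
bounds form a geometric series, and `h + t` does not change. -/
theorem IsAnalyticSemigroup.norm_deriv_apply_le (hS : IsAnalyticSemigroup S) {M L : ℝ}
    (hM : SemigroupBound S M L) {γ C a T : ℝ} (hγ : γ < 1) (hC : 0 ≤ C) {f : ℝ → W}
    (hf : ∀ h u t : ℝ, 0 < h → h ≤ L → a ≤ u → u ≤ t → t ≤ T → t - u ≤ h →
      ‖deriv S h (f t - S (t - u) (f u))‖ ≤ C * h ^ (γ - 1)) {h t : ℝ} (hh : 0 < h)
    (hat : a ≤ t) (htT : t ≤ T) (hL : h + (t - a) ≤ L) :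
    ‖deriv S h (f t)‖ ≤ C / (1 - 2 ^ (γ - 1)) * h ^ (γ - 1) + M * ‖f a‖ / (h + (t - a)) := by
  have h2 : (2 : ℝ) ^ (γ - 1) < 1 := Real.rpow_lt_one_of_one_lt_of_neg (by norm_num) (by linarith)
  set q : ℝ := 2 ^ (γ - 1) with hq
  have hq0 : 0 ≤ q := by positivity
  have hK : C ≤ C / (1 - q) := by
    rw [le_div_iff₀ (by linarith)]; nlinarith
  have key : ∀ (k : ℕ) (h t : ℝ), 0 < h → a ≤ t → t ≤ T → h + (t - a) ≤ L → t - a ≤ 2 ^ k * h →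
      ‖deriv S h (f t)‖ ≤ C / (1 - q) * h ^ (γ - 1) + M * ‖f a‖ / (h + (t - a)) := by
    have base : ∀ h t : ℝ, 0 < h → a ≤ t → t ≤ T → h + (t - a) ≤ L → t - a ≤ h →
        ‖deriv S h (f t)‖ ≤ C / (1 - q) * h ^ (γ - 1) + M * ‖f a‖ / (h + (t - a)) := by
      intro h t hh hat htT hL hth
      have e : deriv S h (f t)
          = deriv S h (f t - S (t - a) (f a)) + deriv S (h + (t - a)) (f a) := by
        rw [hS.deriv_add_apply' (sub_nonneg.2 hat) hh, ← map_add, sub_add_cancel]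
      have h1 := hf h a t hh (by linarith) le_rfl hat htT hth
      have h3 := (deriv S (h + (t - a))).le_of_opNorm_le
        (hM.deriv_le (h + (t - a)) (by linarith) hL) (f a)
      rw [e]
      refine (norm_add_le _ _).trans (add_le_add (h1.trans ?_) (h3.trans (le_of_eq (by ring))))
      gcongr
    intro k
    induction k with
    | zero => intro h t hh hat htT hL hk; exact base h t hh hat htT hL (by simpa using hk)
    | succ k ih =>
      intro h t hh hat htT hL hk
      rcases le_total (t - a) h with hth | hth
      · exact base h t hh hat htT hL hth
      have e : deriv S h (f t) = deriv S h (f t - S (t - (t - h)) (f (t - h)))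
          + deriv S (2 * h) (f (t - h)) := by
        rw [two_mul, hS.deriv_add_apply' hh.le hh, ← map_add, sub_sub_cancel, sub_add_cancel]
      have h1 := hf h (t - h) t hh (by linarith) (by linarith) (by linarith) htT (by linarith)
      have h3 := ih (2 * h) (t - h) (by linarith) (by linarith) (by linarith) (by linarith)
        (by rw [pow_succ] at hk; linarith)
      rw [e]
      refine (norm_add_le _ _).trans ((add_le_add h1 h3).trans (le_of_eq ?_))
      rw [Real.mul_rpow (by norm_num) hh.le, ← hq, show 2 * h + (t - h - a) = h + (t - a) by ring]
      have : 1 - q ≠ 0 := by linarith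
      field_simp
      ring
  obtain ⟨k, hk⟩ := pow_unbounded_of_one_lt ((t - a) / h) (one_lt_two (α := ℝ))
  exact key k h t hh hat htT hL ((div_lt_iff₀ hh).1 hk).le

end Smoothing

/-! ### Partitions and partition sums -/

section Partitions

theorem IsPartition.mono {s t : ℝ} {n : ℕ} {u : ℕ → ℝ} (h : IsPartition s t n u) {i j : ℕ}
    (hij : i ≤ j) (hj : j ≤ n) : u i ≤ u j := by
  induction j, hij using Nat.le_induction with
  | base => exact le_rfl
  | succ j hij ih => exact (ih (by omega)).trans (h.lt_succ j (by omega)).le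

theorem IsPartition.left_le {s t : ℝ} {n : ℕ} {u : ℕ → ℝ} (h : IsPartition s t n u) {i : ℕ}
    (hi : i ≤ n) : s ≤ u i := h.left ▸ h.mono (Nat.zero_le i) hi

theorem IsPartition.le_right {s t : ℝ} {n : ℕ} {u : ℕ → ℝ} (h : IsPartition s t n u) {i : ℕ}
    (hi : i ≤ n) : u i ≤ t := h.right ▸ h.mono hi le_rfl

theorem IsPartition.head {s t : ℝ} {n : ℕ} {u : ℕ → ℝ} (h : IsPartition s t n u) {i : ℕ}
    (hi : i ≤ n) : IsPartition s (u i) i u :=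
  ⟨h.left, rfl, fun j hj => h.lt_succ j (by omega)⟩

theorem IsPartition.tail {s t : ℝ} {n : ℕ} {u : ℕ → ℝ} (h : IsPartition s t n u) {i : ℕ}
    (hi : i ≤ n) : IsPartition (u i) t (n - i) (fun k => u (i + k)) :=
  ⟨rfl, by simp only [Nat.add_sub_cancel' hi, h.right], fun j hj => h.lt_succ (i + j) (by omega)⟩

theorem IsPartition.eq_zero {s : ℝ} {n : ℕ} {u : ℕ → ℝ} (h : IsPartition s s n u) : n = 0 := by
  by_contra hn
  have h1 := h.lt_succ 0 (by omega)
  have h2 := h.le_right (i := 1) (by omega)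
  have := h.left
  simp only [zero_add] at h1
  linarith

theorem exists_isPartition {s t : ℝ} (hst : s ≤ t) {δ : ℝ} (hδ : 0 < δ) :
    ∃ (n : ℕ) (u : ℕ → ℝ), IsPartition s t n u ∧ ∀ i < n, u (i + 1) - u i < δ := by
  rcases hst.eq_or_lt with rfl | hlt
  · exact ⟨0, fun _ => s, ⟨rfl, rfl, by simp⟩, by simp⟩
  · obtain ⟨n, hn⟩ := exists_nat_gt ((t - s) / δ)
    have hn0 : (0 : ℝ) < n := lt_trans (div_pos (sub_pos.2 hlt) hδ) hn
    have hd : 0 < (t - s) / n := div_pos (sub_pos.2 hlt) hn0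
    refine ⟨n, fun i => s + i * ((t - s) / n), ⟨by simp, ?_, fun i _ => ?_⟩, fun i _ => ?_⟩
    · field_simp
      ring
    · push_cast
      linarith
    · have : (t - s) / n < δ := by
        rw [div_lt_iff₀ hn0, mul_comm]
        exact (div_lt_iff₀ hδ).1 hn
      push_cast
      linarith

/-- The interval of a partition of `[s,t]` that contains a given point `c ∈ (s,t]`. -/
theorem IsPartition.exists_interval {s t : ℝ} {n : ℕ} {u : ℕ → ℝ} (h : IsPartition s t n u)
    {c : ℝ} (hs : s < c) (ht : c ≤ t) : ∃ i < n, u i < c ∧ c ≤ u (i + 1) := by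
  classical
  have hex : ∃ j, c ≤ u j := ⟨n, by rw [h.right]; exact ht⟩
  have h0 : Nat.find hex ≠ 0 := by
    intro h0
    have := Nat.find_spec hex
    rw [h0, h.left] at this
    linarith
  obtain ⟨i, hi⟩ := Nat.exists_eq_succ_of_ne_zero h0
  have hle : Nat.find hex ≤ n := Nat.find_min' hex (by rw [h.right]; exact ht)
  refine ⟨i, by omega, not_le.1 (Nat.find_min hex (by omega)), ?_⟩
  have := Nat.find_spec hex
  rwa [hi] at this

variable {W : Type*} [NormedAddCommGroup W] [NormedSpace ℝ W] {S : ℝ → W →L[ℝ] W}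

/-- The sum `∑ S(t-v) Ξ_{vu}` over the intervals `[u,v]` of a partition. -/
def partSum (S : ℝ → W →L[ℝ] W) (Ξ : ℝ → ℝ → W) (t : ℝ) (n : ℕ) (u : ℕ → ℝ) : W :=
  ∑ i ∈ Finset.range n, S (t - u (i + 1)) (Ξ (u (i + 1)) (u i))

/-- The defect of additivity `Ξ_{vu} - Ξ_{vm} - S(v-m) Ξ_{mu}`. -/
def defect (S : ℝ → W →L[ℝ] W) (Ξ : ℝ → ℝ → W) (v m u : ℝ) : W :=
  Ξ v u - Ξ v m - S (v - m) (Ξ m u)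

theorem apply_partSum (hS : IsAnalyticSemigroup S) (Ξ : ℝ → ℝ → W) {s t t' : ℝ} {n : ℕ}
    {u : ℕ → ℝ} (h : IsPartition s t n u) (ht : t ≤ t') :
    S (t' - t) (partSum S Ξ t n u) = partSum S Ξ t' n u := by
  simp only [partSum, map_sum]
  refine Finset.sum_congr rfl fun i hi => ?_
  rw [hS.comp_apply (h.le_right (by simpa using hi)) ht]

theorem partSum_split (hS : IsAnalyticSemigroup S) (Ξ : ℝ → ℝ → W) {s t : ℝ} {n : ℕ}
    {u : ℕ → ℝ} (h : IsPartition s t n u) {i : ℕ} (hi : i ≤ n) :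
    partSum S Ξ t n u = S (t - u i) (partSum S Ξ (u i) i u)
      + partSum S Ξ t (n - i) (fun k => u (i + k)) := by
  rw [apply_partSum hS Ξ (h.head hi) (h.le_right hi)]
  simp only [partSum, ← add_assoc]
  rw [← Finset.sum_range_add, Nat.add_sub_cancel' hi]

theorem partSum_split_interval (hS : IsAnalyticSemigroup S) (Ξ : ℝ → ℝ → W) {s t : ℝ} {n : ℕ}
    {u : ℕ → ℝ} (h : IsPartition s t n u) {i : ℕ} (hi : i < n) :
    partSum S Ξ t n u = S (t - u i) (partSum S Ξ (u i) i u)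
      + S (t - u (i + 1)) (Ξ (u (i + 1)) (u i))
      + partSum S Ξ t (n - (i + 1)) (fun k => u (i + 1 + k)) := by
  rw [partSum_split hS Ξ h (i := i + 1) hi, apply_partSum hS Ξ (h.head (i := i + 1) hi)
    (h.le_right hi), apply_partSum hS Ξ (h.head hi.le) (h.le_right hi.le)]
  congr 1
  exact Finset.sum_range_succ _ _

theorem IsPartition.append {s m t : ℝ} {n k : ℕ} {u w : ℕ → ℝ} (h : IsPartition s m n u)
    (h' : IsPartition m t k w) :
    IsPartition s t (n + k) (fun i => if i ≤ n then u i else w (i - n)) := by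
  refine ⟨by simp [h.left], ?_, fun i hi => ?_⟩
  · rcases Nat.eq_zero_or_pos k with rfl | hk
    · simp [h.right, ← h'.left, h'.right]
    · have : ¬ n + k ≤ n := by omega
      simp [this, h'.right]
  · rcases lt_trichotomy i n with hlt | rfl | hgt
    · have h1 : i ≤ n := hlt.le
      have h2 : i + 1 ≤ n := hlt
      simp [h1, h2, h.lt_succ i hlt]
    · have h3 := h'.lt_succ 0 (by omega)
      rw [h'.left] at h3
      simpa [h.right] using h3
    · have h1 : ¬ i ≤ n := by omega
      have h2 : ¬ i + 1 ≤ n := by omega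
      have h3 := h'.lt_succ (i - n) (by omega)
      simp only [h1, h2, if_false]
      rwa [show i + 1 - n = i - n + 1 by omega]

theorem IsPartition.append_mesh_lt {s m t δ : ℝ} {n k : ℕ} {u w : ℕ → ℝ}
    (h : IsPartition s m n u) (h' : IsPartition m t k w) (hδ : ∀ i < n, u (i + 1) - u i < δ)
    (hδ' : ∀ i < k, w (i + 1) - w i < δ) : ∀ i < n + k,
      (fun i => if i ≤ n then u i else w (i - n)) (i + 1)
        - (fun i => if i ≤ n then u i else w (i - n)) i < δ := by
  intro i hi
  rcases lt_trichotomy i n with hlt | rfl | hgt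
  · have e1 : i ≤ n := hlt.le
    have e2 : i + 1 ≤ n := hlt
    simpa [e1, e2] using hδ i hlt
  · simpa [h.right, h'.left] using hδ' 0 (by omega)
  · have e1 : ¬ i ≤ n := by omega
    have e2 : ¬ i + 1 ≤ n := by omega
    have h3 := hδ' (i - n) (by omega)
    simp only [e1, e2, if_false]
    rwa [show i + 1 - n = i - n + 1 by omega]

theorem partSum_append (hS : IsAnalyticSemigroup S) (Ξ : ℝ → ℝ → W) {s m t : ℝ} {n k : ℕ}
    {u w : ℕ → ℝ} (h : IsPartition s m n u) (h' : IsPartition m t k w) :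
    partSum S Ξ t (n + k) (fun i => if i ≤ n then u i else w (i - n))
      = S (t - m) (partSum S Ξ m n u) + partSum S Ξ t k w := by
  have hmt : m ≤ t := by simpa [h'.left] using h'.le_right (Nat.zero_le k)
  rw [partSum_split hS Ξ (h.append h') (Nat.le_add_right n k)]
  simp only [le_refl, if_true, h.right, Nat.add_sub_cancel_left]
  congr 2
  · refine Finset.sum_congr rfl fun i hi => ?_
    have hi' : i < n := by simpa using hi
    have h1 : i ≤ n := hi'.le
    have h2 : i + 1 ≤ n := hi'
    simp only [h1, h2, if_true]
  · funext j
    rcases Nat.eq_zero_or_pos j with rfl | hj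
    · simp [h.right, h'.left]
    · have : ¬ n + j ≤ n := by omega
      simp [this]

/-- Cutting a partition at a point `m`: the partition sums add up, up to the defect of `Ξ` on the
interval that contains `m`. -/
theorem IsPartition.exists_cut (hS : IsAnalyticSemigroup S) (Ξ : ℝ → ℝ → W) {a m b δ : ℝ} {n : ℕ}
    {u : ℕ → ℝ} (h : IsPartition a b n u) (hδ : ∀ i < n, u (i + 1) - u i < δ) (ham : a ≤ m)
    (hmb : m ≤ b) :
    ∃ (n₁ : ℕ) (u₁ : ℕ → ℝ) (n₂ : ℕ) (u₂ : ℕ → ℝ),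
      IsPartition a m n₁ u₁ ∧ (∀ i < n₁, u₁ (i + 1) - u₁ i < δ) ∧
      IsPartition m b n₂ u₂ ∧ (∀ i < n₂, u₂ (i + 1) - u₂ i < δ) ∧
      (partSum S Ξ b n u = S (b - m) (partSum S Ξ m n₁ u₁) + partSum S Ξ b n₂ u₂ ∨
        ∃ p q : ℝ, a ≤ p ∧ p ≤ m ∧ m ≤ q ∧ q ≤ b ∧ q - p < δ ∧
          partSum S Ξ b n u = S (b - m) (partSum S Ξ m n₁ u₁) + partSum S Ξ b n₂ u₂
            + S (b - q) (defect S Ξ q m p)) := by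
  rcases ham.eq_or_lt with rfl | ham
  · refine ⟨0, u, n, u, ⟨h.left, h.left, by simp⟩, by simp, h, hδ, Or.inl ?_⟩
    simp [partSum]
  obtain ⟨i, hin, hi1, hi2⟩ := h.exists_interval ham hmb
  rcases hi2.eq_or_lt with rfl | hi2
  · exact ⟨i + 1, u, n - (i + 1), _, h.head hin, fun j hj => hδ j (by omega), h.tail hin,
      fun j hj => hδ (i + 1 + j) (by omega), Or.inl (partSum_split hS Ξ h hin)⟩
  have hd := hδ i hin
  have hP₁ : IsPartition a m (i + 1) (fun j => if j ≤ i then u j else m) := by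
    refine ⟨by simp [h.left], by simp, fun j hj => ?_⟩
    rcases Nat.lt_succ_iff_lt_or_eq.1 hj with hj | rfl
    · simp [hj.le, Nat.succ_le_of_lt hj, h.lt_succ j (by omega)]
    · simpa using hi1
  have hP₂ : IsPartition m b (n - i) (fun j => if j = 0 then m else u (i + j)) := by
    refine ⟨by simp, ?_, fun j hj => ?_⟩
    · have : n - i ≠ 0 := by omega
      simp only [this, if_false, Nat.add_sub_cancel' hin.le, h.right]
    · rcases Nat.eq_zero_or_pos j with rfl | hj0
      · simpa using hi2
      · simp only [hj0.ne', Nat.add_eq_zero_iff, one_ne_zero, and_false, if_false]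
        exact h.lt_succ (i + j) (by omega)
  refine ⟨_, _, _, _, hP₁, fun j hj => ?_, hP₂, fun j hj => ?_,
    Or.inr ⟨u i, u (i + 1), h.left_le hin.le, hi1.le, hi2.le, h.le_right hin, hd, ?_⟩⟩
  · rcases Nat.lt_succ_iff_lt_or_eq.1 hj with hj | rfl
    · simpa [hj.le, Nat.succ_le_of_lt hj] using hδ j (by omega)
    · simp only [le_refl, if_true, Nat.succ_le_iff, lt_irrefl, if_false]
      linarith
  · rcases Nat.eq_zero_or_pos j with rfl | hj0
    · simp only [zero_add, one_ne_zero, if_false, if_true]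
      linarith
    · simp only [hj0.ne', Nat.add_eq_zero_iff, one_ne_zero, and_false, if_false]
      exact hδ (i + j) (by omega)
  · have e1 : partSum S Ξ m (i + 1) (fun j => if j ≤ i then u j else m)
        = partSum S Ξ m i u + Ξ m (u i) := by
      rw [partSum, Finset.sum_range_succ]
      simp only [le_refl, if_true, Nat.succ_le_iff, lt_irrefl, if_false, sub_self, hS.zero_apply]
      congr 1
      refine Finset.sum_congr rfl fun j hj => ?_
      have hj' : j < i := by simpa using hj
      simp only [hj', hj'.le, if_true]
    have e2 : partSum S Ξ b (n - i) (fun j => if j = 0 then m else u (i + j))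
        = partSum S Ξ b (n - (i + 1)) (fun k => u (i + 1 + k))
          + S (b - u (i + 1)) (Ξ (u (i + 1)) m) := by
      rw [partSum, show n - i = n - (i + 1) + 1 by omega, Finset.sum_range_succ']
      simp only [Nat.add_eq_zero_iff, one_ne_zero, and_false, if_false, if_true, zero_add]
      congr 1
      refine Finset.sum_congr rfl fun j hj => ?_
      rw [show i + (j + 1 + 1) = i + 1 + (j + 1) by omega, show i + (j + 1) = i + 1 + j by omega]
    have hub := h.le_right (i := i + 1) hin
    rw [partSum_split_interval hS Ξ h hin, e1, e2, defect, map_add, map_sub, map_sub,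
      hS.comp_apply hi2.le hub, ← apply_partSum hS Ξ (h.head hin.le) hi1.le,
      hS.comp_apply hi1.le hmb]
    abel

end Partitions

/-! ### Rough integrals -/

section RoughIntegrals

variable {W : Type*} [NormedAddCommGroup W] [NormedSpace ℝ W] {S : ℝ → W →L[ℝ] W}
  {Ξ Ξ' : ℝ → ℝ → W}

theorem hasRoughIntegral_iff {s t : ℝ} {x : W} : HasRoughIntegral S Ξ s t x ↔
    ∀ ε > 0, ∃ δ > 0, ∀ (n : ℕ) (u : ℕ → ℝ), IsPartition s t n u →
      (∀ i < n, u (i + 1) - u i < δ) → ‖partSum S Ξ t n u - x‖ < ε :=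
  Iff.rfl

theorem HasRoughIntegral.congr {s t : ℝ} {x : W} (h : HasRoughIntegral S Ξ s t x)
    (hΞ : ∀ u v : ℝ, s ≤ u → u ≤ v → v ≤ t → Ξ v u = Ξ' v u) : HasRoughIntegral S Ξ' s t x := by
  intro ε hε
  obtain ⟨δ, hδ, H⟩ := h ε hε
  refine ⟨δ, hδ, fun n u hu hm => ?_⟩
  convert H n u hu hm using 4 with i hi
  have hi' : i < n := by simpa using hi
  rw [hΞ _ _ (hu.left_le hi'.le) (hu.lt_succ i hi').le (hu.le_right hi')]

theorem HasRoughIntegral.sub {s t : ℝ} {x x' : W} (h : HasRoughIntegral S Ξ s t x)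
    (h' : HasRoughIntegral S Ξ' s t x') :
    HasRoughIntegral S (fun v u => Ξ v u - Ξ' v u) s t (x - x') := by
  intro ε hε
  obtain ⟨δ, hδ, H⟩ := h (ε / 2) (by positivity)
  obtain ⟨δ', hδ', H'⟩ := h' (ε / 2) (by positivity)
  refine ⟨min δ δ', lt_min hδ hδ', fun n u hu hm => ?_⟩
  have h1 := H n u hu fun i hi => (hm i hi).trans_le (min_le_left _ _)
  have h2 := H' n u hu fun i hi => (hm i hi).trans_le (min_le_right _ _)
  simp only [map_sub, Finset.sum_sub_distrib]
  rw [sub_sub_sub_comm]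
  refine (norm_sub_le _ _).trans_lt ?_
  linarith

theorem HasRoughIntegral.shift {s t τ : ℝ} {x : W}
    (h : HasRoughIntegral S (fun v u => Ξ (v + τ) (u + τ)) s t x) :
    HasRoughIntegral S Ξ (s + τ) (t + τ) x := by
  intro ε hε
  obtain ⟨δ, hδ, H⟩ := h ε hε
  refine ⟨δ, hδ, fun n u hu hm => ?_⟩
  have := H n (fun i => u i - τ) ⟨by simp [hu.left], by simp [hu.right],
    fun i hi => by simpa using hu.lt_succ i hi⟩ (fun i hi => by simpa using hm i hi)
  simpa [sub_add, ← sub_sub, add_sub_assoc, sub_sub_eq_add_sub] using this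

theorem hasRoughIntegral_shift_iff {s t τ : ℝ} {x : W} :
    HasRoughIntegral S (fun v u => Ξ (v + τ) (u + τ)) s t x ↔
      HasRoughIntegral S Ξ (s + τ) (t + τ) x := by
  refine ⟨HasRoughIntegral.shift, fun h => ?_⟩
  have := HasRoughIntegral.shift (S := S) (Ξ := fun v u => Ξ (v + τ) (u + τ)) (s := s + τ)
    (t := t + τ) (τ := -τ) (x := x) (by simpa using h)
  simpa using this

theorem roughIntegral_shift (S : ℝ → W →L[ℝ] W) (Ξ : ℝ → ℝ → W) (s t τ : ℝ) :
    roughIntegral S (fun v u => Ξ (v + τ) (u + τ)) s t = roughIntegral S Ξ (s + τ) (t + τ) := by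
  have : HasRoughIntegral S (fun v u => Ξ (v + τ) (u + τ)) s t
      = HasRoughIntegral S Ξ (s + τ) (t + τ) := funext fun x => propext hasRoughIntegral_shift_iff
  unfold roughIntegral
  rw [this]

theorem HasRoughIntegral.roughIntegral_eq {s t : ℝ} {x : W} (hst : s ≤ t)
    (h : HasRoughIntegral S Ξ s t x) : roughIntegral S Ξ s t = x := by
  have hex : ∃ x, HasRoughIntegral S Ξ s t x := ⟨x, h⟩
  rw [roughIntegral, dif_pos hex]
  exact hex.choose_spec.unique hst h

theorem HasRoughIntegral.eq_zero {s : ℝ} {x : W} (h : HasRoughIntegral S Ξ s s x) : x = 0 :=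
  h.unique le_rfl fun ε hε => ⟨1, one_pos, fun n u hu _ => by
    obtain rfl := hu.eq_zero
    simpa using hε⟩

/-- The integral over `[m,b]` is the increment of the integral from `a`. -/
theorem HasRoughIntegral.of_left (hS : IsAnalyticSemigroup S) {a m b : ℝ} (ham : a ≤ m)
    {x x' : W} (h : HasRoughIntegral S Ξ a b x)
    (h' : HasRoughIntegral S Ξ a m x') : HasRoughIntegral S Ξ m b (x - S (b - m) x') := by
  rw [hasRoughIntegral_iff] at *
  intro ε hε
  have hN : 0 < ‖S (b - m)‖ + 1 := by positivity
  obtain ⟨δ, hδ, H⟩ := h (ε / 2) (by positivity)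
  obtain ⟨δ', hδ', H'⟩ := h' (ε / 2 / (‖S (b - m)‖ + 1)) (by positivity)
  obtain ⟨k, w, hw, hwm⟩ := exists_isPartition ham (lt_min hδ hδ')
  refine ⟨δ, hδ, fun n u hu hm => ?_⟩
  have h2 := H' k w hw fun i hi => (hwm i hi).trans_le (min_le_right _ _)
  have h1 := H _ _ (hw.append hu)
    (hw.append_mesh_lt hu (fun i hi => (hwm i hi).trans_le (min_le_left _ _)) hm)
  rw [partSum_append hS Ξ hw hu] at h1
  have e : partSum S Ξ b n u - (x - S (b - m) x')
      = (S (b - m) (partSum S Ξ m k w) + partSum S Ξ b n u - x)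
        - S (b - m) (partSum S Ξ m k w - x') := by
    rw [map_sub]; abel
  have h3 : ‖S (b - m) (partSum S Ξ m k w - x')‖ ≤ ε / 2 := by
    refine ((S (b - m)).le_opNorm _).trans ?_
    calc _ ≤ (‖S (b - m)‖ + 1) * (ε / 2 / (‖S (b - m)‖ + 1)) := by gcongr; linarith
      _ = ε / 2 := by field_simp
  rw [e]
  refine (norm_sub_le _ _).trans_lt ?_
  linarith

/-- Integrals over adjacent intervals add up, if the defect of the integrand at the common
endpoint is small. -/
theorem HasRoughIntegral.join (hS : IsAnalyticSemigroup S) {a m b : ℝ} (ham : a ≤ m)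
    (hmb : m ≤ b) {x x' : W} (h : HasRoughIntegral S Ξ a m x)
    (h' : HasRoughIntegral S Ξ m b x')
    (hΞ : ∀ ε > 0, ∃ δ > 0, ∀ p q : ℝ, a ≤ p → p ≤ m → m ≤ q → q ≤ b → q - p < δ →
      ‖S (b - q) (defect S Ξ q m p)‖ < ε) :
    HasRoughIntegral S Ξ a b (S (b - m) x + x') := by
  intro ε hε
  have hN : 0 < ‖S (b - m)‖ + 1 := by positivity
  obtain ⟨δ₁, hδ₁, H₁⟩ := h (ε / 3 / (‖S (b - m)‖ + 1)) (by positivity)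
  obtain ⟨δ₂, hδ₂, H₂⟩ := h' (ε / 3) (by positivity)
  obtain ⟨δ₃, hδ₃, H₃⟩ := hΞ (ε / 3) (by positivity)
  refine ⟨min δ₁ (min δ₂ δ₃), by positivity, fun n u hu hm => ?_⟩
  obtain ⟨n₁, u₁, n₂, u₂, hu₁, hm₁, hu₂, hm₂, hsum⟩ := hu.exists_cut hS Ξ hm ham hmb
  have h1 := H₁ n₁ u₁ hu₁ fun i hi => (hm₁ i hi).trans_le (min_le_left _ _)
  have h2 := H₂ n₂ u₂ hu₂ fun i hi =>
    (hm₂ i hi).trans_le ((min_le_right _ _).trans (min_le_left _ _))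
  change ‖partSum S Ξ m n₁ u₁ - x‖ < _ at h1
  change ‖partSum S Ξ b n₂ u₂ - x'‖ < _ at h2
  change ‖partSum S Ξ b n u - _‖ < _
  have h3 : ‖S (b - m) (partSum S Ξ m n₁ u₁ - x)‖ ≤ ε / 3 := by
    refine ((S (b - m)).le_opNorm _).trans ?_
    calc _ ≤ (‖S (b - m)‖ + 1) * (ε / 3 / (‖S (b - m)‖ + 1)) := by gcongr; linarith
      _ = ε / 3 := by field_simp
  rcases hsum with hsum | ⟨p, q, hp, hpm, hmq, hq, hpq, hsum⟩
  · have e : partSum S Ξ b n u - (S (b - m) x + x')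
        = S (b - m) (partSum S Ξ m n₁ u₁ - x) + (partSum S Ξ b n₂ u₂ - x') := by
      rw [hsum, map_sub]; abel
    rw [e]
    refine (norm_add_le _ _).trans_lt ?_
    linarith
  · have e : partSum S Ξ b n u - (S (b - m) x + x')
        = S (b - m) (partSum S Ξ m n₁ u₁ - x) + (partSum S Ξ b n₂ u₂ - x')
          + S (b - q) (defect S Ξ q m p) := by
      rw [hsum, map_sub]; abel
    have h4 := H₃ p q hp hpm hmq hq
      (hpq.trans_le ((min_le_right _ _).trans (min_le_right _ _)))
    rw [e]
    refine (norm_add₃_le).trans_lt ?_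
    linarith

end RoughIntegrals

/-! ### The sewing lemma -/

section Sewing

variable {W : Type*} [NormedAddCommGroup W] [NormedSpace ℝ W] {S : ℝ → W →L[ℝ] W}
  {Ξ Φ : ℝ → ℝ → W}

/-- The maximal inequality of the sewing lemma. The induction on the number of intervals singles
out the interval that contains the midpoint of `[s,t]`: the intervals to its left and to its
right fill at most one half of `[s,t]` each. -/
theorem IsPartition.norm_partSum_sub_le (hS : IsAnalyticSemigroup S) {a b C μ : ℝ} (hμ : 1 < μ)
    (hC : 0 ≤ C)
    (hΞ : ∀ u m v : ℝ, a ≤ u → u ≤ m → m ≤ v → v ≤ b →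
      ‖S (b - v) (defect S Ξ v m u)‖ ≤ C * (v - u) ^ μ) {n : ℕ} :
    ∀ {s t : ℝ} {u : ℕ → ℝ}, a ≤ s → t ≤ b → IsPartition s t n u →
      ‖S (b - t) (partSum S Ξ t n u - Ξ t s)‖ ≤ 2 * C / (1 - 2 ^ (1 - μ)) * (t - s) ^ μ := by
  have hq : (2 : ℝ) ^ (1 - μ) < 1 := Real.rpow_lt_one_of_one_lt_of_neg (by norm_num) (by linarith)
  set K := 2 * C / (1 - 2 ^ (1 - μ)) with hK
  have hK0 : 0 ≤ K := div_nonneg (by linarith) (by linarith)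
  induction n using Nat.strong_induction_on with
  | _ n ih =>
  intro s t u has htb hu
  rcases Nat.eq_zero_or_pos n with rfl | hn
  · obtain rfl : s = t := hu.left.symm.trans hu.right
    have := hΞ s s s has le_rfl le_rfl htb
    have e : defect S Ξ s s s = - Ξ s s := by simp [defect, hS.zero_apply]
    rw [e] at this
    simpa [partSum, Real.zero_rpow (by linarith : μ ≠ 0)] using this
  have hst : s < t := by
    have h1 := hu.lt_succ 0 hn
    rw [hu.left] at h1
    exact h1.trans_le (hu.le_right hn)
  obtain ⟨i, hin, hi1, hi2⟩ := hu.exists_interval (c := (s + t) / 2) (by linarith) (by linarith)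
  have hsi := hu.left_le hin.le
  have hjt := hu.le_right (i := i + 1) hin
  have hij := hu.lt_succ i hin
  have e : S (b - t) (partSum S Ξ t n u - Ξ t s)
      = S (b - u i) (partSum S Ξ (u i) i u - Ξ (u i) s)
        + S (b - t) (partSum S Ξ t (n - (i + 1)) (fun k => u (i + 1 + k)) - Ξ t (u (i + 1)))
        - S (b - t) (defect S Ξ t (u i) s) - S (b - t) (defect S Ξ t (u (i + 1)) (u i)) := by
    rw [← hS.comp_apply (by linarith : u i ≤ t) htb, ← map_add, ← map_sub, ← map_sub,
      partSum_split_interval hS Ξ hu hin, map_sub (S (t - u i))]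
    simp only [defect]
    congr 1
    abel
  have h1 := ih i hin has (by linarith) (hu.head hin.le)
  have h2 := ih (n - (i + 1)) (by omega) (by linarith : a ≤ u (i + 1)) htb (hu.tail hin)
  have h3 := hΞ s (u i) t has hsi (by linarith) htb
  have h4 := hΞ (u i) (u (i + 1)) t (by linarith) hij.le hjt htb
  have hd : 0 < t - s := sub_pos.2 hst
  have b1 : (u i - s) ^ μ ≤ ((t - s) / 2) ^ μ :=
    Real.rpow_le_rpow (by linarith) (by linarith) (by linarith)
  have b2 : (t - u (i + 1)) ^ μ ≤ ((t - s) / 2) ^ μ :=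
    Real.rpow_le_rpow (by linarith) (by linarith) (by linarith)
  have b3 : (t - u i) ^ μ ≤ (t - s) ^ μ :=
    Real.rpow_le_rpow (by linarith) (by linarith) (by linarith)
  have hhalf : ((t - s) / 2) ^ μ = (t - s) ^ μ * (2 ^ (1 - μ) / 2) := by
    rw [Real.div_rpow hd.le (by norm_num), Real.rpow_sub (by norm_num), Real.rpow_one]
    field_simp
  rw [e]
  calc _ ≤ K * (u i - s) ^ μ + K * (t - u (i + 1)) ^ μ + C * (t - s) ^ μ + C * (t - u i) ^ μ :=
        (norm_sub_le _ _).trans (add_le_add ((norm_sub_le _ _).trans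
          (add_le_add ((norm_add_le _ _).trans (add_le_add h1 h2)) h3)) h4)
    _ ≤ K * ((t - s) / 2) ^ μ + K * ((t - s) / 2) ^ μ + C * (t - s) ^ μ + C * (t - s) ^ μ := by
        gcongr
    _ = (K * 2 ^ (1 - μ) + 2 * C) * (t - s) ^ μ := by rw [hhalf]; ring
    _ = K * (t - s) ^ μ := by
        congr 1
        rw [hK]
        have : (1 : ℝ) - 2 ^ (1 - μ) ≠ 0 := by linarith
        field_simp
        ring

theorem HasRoughIntegral.norm_sub_le (hS : IsAnalyticSemigroup S) {a b C μ : ℝ} (hμ : 1 < μ)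
    (hC : 0 ≤ C) (hab : a ≤ b)
    (hΞ : ∀ u m v : ℝ, a ≤ u → u ≤ m → m ≤ v → v ≤ b →
      ‖S (b - v) (defect S Ξ v m u)‖ ≤ C * (v - u) ^ μ) {x : W}
    (hx : HasRoughIntegral S Ξ a b x) :
    ‖x - Ξ b a‖ ≤ 2 * C / (1 - 2 ^ (1 - μ)) * (b - a) ^ μ := by
  refine le_of_forall_pos_le_add fun ε hε => ?_
  obtain ⟨δ, hδ, H⟩ := hx ε hε
  obtain ⟨n, u, hu, hm⟩ := exists_isPartition hab hδ
  have h1 := H n u hu hm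
  change ‖partSum S Ξ b n u - x‖ < _ at h1
  have h2 := hu.norm_partSum_sub_le hS hμ hC hΞ le_rfl le_rfl
  rw [sub_self, hS.zero_apply] at h2
  calc ‖x - Ξ b a‖ = ‖(partSum S Ξ b n u - Ξ b a) - (partSum S Ξ b n u - x)‖ := by congr 1; abel
    _ ≤ ‖partSum S Ξ b n u - Ξ b a‖ + ‖partSum S Ξ b n u - x‖ := _root_.norm_sub_le _ _
    _ ≤ _ := by linarith

/-- A partition sum of mesh `η` is, up to `O(η^(μ-1))`, close to all sufficiently fine partition
sums: a fine partition can be cut at the points of the given one with negligible error, and the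
maximal inequality applies to the pieces. -/
theorem IsPartition.norm_partSum_sub_partSum_le (hS : IsAnalyticSemigroup S) {a b C μ η : ℝ}
    (hμ : 1 < μ) (hC : 0 ≤ C)
    (hΞ : ∀ u m v : ℝ, a ≤ u → u ≤ m → m ≤ v → v ≤ b →
      ‖S (b - v) (defect S Ξ v m u)‖ ≤ C * (v - u) ^ μ) {n : ℕ} :
    ∀ {t : ℝ} {u : ℕ → ℝ}, t ≤ b → IsPartition a t n u → (∀ i < n, u (i + 1) - u i ≤ η) →
      ∀ ε > 0, ∃ δ > 0, ∀ (k : ℕ) (w : ℕ → ℝ), IsPartition a t k w →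
        (∀ i < k, w (i + 1) - w i < δ) →
        ‖S (b - t) (partSum S Ξ t k w - partSum S Ξ t n u)‖
          ≤ 2 * C / (1 - 2 ^ (1 - μ)) * η ^ (μ - 1) * (t - a) + ε := by
  have hq : (2 : ℝ) ^ (1 - μ) < 1 := Real.rpow_lt_one_of_one_lt_of_neg (by norm_num) (by linarith)
  have hK0 : 0 ≤ 2 * C / (1 - 2 ^ (1 - μ)) := div_nonneg (by linarith) (by linarith)
  set K := 2 * C / (1 - 2 ^ (1 - μ)) with hK
  induction n with
  | zero =>
    intro t u htb hu _ ε hε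
    obtain rfl : a = t := hu.left.symm.trans hu.right
    refine ⟨1, one_pos, fun k w hw _ => ?_⟩
    obtain rfl := hw.eq_zero
    simpa [partSum] using hε.le
  | succ n ih =>
    intro t u htb hu hm ε hε
    have hat : a ≤ u n := hu.left_le (by omega)
    have htn : u n < t := by simpa [hu.right] using hu.lt_succ n (by omega)
    have hmn : t - u n ≤ η := by simpa [hu.right] using hm n (by omega)
    obtain ⟨δ₁, hδ₁, H₁⟩ := ih (by linarith : u n ≤ b) (hu.head (by omega))
      (fun i hi => hm i (by omega)) (ε / 2) (by positivity)
    obtain ⟨δ₂, hδ₂, H₂⟩ : ∃ δ > 0, C * δ ^ μ ≤ ε / 2 := by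
      refine ⟨(ε / 2 / (C + 1)) ^ (1 / μ), by positivity, ?_⟩
      rw [← Real.rpow_mul (by positivity), one_div_mul_cancel (by linarith), Real.rpow_one,
        mul_div_assoc', div_le_iff₀ (by linarith)]
      nlinarith
    refine ⟨min δ₁ δ₂, lt_min hδ₁ hδ₂, fun k w hw hwm => ?_⟩
    obtain ⟨n₁, u₁, n₂, u₂, hu₁, hm₁, hu₂, hm₂, hsum⟩ := hw.exists_cut hS Ξ hwm hat htn.le
    have h1 := H₁ n₁ u₁ hu₁ fun i hi => (hm₁ i hi).trans_le (min_le_left _ _)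
    have h2 := hu₂.norm_partSum_sub_le hS hμ hC hΞ hat htb
    have hpow : (t - u n) ^ μ ≤ η ^ (μ - 1) * (t - u n) := by
      have h0 : 0 < t - u n := sub_pos.2 htn
      calc (t - u n) ^ μ = (t - u n) ^ (μ - 1) * (t - u n) := by
            rw [Real.rpow_sub_one h0.ne']; field_simp
        _ ≤ _ := by gcongr
    have eP : partSum S Ξ t (n + 1) u = S (t - u n) (partSum S Ξ (u n) n u) + Ξ t (u n) := by
      rw [partSum_split_interval hS Ξ hu (Nat.lt_succ_self n)]
      simp [partSum, hu.right, hS.zero_apply]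
    have hmain : ‖S (b - u n) (partSum S Ξ (u n) n₁ u₁ - partSum S Ξ (u n) n u)‖
        + ‖S (b - t) (partSum S Ξ t n₂ u₂ - Ξ t (u n))‖
        ≤ K * η ^ (μ - 1) * (t - a) + ε / 2 := by
      refine (add_le_add h1 (h2.trans (mul_le_mul_of_nonneg_left hpow hK0))).trans (le_of_eq ?_)
      ring
    rcases hsum with hsum | ⟨p, q, hp, hpm, hmq, hq, hpq, hsum⟩
    · have e : S (b - t) (partSum S Ξ t k w - partSum S Ξ t (n + 1) u)
          = S (b - u n) (partSum S Ξ (u n) n₁ u₁ - partSum S Ξ (u n) n u)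
            + S (b - t) (partSum S Ξ t n₂ u₂ - Ξ t (u n)) := by
        rw [← hS.comp_apply htn.le htb, ← map_add, hsum, eP, map_sub (S (t - u n))]
        congr 1
        abel
      rw [e]
      refine (norm_add_le _ _).trans ?_
      linarith
    · have e : S (b - t) (partSum S Ξ t k w - partSum S Ξ t (n + 1) u)
          = S (b - u n) (partSum S Ξ (u n) n₁ u₁ - partSum S Ξ (u n) n u)
            + S (b - t) (partSum S Ξ t n₂ u₂ - Ξ t (u n)) + S (b - q) (defect S Ξ q (u n) p) := by
        rw [← hS.comp_apply htn.le htb, ← hS.comp_apply hq htb, ← map_add, ← map_add, hsum, eP,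
          map_sub (S (t - u n))]
        congr 1
        abel
      have h3 : ‖S (b - q) (defect S Ξ q (u n) p)‖ ≤ ε / 2 := by
        refine (hΞ p (u n) q hp hpm hmq (hq.trans htb)).trans (le_trans ?_ H₂)
        have : q - p ≤ δ₂ := (hpq.trans_le (min_le_right _ _)).le
        have hqp : 0 ≤ q - p := by linarith
        gcongr
      rw [e]
      refine (norm_add_le _ _).trans ?_
      have := norm_add_le (S (b - u n) (partSum S Ξ (u n) n₁ u₁ - partSum S Ξ (u n) n u))
        (S (b - t) (partSum S Ξ t n₂ u₂ - Ξ t (u n)))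
      linarith

/-- The sewing lemma: existence of the rough integral. -/
theorem exists_hasRoughIntegral [CompleteSpace W] (hS : IsAnalyticSemigroup S) {a b C μ : ℝ}
    (hμ : 1 < μ) (hC : 0 ≤ C) (hab : a ≤ b)
    (hΞ : ∀ u m v : ℝ, a ≤ u → u ≤ m → m ≤ v → v ≤ b →
      ‖S (b - v) (defect S Ξ v m u)‖ ≤ C * (v - u) ^ μ) :
    ∃ x : W, HasRoughIntegral S Ξ a b x := by
  have hq : (2 : ℝ) ^ (1 - μ) < 1 := Real.rpow_lt_one_of_one_lt_of_neg (by norm_num) (by linarith)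
  have hK0 : 0 ≤ 2 * C / (1 - 2 ^ (1 - μ)) := div_nonneg (by linarith) (by linarith)
  set K := 2 * C / (1 - 2 ^ (1 - μ)) with hK
  have hcauchy : ∀ ε > 0, ∃ η > 0, ∀ (n : ℕ) (u : ℕ → ℝ) (n' : ℕ) (u' : ℕ → ℝ),
      IsPartition a b n u → (∀ i < n, u (i + 1) - u i < η) →
      IsPartition a b n' u' → (∀ i < n', u' (i + 1) - u' i < η) →
      dist (partSum S Ξ b n u) (partSum S Ξ b n' u') < ε := by
    intro ε hε
    obtain ⟨η, hη, Hη⟩ : ∃ η > 0, K * η ^ (μ - 1) * (b - a) ≤ ε / 8 := by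
      have hc : 0 ≤ K * (b - a) := mul_nonneg hK0 (sub_nonneg.2 hab)
      refine ⟨(ε / 8 / (K * (b - a) + 1)) ^ (1 / (μ - 1)), by positivity, ?_⟩
      rw [← Real.rpow_mul (by positivity), one_div_mul_cancel (by linarith), Real.rpow_one,
        mul_div_assoc', div_mul_eq_mul_div, div_le_iff₀ (by linarith)]
      nlinarith
    refine ⟨η, hη, fun n u n' u' hu hm hu' hm' => ?_⟩
    obtain ⟨δ, hδ, H⟩ := hu.norm_partSum_sub_partSum_le hS hμ hC hΞ le_rfl
      (fun i hi => (hm i hi).le) (ε / 8) (by positivity)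
    obtain ⟨δ', hδ', H'⟩ := hu'.norm_partSum_sub_partSum_le hS hμ hC hΞ le_rfl
      (fun i hi => (hm' i hi).le) (ε / 8) (by positivity)
    obtain ⟨k, w, hw, hwm⟩ := exists_isPartition hab (lt_min hδ hδ')
    have h1 := H k w hw fun i hi => (hwm i hi).trans_le (min_le_left _ _)
    have h2 := H' k w hw fun i hi => (hwm i hi).trans_le (min_le_right _ _)
    rw [sub_self, hS.zero_apply, ← dist_eq_norm] at h1 h2
    have := dist_triangle_left (partSum S Ξ b n u) (partSum S Ξ b n' u') (partSum S Ξ b k w)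
    linarith
  choose n u hu hm using fun k : ℕ => exists_isPartition hab (Nat.one_div_pos_of_nat (n := k))
  have hseq : CauchySeq fun k => partSum S Ξ b (n k) (u k) := by
    refine Metric.cauchySeq_iff'.2 fun ε hε => ?_
    obtain ⟨η, hη, H⟩ := hcauchy ε hε
    obtain ⟨N, hN⟩ := exists_nat_one_div_lt hη
    refine ⟨N, fun k hk => H _ _ _ _ (hu k) (fun i hi => (hm k i hi).trans_le ?_) (hu N)
      (fun i hi => (hm N i hi).trans hN)⟩
    exact (Nat.one_div_le_one_div hk).trans hN.le
  obtain ⟨x, hx⟩ := cauchySeq_tendsto_of_complete hseq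
  refine ⟨x, fun ε hε => ?_⟩
  obtain ⟨η, hη, H⟩ := hcauchy (ε / 2) (by positivity)
  obtain ⟨N, hN⟩ := exists_nat_one_div_lt hη
  refine ⟨η, hη, fun k w hw hwm => ?_⟩
  change ‖partSum S Ξ b k w - x‖ < ε
  rw [← dist_eq_norm]
  have h1 : dist (partSum S Ξ b k w) x ≤ ε / 2 := by
    refine le_of_tendsto (tendsto_const_nhds.dist hx) ?_
    filter_upwards [eventually_ge_atTop N] with j hj
    refine (H _ _ _ _ hw hwm (hu j) fun i hi => (hm j i hi).trans_le ?_).le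
    exact (Nat.one_div_le_one_div hj).trans hN.le
  linarith

/-- An additive `Φ` is the rough integral of all `Ξ` with `Ξ - Φ = O((v-u)^μ)`, `μ > 1`. -/
theorem hasRoughIntegral_of_additive (hS : IsAnalyticSemigroup S) {a b C M μ : ℝ} (hμ : 1 < μ)
    (hab : a ≤ b) (hM0 : 0 ≤ M) (hM : ∀ t : ℝ, 0 ≤ t → t ≤ b - a → ‖S t‖ ≤ M)
    (hΦ : ∀ u m v : ℝ, a ≤ u → u ≤ m → m ≤ v → v ≤ b → Φ v u = Φ v m + S (v - m) (Φ m u))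
    (hC : 0 ≤ C)
    (hΞ : ∀ u v : ℝ, a ≤ u → u ≤ v → v ≤ b → ‖Ξ v u - Φ v u‖ ≤ C * (v - u) ^ μ) :
    HasRoughIntegral S Ξ a b (Φ b a) := by
  have haa : Φ a a = 0 := by
    have := hΦ a a a le_rfl le_rfl le_rfl hab
    rw [sub_self, hS.zero_apply] at this
    simpa using this
  have hsum : ∀ (n : ℕ) (t : ℝ) (u : ℕ → ℝ), t ≤ b → IsPartition a t n u →
      partSum S Φ t n u = Φ t a := by
    intro n
    induction n with
    | zero =>
      intro t u htb hu
      obtain rfl : a = t := hu.left.symm.trans hu.right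
      simp [partSum, haa]
    | succ n ih =>
      intro t u htb hu
      have htn : u n < t := by simpa [hu.right] using hu.lt_succ n (by omega)
      rw [partSum_split_interval hS Φ hu (Nat.lt_succ_self n),
        ih (u n) u (by linarith) (hu.head (by omega)), hu.right,
        hΦ a (u n) t le_rfl (hu.left_le (by omega)) htn.le htb]
      simp [partSum, hS.zero_apply, add_comm]
  intro ε hε
  have hc : 0 ≤ M * C * (b - a) := mul_nonneg (mul_nonneg hM0 hC) (sub_nonneg.2 hab)
  obtain ⟨η, hη, Hη⟩ : ∃ η > 0, M * C * (b - a) * η ^ (μ - 1) < ε := by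
    refine ⟨(ε / (M * C * (b - a) + 1)) ^ (1 / (μ - 1)), by positivity, ?_⟩
    rw [← Real.rpow_mul (by positivity), one_div_mul_cancel (by linarith), Real.rpow_one,
      mul_div_assoc', div_lt_iff₀ (by linarith)]
    nlinarith
  refine ⟨η, hη, fun n u hu hm => lt_of_le_of_lt ?_ Hη⟩
  rw [← hsum n b u le_rfl hu, partSum, ← Finset.sum_sub_distrib]
  calc _ ≤ ∑ i ∈ Finset.range n, M * C * η ^ (μ - 1) * (u (i + 1) - u i) := by
        refine norm_sum_le_of_le _ fun i hi => ?_
        have hi' : i < n := by simpa using hi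
        have h1 := hu.left_le hi'.le
        have h2 := hu.lt_succ i hi'
        have h3 := hu.le_right (i := i + 1) hi'
        have h0 : 0 < u (i + 1) - u i := sub_pos.2 h2
        rw [← map_sub]
        calc _ ≤ M * (C * (u (i + 1) - u i) ^ μ) :=
              (S _).le_of_opNorm_le_of_le (hM _ (by linarith) (by linarith))
                (hΞ _ _ h1 h2.le h3)
          _ = M * (C * ((u (i + 1) - u i) ^ (μ - 1) * (u (i + 1) - u i))) := by
              rw [Real.rpow_sub_one h0.ne']; field_simp
          _ ≤ M * (C * (η ^ (μ - 1) * (u (i + 1) - u i))) := by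
              have := (hm i hi').le
              gcongr
          _ = _ := by ring
    _ = M * C * (b - a) * η ^ (μ - 1) := by
        rw [← Finset.mul_sum, Finset.sum_range_sub, hu.left, hu.right]; ring

end Sewing

/-! ### Singular integrals -/

section SingularIntegrals

variable {X : Type*} [NormedAddCommGroup X] [NormedSpace ℝ X]

theorem intervalIntegrable_of_norm_le_sub_rpow {f : ℝ → X} {s t K γ : ℝ} (hst : s ≤ t)
    (hγ : 0 < γ) (hf : ContinuousOn f (Ioo s t))
    (hb : ∀ r ∈ Ioo s t, ‖f r‖ ≤ K * (t - r) ^ (γ - 1)) :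
    IntervalIntegrable f volume s t ∧ ‖∫ r in s..t, f r‖ ≤ K / γ * (t - s) ^ γ := by
  have hg : IntervalIntegrable (fun r : ℝ => K * (t - r) ^ (γ - 1)) volume s t := by
    have h0 : IntervalIntegrable (fun r : ℝ => r ^ (γ - 1)) volume (t - s) 0 :=
      intervalIntegral.intervalIntegrable_rpow' (by linarith)
    have := (h0.comp_sub_left t).const_mul K
    simpa using this
  have hae : ∀ᵐ r ∂(volume.restrict (Ioo s t)), ‖f r‖ ≤ K * (t - r) ^ (γ - 1) :=
    (ae_restrict_iff' measurableSet_Ioo).2 (.of_forall hb)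
  have hg' := (intervalIntegrable_iff_integrableOn_Ioo_of_le hst).1 hg
  refine ⟨(intervalIntegrable_iff_integrableOn_Ioo_of_le hst).2
    (hg'.mono' (hf.aestronglyMeasurable measurableSet_Ioo) hae), ?_⟩
  rw [intervalIntegral.integral_of_le hst, integral_Ioc_eq_integral_Ioo]
  refine (norm_integral_le_of_norm_le hg' hae).trans (le_of_eq ?_)
  rw [← integral_Ioc_eq_integral_Ioo, ← intervalIntegral.integral_of_le hst,
    intervalIntegral.integral_const_mul,
    intervalIntegral.integral_comp_sub_left (fun r : ℝ => r ^ (γ - 1)) t,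
    integral_rpow (Or.inl (by linarith))]
  simp [Real.zero_rpow hγ.ne']
  ring

theorem intervalIntegrable_of_norm_le_rpow_sub {f : ℝ → X} {s t K γ : ℝ} (hst : s ≤ t)
    (hγ : 0 < γ) (hf : ContinuousOn f (Ioo s t))
    (hb : ∀ r ∈ Ioo s t, ‖f r‖ ≤ K * (r - s) ^ (γ - 1)) :
    IntervalIntegrable f volume s t ∧ ‖∫ r in s..t, f r‖ ≤ K / γ * (t - s) ^ γ := by
  have hmaps : MapsTo (fun r : ℝ => s + t - r) (Ioo s t) (Ioo s t) := fun r hr =>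
    ⟨by simp only; linarith [hr.2], by simp only; linarith [hr.1]⟩
  obtain ⟨h1, h2⟩ := intervalIntegrable_of_norm_le_sub_rpow (f := fun r => f (s + t - r)) hst hγ
    (hf.comp (by fun_prop) hmaps) (fun r hr => by
      have := hb _ (hmaps hr)
      rwa [show s + t - r - s = t - r by ring] at this)
  refine ⟨?_, ?_⟩
  · have := h1.comp_sub_left (s + t)
    simpa using this.symm
  · rwa [intervalIntegral.integral_comp_sub_left f (s + t), add_sub_cancel_right,
      add_sub_cancel_left] at h2

end SingularIntegrals

/-! ### The convolution `ω^S` -/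

section Convolution

variable {V W : Type*} [NormedAddCommGroup V] [NormedSpace ℝ V]
  [NormedAddCommGroup W] [NormedSpace ℝ W] {S : ℝ → W →L[ℝ] W} {ω : ℝ → V}

/-- `‖A S(h) x‖ ≤ N h^(γ-1)` on `(0, L]`: a bound in the real interpolation space between `W` and
`D(A)` with parameters `(γ, ∞)`. -/
def IsRegular (S : ℝ → W →L[ℝ] W) (γ L N : ℝ) (x : W) : Prop :=
  ∀ h : ℝ, 0 < h → h ≤ L → ‖deriv S h x‖ ≤ N * h ^ (γ - 1)

/-- The operator norm version of `IsRegular`. -/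
def IsRegularOp (S : ℝ → W →L[ℝ] W) (γ L N : ℝ) (K : V →L[ℝ] W) : Prop :=
  ∀ v : V, IsRegular S γ L (N * ‖v‖) (K v)

/-- An analytic semigroup together with an `α`-Hölder path on `[0,T]`, with constants. The
semigroup is bounded on the horizon `2T`, since the times of two increments may add up. -/
structure Driven (S : ℝ → W →L[ℝ] W) (ω : ℝ → V) (α M C T : ℝ) : Prop where
  semigroup : IsAnalyticSemigroup S
  bound : SemigroupBound S M (2 * T)
  pos : 0 < α
  lt_one : α < 1
  nonneg : 0 ≤ C
  holder : ∀ s t : ℝ, 0 ≤ s → s ≤ t → t ≤ T → ‖ω t - ω s‖ ≤ C * (t - s) ^ α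

theorem SemigroupBound.isRegularOp {M L : ℝ} (hM : SemigroupBound S M L) (K : V →L[ℝ] W) :
    IsRegularOp S 0 L (M * ‖K‖) K := by
  intro v h hh hhL
  rw [zero_sub, Real.rpow_neg_one]
  calc _ ≤ M / h * (‖K‖ * ‖v‖) :=
        (deriv S h).le_of_opNorm_le_of_le (hM.deriv_le h hh hhL) (K.le_opNorm v)
    _ = _ := by ring

theorem continuousOn_of_holder {X : Type*} [NormedAddCommGroup X] {f : ℝ → X} {a b C α : ℝ}
    (hα : 0 < α) (hf : ∀ s t : ℝ, a ≤ s → s ≤ t → t ≤ b → ‖f t - f s‖ ≤ C * (t - s) ^ α) :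
    ContinuousOn f (Icc a b) := by
  intro t ht
  have hb : ∀ s ∈ Icc a b, ‖f s - f t‖ ≤ C * |s - t| ^ α := by
    intro s hs
    rcases le_total s t with h | h
    · rw [norm_sub_rev, abs_sub_comm, abs_of_nonneg (sub_nonneg.2 h)]
      exact hf s t hs.1 h ht.2
    · rw [abs_of_nonneg (sub_nonneg.2 h)]
      exact hf t s ht.1 h hs.2
  have hlim : Tendsto (fun s => C * |s - t| ^ α) (𝓝[Icc a b] t) (𝓝 0) := by
    have : Tendsto (fun s : ℝ => C * |s - t| ^ α) (𝓝 t) (𝓝 (C * |t - t| ^ α)) := by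
      refine Tendsto.const_mul _ (Tendsto.rpow_const ?_ (Or.inr hα.le))
      exact (continuous_abs.comp (continuous_id.sub continuous_const)).tendsto t
    simpa [Real.zero_rpow hα.ne'] using this.mono_left nhdsWithin_le_nhds
  rw [ContinuousWithinAt, tendsto_iff_norm_sub_tendsto_zero]
  refine squeeze_zero' (.of_forall fun _ => norm_nonneg _) ?_ hlim
  filter_upwards [self_mem_nhdsWithin] with s hs using hb s hs

namespace Driven

variable {α M C T : ℝ}

omit [NormedSpace ℝ V] in
theorem continuousOn_path (d : Driven S ω α M C T) : ContinuousOn ω (Icc 0 T) :=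
  continuousOn_of_holder d.pos d.holder

omit [NormedSpace ℝ V] in
theorem continuousOn_deriv_sub (d : Driven S ω α M C T) (s t : ℝ) :
    ContinuousOn (fun r => deriv S (t - r)) (Ioo s t) :=
  d.semigroup.continuousOn_deriv.comp (by fun_prop) fun r hr => sub_pos.2 hr.2

theorem integrable_kernel (d : Driven S ω α M C T) {s t : ℝ} (hs : 0 ≤ s) (hst : s ≤ t)
    (ht : t ≤ T) :
    IntervalIntegrable
      (fun r => (deriv S (t - r)).comp (ContinuousLinearMap.apply ℝ W (ω t - ω r))) volume s t ∧
    ‖∫ r in s..t, (deriv S (t - r)).comp (ContinuousLinearMap.apply ℝ W (ω t - ω r))‖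
      ≤ M * C / α * (t - s) ^ α := by
  refine intervalIntegrable_of_norm_le_sub_rpow hst d.pos ?_ fun r hr => ?_
  · refine (d.continuousOn_deriv_sub s t).clm_comp ?_
    refine (ContinuousLinearMap.apply ℝ W).continuous.comp_continuousOn ?_
    exact continuousOn_const.sub (d.continuousOn_path.mono
      fun r hr => ⟨by linarith [hr.1], by linarith [hr.2]⟩)
  · have h0 : 0 < t - r := sub_pos.2 hr.2
    have hM := d.bound.nonneg
    have hC := d.nonneg
    have h1 := d.bound.deriv_le (t - r) h0 (by linarith [hr.1])
    have h2 := d.holder r t (by linarith [hr.1]) hr.2.le ht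
    refine ContinuousLinearMap.opNorm_le_bound _ (by positivity) fun K => ?_
    calc _ ≤ M / (t - r) * (‖K‖ * (C * (t - r) ^ α)) :=
          (deriv S (t - r)).le_of_opNorm_le_of_le h1 (K.le_of_opNorm_le_of_le le_rfl h2)
      _ = _ := by rw [Real.rpow_sub_one h0.ne']; field_simp

theorem integrable_kernel_apply (d : Driven S ω α M C T) {s t : ℝ} (hs : 0 ≤ s) (hst : s ≤ t)
    (ht : t ≤ T) (K : V →L[ℝ] W) :
    IntervalIntegrable (fun r => deriv S (t - r) (K (ω t - ω r))) volume s t :=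
  (intervalIntegrable_iff_integrableOn_Ioc_of_le hst).2
    ((ContinuousLinearMap.apply ℝ W K).integrable_comp
      ((intervalIntegrable_iff_integrableOn_Ioc_of_le hst).1 (d.integrable_kernel hs hst ht).1))

theorem omegaS_apply [CompleteSpace W] (d : Driven S ω α M C T) {s t : ℝ} (hs : 0 ≤ s)
    (hst : s ≤ t) (ht : t ≤ T) (K : V →L[ℝ] W) :
    omegaS S ω t s K = S (t - s) (K (ω t - ω s))
      - ∫ r in s..t, deriv S (t - r) (K (ω t - ω r)) := by
  have h := d.integrable_kernel hs hst ht
  exact congrArg (fun x => S (t - s) (K (ω t - ω s)) - x)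
    (ContinuousLinearMap.intervalIntegral_apply h.1 K)

theorem norm_omegaS_le [CompleteSpace W] (d : Driven S ω α M C T) {s t : ℝ} (hs : 0 ≤ s)
    (hst : s ≤ t) (ht : t ≤ T) :
    ‖omegaS S ω t s‖ ≤ (M * C + M * C / α) * (t - s) ^ α := by
  have hM := d.bound.nonneg
  have hC := d.nonneg
  rw [omegaS, add_mul]
  refine (norm_sub_le _ _).trans (add_le_add ?_ (d.integrable_kernel hs hst ht).2)
  have h0 : 0 ≤ t - s := sub_nonneg.2 hst
  refine ContinuousLinearMap.opNorm_le_bound _ (by positivity) fun K => ?_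
  calc _ ≤ M * (‖K‖ * (C * (t - s) ^ α)) :=
        (S (t - s)).le_of_opNorm_le_of_le (d.bound.norm_le _ h0 (by linarith))
          (K.le_of_opNorm_le_of_le le_rfl (d.holder s t hs hst ht))
    _ = _ := by ring

theorem exists_norm_omegaS_apply_le [CompleteSpace W] (d : Driven S ω α M C T) :
    ∃ A : ℝ, 0 ≤ A ∧ ∀ (s t : ℝ) (K : V →L[ℝ] W), 0 ≤ s → s ≤ t → t ≤ T →
      ‖omegaS S ω t s K‖ ≤ A * (t - s) ^ α * ‖K‖ := by
  have hM := d.bound.nonneg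
  have hC := d.nonneg
  have hα := d.pos
  exact ⟨M * C + M * C / α, by positivity, fun s t K hs hst ht =>
    (omegaS S ω t s).le_of_opNorm_le (d.norm_omegaS_le hs hst ht) K⟩

theorem _root_.RoughEvolution.omegaS_self (hS : IsAnalyticSemigroup S) (ω : ℝ → V) (s : ℝ) :
    omegaS S ω s s = 0 := by
  ext K
  simp [omegaS, hS.zero]

/-- `ω^S` is additive: `∫_s^t S(t-r) K dω_r = ∫_m^t S(t-r) K dω_r + S(t-m) ∫_s^m S(m-r) K dω_r`. -/
theorem omegaS_add [CompleteSpace W] (d : Driven S ω α M C T) {s m t : ℝ} (hs : 0 ≤ s)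
    (hsm : s ≤ m) (hmt : m ≤ t) (ht : t ≤ T) (K : V →L[ℝ] W) :
    omegaS S ω t s K = omegaS S ω t m K + S (t - m) (omegaS S ω m s K) := by
  rcases hmt.eq_or_lt with rfl | hlt
  · rw [omegaS_self d.semigroup, sub_self, d.semigroup.zero_apply]; simp
  have i1 := d.integrable_kernel_apply hs (hsm.trans hmt) ht K
  have i2 := d.integrable_kernel_apply (hs.trans hsm) hmt ht K
  have i3 := d.integrable_kernel_apply hs hsm (hmt.trans ht) K
  obtain ⟨j1, j2⟩ := d.semigroup.integral_deriv_sub hsm hlt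
  have i4 : IntervalIntegrable (fun r => deriv S (t - r) (K (ω t - ω r))) volume s m :=
    i1.mono_set (by rw [uIcc_of_le hsm, uIcc_of_le (hsm.trans hmt)]; exact Icc_subset_Icc_right hmt)
  have e1 : ∫ r in s..m, deriv S (t - r) (K (ω t - ω r))
      = (S (t - s) - S (t - m)) (K (ω t - ω m))
        + S (t - m) (∫ r in s..m, deriv S (m - r) (K (ω m - ω r))) := by
    have j3 : IntervalIntegrable (fun r => deriv S (t - r) (K (ω t - ω m))) volume s m :=
      (intervalIntegrable_iff_integrableOn_Ioc_of_le hsm).2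
        ((ContinuousLinearMap.apply ℝ W (K (ω t - ω m))).integrable_comp
          ((intervalIntegrable_iff_integrableOn_Ioc_of_le hsm).1 j1))
    have j4 : IntervalIntegrable (fun r => S (t - m) (deriv S (m - r) (K (ω m - ω r))))
        volume s m :=
      (intervalIntegrable_iff_integrableOn_Ioc_of_le hsm).2
        ((S (t - m)).integrable_comp ((intervalIntegrable_iff_integrableOn_Ioc_of_le hsm).1 i3))
    rw [← j2, ContinuousLinearMap.intervalIntegral_apply j1,
      ← ContinuousLinearMap.intervalIntegral_comp_comm _ i3,
      ← intervalIntegral.integral_add j3 j4, intervalIntegral.integral_of_le hsm,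
      intervalIntegral.integral_of_le hsm, integral_Ioc_eq_integral_Ioo,
      integral_Ioc_eq_integral_Ioo]
    refine setIntegral_congr_fun measurableSet_Ioo fun r hr => ?_
    have : deriv S (t - r) (K (ω m - ω r)) = S (t - m) (deriv S (m - r) (K (ω m - ω r))) := by
      rw [← d.semigroup.deriv_add_apply (by linarith) (sub_pos.2 hr.2), sub_add_sub_cancel]
    simp only [← this, ← map_add]
    congr 2
    abel
  rw [d.omegaS_apply hs (hsm.trans hmt) ht, d.omegaS_apply (hs.trans hsm) hmt ht,
    d.omegaS_apply hs hsm (hmt.trans ht),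
    ← intervalIntegral.integral_add_adjacent_intervals i4 i2, e1, map_sub (S (t - m)),
    d.semigroup.comp_apply hsm hmt]
  have e2 : S (t - s) (K (ω t - ω s)) = S (t - s) (K (ω t - ω m)) + S (t - s) (K (ω m - ω s)) := by
    rw [← map_add, ← map_add]; congr 2; abel
  rw [e2]
  change _ - (S (t - s) (K (ω t - ω m)) - S (t - m) (K (ω t - ω m)) + _ + _) = _
  abel

/-- Freezing the semigroup in `ω^S_{ts}(K)` costs `O((t-s)^(α+γ))` if `K` is `γ`-regular. -/
theorem exists_norm_sub_omegaS_le [CompleteSpace W] (d : Driven S ω α M C T) {γ : ℝ}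
    (hγ : 0 < γ) :
    ∃ A : ℝ, 0 ≤ A ∧ ∀ (s t N : ℝ) (K : V →L[ℝ] W), 0 ≤ s → s ≤ t → t ≤ T → 0 ≤ N →
      IsRegularOp S γ (2 * T) N K →
      ‖K (ω t - ω s) - omegaS S ω t s K‖ ≤ A * N * (t - s) ^ (α + γ) := by
  have hα := d.pos
  have hC := d.nonneg
  refine ⟨C / γ + C / (α + γ), by positivity, fun s t N K hs hst ht hN hK => ?_⟩
  have h0 : 0 ≤ t - s := sub_nonneg.2 hst
  have b1 : ‖S (t - s) (K (ω t - ω s)) - K (ω t - ω s)‖ ≤ C / γ * N * (t - s) ^ (α + γ) := by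
    refine (d.semigroup.norm_apply_sub_le hγ (by positivity : 0 ≤ N * ‖ω t - ω s‖) h0
      fun r hr hrh => hK _ r hr (by linarith)).trans ?_
    rw [Real.rpow_add_of_nonneg h0 hα.le hγ.le]
    calc _ ≤ N * (C * (t - s) ^ α) / γ * (t - s) ^ γ := by
          gcongr
          exact d.holder s t hs hst ht
      _ = _ := by ring
  have b2 : ‖∫ r in s..t, deriv S (t - r) (K (ω t - ω r))‖
      ≤ C * N / (α + γ) * (t - s) ^ (α + γ) := by
    refine (intervalIntegrable_of_norm_le_sub_rpow hst (by positivity) ?_ fun r hr => ?_).2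
    · refine (d.continuousOn_deriv_sub s t).clm_apply (K.continuous.comp_continuousOn ?_)
      exact continuousOn_const.sub (d.continuousOn_path.mono
        fun r hr => ⟨by linarith [hr.1], by linarith [hr.2]⟩)
    · have hr0 : 0 < t - r := sub_pos.2 hr.2
      refine (hK _ (t - r) hr0 (by linarith [hr.1])).trans ?_
      rw [show α + γ - 1 = α + (γ - 1) by ring, Real.rpow_add hr0]
      calc _ ≤ N * (C * (t - r) ^ α) * (t - r) ^ (γ - 1) := by
            gcongr
            exact d.holder r t (by linarith [hr.1]) hr.2.le ht
        _ = _ := by ring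
  have e : K (ω t - ω s) - omegaS S ω t s K = -(S (t - s) (K (ω t - ω s)) - K (ω t - ω s))
      + ∫ r in s..t, deriv S (t - r) (K (ω t - ω r)) := by
    rw [d.omegaS_apply hs hst ht]; abel
  rw [e]
  refine (norm_add_le _ _).trans ?_
  rw [norm_neg]
  refine (add_le_add b1 b2).trans (le_of_eq (by ring))

/-- `ω^S_{ts}(K)` gains `α` over the regularity of `K`. -/
theorem exists_isRegular_omegaS [CompleteSpace W] (d : Driven S ω α M C T) {γ : ℝ}
    (hγ : 0 ≤ γ) (hαγ : α + γ < 1) :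
    ∃ A : ℝ, 0 ≤ A ∧ ∀ (s t N : ℝ) (K : V →L[ℝ] W), 0 ≤ s → s ≤ t → t ≤ T → 0 ≤ N →
      IsRegularOp S γ (2 * T) N K → IsRegular S (α + γ) T (A * N) (omegaS S ω t s K) := by
  have hα := d.pos
  have hC := d.nonneg
  have hM := d.bound.nonneg
  have h2 : (2 : ℝ) ^ (α + γ - 1) < 1 :=
    Real.rpow_lt_one_of_one_lt_of_neg (by norm_num) (by linarith)
  set B := M * C + M * C / (α + γ)
  have hB : 0 ≤ B := by positivity
  refine ⟨B / (1 - 2 ^ (α + γ - 1)), div_nonneg hB (by linarith),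
    fun s t N K hs hst ht hN hK h hh hhT => ?_⟩
  have key : ∀ h u t : ℝ, 0 < h → h ≤ 2 * T → s ≤ u → u ≤ t → t ≤ T → t - u ≤ h →
      ‖deriv S h (omegaS S ω t s K - S (t - u) (omegaS S ω u s K))‖
        ≤ B * N * h ^ (α + γ - 1) := by
    intro h u t hh hhL hsu hut ht htuh
    have hu0 : 0 ≤ u := hs.trans hsu
    have htu : 0 ≤ t - u := sub_nonneg.2 hut
    have hi := d.integrable_kernel_apply hu0 hut ht K
    rw [d.omegaS_add hs hsu hut ht, add_sub_cancel_right, d.omegaS_apply hu0 hut ht, map_sub,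
      ← ContinuousLinearMap.intervalIntegral_comp_comm _ hi]
    have b1 : ‖deriv S h (S (t - u) (K (ω t - ω u)))‖ ≤ M * C * N * h ^ (α + γ - 1) := by
      rw [← d.semigroup.deriv_add_apply' htu hh, add_comm, d.semigroup.deriv_add_apply htu hh]
      calc _ ≤ M * (N * ‖ω t - ω u‖ * h ^ (γ - 1)) :=
            (S (t - u)).le_of_opNorm_le_of_le (d.bound.norm_le _ htu (by linarith))
              (hK _ h hh hhL)
        _ ≤ M * (N * (C * h ^ α) * h ^ (γ - 1)) := by
            have : ‖ω t - ω u‖ ≤ C * h ^ α := (d.holder u t hu0 hut ht).trans (by gcongr)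
            gcongr
        _ = M * C * N * (h ^ α * h ^ (γ - 1)) := by ring
        _ = _ := by rw [← Real.rpow_add hh]; ring_nf
    have hpos : 0 < α + γ := by linarith
    have b2 : ‖∫ r in u..t, deriv S h (deriv S (t - r) (K (ω t - ω r)))‖
        ≤ M * C / (α + γ) * N * h ^ (α + γ - 1) := by
      refine ((intervalIntegrable_of_norm_le_sub_rpow (K := M / h * (C * N)) hut hpos ?_
        fun r hr => ?_).2).trans ?_
      · refine (deriv S h).continuous.comp_continuousOn ?_
        refine (d.continuousOn_deriv_sub u t).clm_apply (K.continuous.comp_continuousOn ?_)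
        exact continuousOn_const.sub (d.continuousOn_path.mono
          fun r hr => ⟨by linarith [hr.1], by linarith [hr.2]⟩)
      · have hr0 : 0 < t - r := sub_pos.2 hr.2
        have : ‖deriv S (t - r) (K (ω t - ω r))‖ ≤ C * N * (t - r) ^ (α + γ - 1) := by
          refine (hK _ (t - r) hr0 (by linarith [hr.1])).trans ?_
          rw [show α + γ - 1 = α + (γ - 1) by ring, Real.rpow_add hr0]
          calc _ ≤ N * (C * (t - r) ^ α) * (t - r) ^ (γ - 1) := by
                gcongr
                exact d.holder r t (by linarith [hr.1]) hr.2.le ht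
            _ = _ := by ring
        refine ((deriv S h).le_of_opNorm_le_of_le (d.bound.deriv_le h hh hhL) this).trans
          (le_of_eq (by ring))
      · have hpow : (t - u) ^ (α + γ) ≤ h ^ (α + γ) := by gcongr
        calc _ ≤ M / h * (C * N) / (α + γ) * h ^ (α + γ) := by gcongr
          _ = _ := by rw [Real.rpow_sub_one hh.ne']; ring
    refine (norm_sub_le _ _).trans ((add_le_add b1 b2).trans (le_of_eq ?_))
    simp only [B]; ring
  have := d.semigroup.norm_deriv_apply_le d.bound (f := fun t => omegaS S ω t s K) hαγ
    (mul_nonneg hB hN) key hh hst ht (by linarith)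
  rw [omegaS_self d.semigroup] at this
  simp only [zero_apply, norm_zero, mul_zero, zero_div, add_zero] at this
  refine this.trans (le_of_eq ?_)
  ring

theorem exists_norm_omegaS_sub_le [CompleteSpace W] (d : Driven S ω α M C T) :
    ∃ A : ℝ, 0 ≤ A ∧ ∀ s t t' : ℝ, 0 ≤ s → s ≤ t → t ≤ t' → t' ≤ T →
      ‖omegaS S ω t' s - omegaS S ω t s‖ ≤ A * (t' - t) ^ α := by
  obtain ⟨A, hA, hreg⟩ := d.exists_isRegular_omegaS le_rfl (by simpa using d.lt_one)
  obtain ⟨B, hB, hbd⟩ := d.exists_norm_omegaS_apply_le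
  have hM := d.bound.nonneg
  have hα := d.pos
  refine ⟨B + A * M / α, by positivity, fun s t t' hs hst htt ht => ?_⟩
  have h0 : 0 ≤ t' - t := sub_nonneg.2 htt
  refine ContinuousLinearMap.opNorm_le_bound _ (by positivity) fun K => ?_
  have h1 := hreg s t (M * ‖K‖) K hs hst (by linarith) (by positivity) (d.bound.isRegularOp K)
  rw [add_zero] at h1
  have h2 := d.semigroup.norm_apply_sub_le hα (by positivity) h0
    fun r hr hrh => h1 r hr (by linarith)
  have e : (omegaS S ω t' s - omegaS S ω t s) K = omegaS S ω t' t K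
      + (S (t' - t) (omegaS S ω t s K) - omegaS S ω t s K) := by
    change omegaS S ω t' s K - omegaS S ω t s K = _
    rw [d.omegaS_add hs hst htt ht]; abel
  rw [e]
  refine (norm_add_le _ _).trans ((add_le_add (hbd t t' K (by linarith) htt ht) h2).trans
    (le_of_eq ?_))
  ring

theorem continuousOn_omegaS [CompleteSpace W] (d : Driven S ω α M C T) {s : ℝ} (hs : 0 ≤ s) :
    ContinuousOn (fun t => omegaS S ω t s) (Icc s T) := by
  obtain ⟨A, hA, h⟩ := d.exists_norm_omegaS_sub_le
  exact continuousOn_of_holder d.pos fun t t' hst htt ht => h s t t' hs hst htt ht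

end Driven
end Convolution

/-! ### The process `a` -/

section ProcessA

variable {V W : Type*} [NormedAddCommGroup V] [NormedSpace ℝ V]
  [NormedAddCommGroup W] [NormedSpace ℝ W] [CompleteSpace W] {S : ℝ → W →L[ℝ] W} {ω : ℝ → V}

omit [CompleteSpace W] in
theorem procA_self (hS : IsAnalyticSemigroup S) (ω : ℝ → V) (s : ℝ) (E : W →L[ℝ] V →L[ℝ] W)
    (x : W) : procA S ω s s E x = 0 := by
  simp [procA, omegaS_self hS]

namespace Driven

variable {α M C T : ℝ}

theorem continuousOn_integrandA (d : Driven S ω α M C T) {s t : ℝ} (hs : 0 ≤ s) (ht : t ≤ T)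
    (E : W →L[ℝ] V →L[ℝ] W) (x : W) :
    ContinuousOn (fun r => S (t - r) (omegaS S ω r s (E (deriv S (r - s) x)))) (Ioo s t) := by
  refine ContinuousOn.clm_apply ?_ (ContinuousOn.clm_apply ?_ ?_)
  · exact d.semigroup.continuousOn.comp (by fun_prop) fun r hr => sub_pos.2 hr.2
  · exact (d.continuousOn_omegaS hs).mono fun r hr => ⟨hr.1.le, by linarith [hr.2]⟩
  · refine E.continuous.comp_continuousOn (ContinuousOn.clm_apply ?_ continuousOn_const)
    exact d.semigroup.continuousOn_deriv.comp (by fun_prop) fun r hr => sub_pos.2 hr.1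

/-- The integral in the definition of `a` converges absolutely, and it is `O((t-s)^(α+γ))` if `x`
is `γ`-regular. -/
theorem exists_integrandA (d : Driven S ω α M C T) {γ : ℝ} (hγ : 0 ≤ γ) :
    ∃ A : ℝ, 0 ≤ A ∧ ∀ (s t N : ℝ) (E : W →L[ℝ] V →L[ℝ] W) (x : W), 0 ≤ s → s ≤ t → t ≤ T →
      0 ≤ N → IsRegular S γ T N x →
      IntervalIntegrable (fun r => S (t - r) (omegaS S ω r s (E (deriv S (r - s) x))))
        volume s t ∧
      ‖∫ r in s..t, S (t - r) (omegaS S ω r s (E (deriv S (r - s) x)))‖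
        ≤ A * N * (t - s) ^ (α + γ) * ‖E‖ := by
  obtain ⟨B, hB, hbd⟩ := d.exists_norm_omegaS_apply_le
  have hM := d.bound.nonneg
  have hα := d.pos
  have hpos : 0 < α + γ := by linarith
  refine ⟨M * B / (α + γ), by positivity, fun s t N E x hs hst ht hN hx => ?_⟩
  have := intervalIntegrable_of_norm_le_rpow_sub (K := M * B * N * ‖E‖) hst hpos
    (d.continuousOn_integrandA hs ht E x) fun r hr => by
      have hr0 : 0 < r - s := sub_pos.2 hr.1
      have h1 : ‖E (deriv S (r - s) x)‖ ≤ ‖E‖ * (N * (r - s) ^ (γ - 1)) :=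
        E.le_of_opNorm_le_of_le le_rfl (hx _ hr0 (by linarith [hr.2]))
      calc _ ≤ M * (B * (r - s) ^ α * (‖E‖ * (N * (r - s) ^ (γ - 1)))) := by
            refine (S (t - r)).le_of_opNorm_le_of_le
              (d.bound.norm_le _ (by linarith [hr.2]) (by linarith [hr.1])) ?_
            refine (hbd s r _ hs hr.1.le (by linarith [hr.2])).trans ?_
            gcongr
        _ = M * B * N * ‖E‖ * ((r - s) ^ α * (r - s) ^ (γ - 1)) := by ring
        _ = _ := by rw [← Real.rpow_add hr0, add_sub_assoc]
  exact ⟨this.1, this.2.trans (le_of_eq (by ring))⟩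

omit [NormedSpace ℝ V] [CompleteSpace W] in
theorem isRegular_zero (d : Driven S ω α M C T) (x : W) :
    IsRegular S 0 T (M * ‖x‖) x := by
  intro h hh hhT
  rw [zero_sub, Real.rpow_neg_one]
  calc _ ≤ M / h * ‖x‖ := (deriv S h).le_of_opNorm_le (d.bound.deriv_le h hh (by linarith)) x
    _ = _ := by ring

theorem integrable_integrandA (d : Driven S ω α M C T) {s t : ℝ} (hs : 0 ≤ s) (hst : s ≤ t)
    (ht : t ≤ T) (E : W →L[ℝ] V →L[ℝ] W) (x : W) :
    IntervalIntegrable (fun r => S (t - r) (omegaS S ω r s (E (deriv S (r - s) x))))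
      volume s t := by
  obtain ⟨A, hA, h⟩ := d.exists_integrandA le_rfl
  exact (h s t _ E x hs hst ht (mul_nonneg d.bound.nonneg (norm_nonneg x))
    (d.isRegular_zero x)).1

theorem exists_norm_procA_le (d : Driven S ω α M C T) :
    ∃ A : ℝ, 0 ≤ A ∧ ∀ (s t : ℝ) (E : W →L[ℝ] V →L[ℝ] W) (x : W), 0 ≤ s → s ≤ t → t ≤ T →
      ‖procA S ω t s E x‖ ≤ A * (t - s) ^ α * ‖E‖ * ‖x‖ := by
  obtain ⟨A, hA, h⟩ := d.exists_integrandA le_rfl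
  obtain ⟨B, hB, hbd⟩ := d.exists_norm_omegaS_apply_le
  have hM := d.bound.nonneg
  refine ⟨B * M + A * M, by positivity, fun s t E x hs hst ht => ?_⟩
  have h1 := (h s t _ E x hs hst ht (mul_nonneg hM (norm_nonneg x))
    (d.isRegular_zero x)).2
  rw [add_zero] at h1
  have h2 : ‖omegaS S ω t s (E (S (t - s) x))‖ ≤ B * (t - s) ^ α * (‖E‖ * (M * ‖x‖)) := by
    refine (hbd s t _ hs hst ht).trans ?_
    have h0 : 0 ≤ t - s := sub_nonneg.2 hst
    gcongr
    exact E.le_of_opNorm_le_of_le le_rfl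
      ((S (t - s)).le_of_opNorm_le (d.bound.norm_le _ h0 (by linarith)) x)
  refine (norm_sub_le _ _).trans ((add_le_add h2 h1).trans (le_of_eq (by ring)))

theorem procA_sub (d : Driven S ω α M C T) {s t : ℝ} (hs : 0 ≤ s) (hst : s ≤ t)
    (ht : t ≤ T) (E : W →L[ℝ] V →L[ℝ] W) (x x' : W) :
    procA S ω t s E (x - x') = procA S ω t s E x - procA S ω t s E x' := by
  simp only [procA, map_sub]
  rw [intervalIntegral.integral_sub (d.integrable_integrandA hs hst ht E x)
    (d.integrable_integrandA hs hst ht E x')]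
  abel

/-- On `γ`-regular `x`, the semigroup inside `a` can be dropped at the cost
`O((t-s)^(α+γ))`. -/
theorem exists_norm_procA_sub_omegaS_le (d : Driven S ω α M C T) {γ : ℝ} (hγ : 0 < γ) :
    ∃ A : ℝ, 0 ≤ A ∧ ∀ (s t N : ℝ) (E : W →L[ℝ] V →L[ℝ] W) (x : W), 0 ≤ s → s ≤ t → t ≤ T →
      0 ≤ N → IsRegular S γ T N x →
      ‖procA S ω t s E x - omegaS S ω t s (E x)‖ ≤ A * N * (t - s) ^ (α + γ) * ‖E‖ := by
  obtain ⟨A, hA, h⟩ := d.exists_integrandA hγ.le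
  obtain ⟨B, hB, hbd⟩ := d.exists_norm_omegaS_apply_le
  refine ⟨B / γ + A, by positivity, fun s t N E x hs hst ht hN hx => ?_⟩
  have h1 := (h s t N E x hs hst ht hN hx).2
  have h0 : 0 ≤ t - s := sub_nonneg.2 hst
  have h2 : ‖omegaS S ω t s (E (S (t - s) x - x))‖ ≤ B / γ * N * (t - s) ^ (α + γ) * ‖E‖ := by
    refine (hbd s t _ hs hst ht).trans ?_
    have h3 := d.semigroup.norm_apply_sub_le hγ hN h0 fun r hr hrh => hx r hr (by linarith)
    rw [Real.rpow_add_of_nonneg h0 d.pos.le hγ.le]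
    calc _ ≤ B * (t - s) ^ α * (‖E‖ * (N / γ * (t - s) ^ γ)) := by
          gcongr
          exact E.le_of_opNorm_le_of_le le_rfl h3
      _ = _ := by ring
  have e : procA S ω t s E x - omegaS S ω t s (E x) = omegaS S ω t s (E (S (t - s) x - x))
      - ∫ r in s..t, S (t - r) (omegaS S ω r s (E (deriv S (r - s) x))) := by
    rw [map_sub, map_sub, procA]; abel
  rw [e]
  refine (norm_sub_le _ _).trans ((add_le_add h2 h1).trans (le_of_eq (by ring)))

/-- `a` is additive in the sense of
`∫_s^t S(t-r) E S(r-s) x dω_r = ∫_m^t S(t-r) E S(r-m) S(m-s) x dω_r + S(t-m) ∫_s^m …`. -/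
theorem procA_add (d : Driven S ω α M C T) {s m t : ℝ} (hs : 0 ≤ s) (hsm : s ≤ m) (hmt : m ≤ t)
    (ht : t ≤ T) (E : W →L[ℝ] V →L[ℝ] W) (x : W) :
    procA S ω t s E x = procA S ω t m E (S (m - s) x) + S (t - m) (procA S ω m s E x) := by
  rcases hsm.eq_or_lt with rfl | hlt
  · simp [procA_self d.semigroup, d.semigroup.zero_apply]
  have hm0 : 0 ≤ m := hs.trans hsm
  have i1 := d.integrable_integrandA hs (hsm.trans hmt) ht E x
  have i2 := d.integrable_integrandA hs hsm (hmt.trans ht) E x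
  have i3 := d.integrable_integrandA hm0 hmt ht E (S (m - s) x)
  obtain ⟨j1, j2⟩ := d.semigroup.integral_deriv (sub_pos.2 hlt) (sub_le_sub_right hmt s)
  have j1' : IntervalIntegrable (fun r => deriv S (r - s)) volume m t := by
    simpa using j1.comp_sub_right s
  have j2' : ∫ r in m..t, deriv S (r - s) = S (t - s) - S (m - s) := by
    rw [intervalIntegral.integral_comp_sub_right (fun r => deriv S r) s, j2]
  have i4 : IntervalIntegrable (fun r => S (t - r) (omegaS S ω r s (E (deriv S (r - s) x))))
      volume s m := i1.mono_set
        (by rw [uIcc_of_le hsm, uIcc_of_le (hsm.trans hmt)]; exact Icc_subset_Icc_right hmt)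
  have i5 : IntervalIntegrable (fun r => S (t - r) (omegaS S ω r s (E (deriv S (r - s) x))))
      volume m t := i1.mono_set
        (by rw [uIcc_of_le hmt, uIcc_of_le (hsm.trans hmt)]; exact Icc_subset_Icc_left hsm)
  have e1 : ∫ r in s..m, S (t - r) (omegaS S ω r s (E (deriv S (r - s) x)))
      = S (t - m) (∫ r in s..m, S (m - r) (omegaS S ω r s (E (deriv S (r - s) x)))) := by
    rw [← ContinuousLinearMap.intervalIntegral_comp_comm _ i2]
    refine intervalIntegral.integral_congr fun r hr => ?_
    rw [uIcc_of_le hsm] at hr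
    exact (d.semigroup.comp_apply hr.2 hmt _).symm
  set Λ : (W →L[ℝ] W) →L[ℝ] W := ((S (t - m)).comp ((omegaS S ω m s).comp E)).comp
    (ContinuousLinearMap.apply ℝ W x) with hΛ
  have hΛ' : ∀ B : W →L[ℝ] W, Λ B = S (t - m) (omegaS S ω m s (E (B x))) := fun B => rfl
  have e2 : ∫ r in m..t, S (t - r) (omegaS S ω r s (E (deriv S (r - s) x)))
      = (∫ r in m..t, S (t - r) (omegaS S ω r m (E (deriv S (r - m) (S (m - s) x)))))
        + Λ (S (t - s) - S (m - s)) := by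
    have j3 : IntervalIntegrable (fun r => Λ (deriv S (r - s))) volume m t :=
      (intervalIntegrable_iff_integrableOn_Ioc_of_le hmt).2
        (Λ.integrable_comp ((intervalIntegrable_iff_integrableOn_Ioc_of_le hmt).1 j1'))
    rw [← j2', ← ContinuousLinearMap.intervalIntegral_comp_comm _ j1',
      ← intervalIntegral.integral_add i3 j3, intervalIntegral.integral_of_le hmt,
      intervalIntegral.integral_of_le hmt]
    refine setIntegral_congr_fun measurableSet_Ioc fun r hr => ?_
    simp only [hΛ']
    rw [← d.semigroup.deriv_add_apply' (sub_nonneg.2 hsm) (sub_pos.2 hr.1), sub_add_sub_cancel,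
      d.omegaS_add hs hsm hr.1.le (hr.2.trans ht), map_add, d.semigroup.comp_apply hr.1.le hr.2]
  have e3 : Λ (S (t - s) - S (m - s)) = S (t - m) (omegaS S ω m s (E (S (t - s) x)))
      - S (t - m) (omegaS S ω m s (E (S (m - s) x))) := by
    rw [map_sub]; rfl
  rw [procA, procA, procA, ← intervalIntegral.integral_add_adjacent_intervals i4 i5, e1, e2, e3,
    d.omegaS_add hs hsm hmt ht, d.semigroup.comp_apply hsm hmt, map_sub (S (t - m))]
  abel

end Driven
end ProcessA

/-! ### Operators on the tensor product -/

section Tensors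

variable {V W : Type*} [NormedAddCommGroup V] [NormedSpace ℝ V]
  [NormedAddCommGroup W] [NormedSpace ℝ W]

theorem norm_bilinToMultilin_le (Φ : V →L[ℝ] V →L[ℝ] W) : ‖bilinToMultilin Φ‖ ≤ ‖Φ‖ := by
  refine ContinuousMultilinearMap.opNorm_le_bound (norm_nonneg _) fun m => ?_
  have : bilinToMultilin Φ m = Φ (m 0) (m 1) := by simp [bilinToMultilin]
  rw [this, Fin.prod_univ_two, ← mul_assoc]
  exact Φ.le_opNorm₂ _ _

variable [CompleteSpace W]

theorem tensorLift_coe (Φ : V →L[ℝ] V →L[ℝ] W) (x : ⨂[ℝ] _ : Fin 2, V) :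
    tensorLift Φ (x : Tensor V)
      = PiTensorProduct.liftIsometry ℝ (fun _ : Fin 2 => V) W (bilinToMultilin Φ) x :=
  ContinuousLinearMap.extend_eq _
    (e := (UniformSpace.Completion.toComplL : (⨂[ℝ] _ : Fin 2, V) →L[ℝ] Tensor V))
    UniformSpace.Completion.denseRange_coe
    (UniformSpace.Completion.isUniformInducing_coe _) x

theorem norm_tensorLift_apply_le (Φ : V →L[ℝ] V →L[ℝ] W) (x : Tensor V) :
    ‖tensorLift Φ x‖ ≤ ‖Φ‖ * ‖x‖ := by
  induction x using UniformSpace.Completion.induction_on with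
  | hp => exact isClosed_le (by fun_prop) (by fun_prop)
  | ih a =>
    rw [tensorLift_coe, UniformSpace.Completion.norm_coe]
    refine ContinuousLinearMap.le_of_opNorm_le _ ?_ a
    rw [LinearIsometryEquiv.norm_map]
    exact norm_bilinToMultilin_le Φ

theorem tensorLift_sub (Φ Ψ : V →L[ℝ] V →L[ℝ] W) (x : Tensor V) :
    tensorLift (Φ - Ψ) x = tensorLift Φ x - tensorLift Ψ x := by
  induction x using UniformSpace.Completion.induction_on with
  | hp => exact isClosed_eq (by fun_prop) (by fun_prop)
  | ih a =>
    have : bilinToMultilin (Φ - Ψ) = bilinToMultilin Φ - bilinToMultilin Ψ := by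
      ext m; simp [bilinToMultilin]
    rw [tensorLift_coe, tensorLift_coe, tensorLift_coe, this, map_sub]
    rfl

theorem tensorEK_pureTensor (E : W →L[ℝ] V →L[ℝ] W) (K : V →L[ℝ] W) (v₁ v₂ : V) :
    tensorEK E K (pureTensor v₁ v₂) = E (K v₂) v₁ := by
  rw [tensorEK, tensorLift_pureTensor]; rfl

theorem norm_tensorEK_apply_le (E : W →L[ℝ] V →L[ℝ] W) (K : V →L[ℝ] W) (x : Tensor V) :
    ‖tensorEK E K x‖ ≤ ‖E‖ * ‖K‖ * ‖x‖ := by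
  refine (norm_tensorLift_apply_le _ x).trans ?_
  rw [ContinuousLinearMap.opNorm_flip]
  gcongr
  exact ContinuousLinearMap.opNorm_comp_le E K

theorem tensorEK_sub (E : W →L[ℝ] V →L[ℝ] W) (K K' : V →L[ℝ] W) (x : Tensor V) :
    tensorEK E (K - K') x = tensorEK E K x - tensorEK E K' x := by
  have : (E.comp (K - K')).flip = (E.comp K).flip - (E.comp K').flip := by ext v w; simp
  rw [tensorEK, tensorEK, tensorEK, ← tensorLift_sub, this]

end Tensors

/-! ### The process `c` -/

section ProcessC

variable {V W : Type*} [NormedAddCommGroup V] [NormedSpace ℝ V]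
  [NormedAddCommGroup W] [NormedSpace ℝ W] {S : ℝ → W →L[ℝ] W} {ω : ℝ → V}
  {ω2 : ℝ → ℝ → Tensor V}

/-- An analytic semigroup together with a rough path on `[0,T]`, with constants. -/
structure RoughDriven (S : ℝ → W →L[ℝ] W) (ω : ℝ → V) (ω2 : ℝ → ℝ → Tensor V)
    (α M C T : ℝ) : Prop extends Driven S ω α M C T where
  norm_area_le : ∀ s t : ℝ, 0 ≤ s → s ≤ t → t ≤ T → ‖ω2 t s‖ ≤ C * (t - s) ^ (2 * α)
  chen : ∀ s u t : ℝ, 0 ≤ s → s ≤ u → u ≤ t → t ≤ T →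
    ω2 t s - ω2 u s - ω2 t u = pureTensor (ω u - ω s) (ω t - ω u)

variable [CompleteSpace W]

namespace RoughDriven

variable {α M C T : ℝ}

theorem tensorEK_chen (d : RoughDriven S ω ω2 α M C T) {s u t : ℝ} (hs : 0 ≤ s) (hsu : s ≤ u)
    (hut : u ≤ t) (ht : t ≤ T) (E : W →L[ℝ] V →L[ℝ] W) (K : V →L[ℝ] W) :
    tensorEK E K (ω2 t s) = tensorEK E K (ω2 u s) + tensorEK E K (ω2 t u)
      + E (K (ω t - ω u)) (ω u - ω s) := by
  rw [← tensorEK_pureTensor, ← d.chen s u t hs hsu hut ht, map_sub, map_sub]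
  abel

omit [CompleteSpace W] in
theorem area_self (d : RoughDriven S ω ω2 α M C T) {t : ℝ} (ht : 0 ≤ t) (htT : t ≤ T) :
    ω2 t t = 0 := by
  have := d.norm_area_le t t ht le_rfl htT
  have hα := d.pos
  rw [sub_self, Real.zero_rpow (by positivity), mul_zero] at this
  simpa using this

theorem continuousOn_tensorEK (d : RoughDriven S ω ω2 α M C T) {t : ℝ} (ht : t ≤ T)
    (E : W →L[ℝ] V →L[ℝ] W) (K : V →L[ℝ] W) :
    ContinuousOn (fun r => tensorEK E K (ω2 t r)) (Icc 0 t) := by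
  have hα := d.pos
  have hC := d.nonneg
  refine continuousOn_of_holder (C := ‖E‖ * ‖K‖ * (C * t ^ α + C * t ^ α * C)) hα
    fun r r' hr hrr hrt => ?_
  have h0 : 0 ≤ r' - r := sub_nonneg.2 hrr
  have e : tensorEK E K (ω2 t r') - tensorEK E K (ω2 t r)
      = - (tensorEK E K (ω2 r' r) + E (K (ω t - ω r')) (ω r' - ω r)) := by
    rw [d.tensorEK_chen hr hrr hrt ht]; abel
  have b1 : ‖tensorEK E K (ω2 r' r)‖ ≤ ‖E‖ * ‖K‖ * (C * (t ^ α * (r' - r) ^ α)) := by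
    refine (norm_tensorEK_apply_le E K _).trans ?_
    gcongr
    refine (d.norm_area_le r r' hr hrr (hrt.trans ht)).trans ?_
    rw [two_mul, Real.rpow_add_of_nonneg h0 hα.le hα.le]
    gcongr
    linarith
  have b2 : ‖E (K (ω t - ω r')) (ω r' - ω r)‖
      ≤ ‖E‖ * (‖K‖ * (C * t ^ α)) * (C * (r' - r) ^ α) := by
    refine (E _).le_of_opNorm_le_of_le ?_ (d.holder r r' hr hrr (hrt.trans ht))
    refine E.le_of_opNorm_le_of_le le_rfl (K.le_of_opNorm_le_of_le le_rfl ?_)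
    refine (d.holder r' t (by linarith) hrt ht).trans ?_
    gcongr
    linarith
  rw [e, norm_neg]
  refine (norm_add_le _ _).trans ((add_le_add b1 b2).trans (le_of_eq (by ring)))

theorem integrandC (d : RoughDriven S ω ω2 α M C T) {s t : ℝ} (hs : 0 ≤ s) (hst : s ≤ t)
    (ht : t ≤ T) (E : W →L[ℝ] V →L[ℝ] W) (K : V →L[ℝ] W) :
    IntervalIntegrable (fun r => deriv S (t - r) (tensorEK E K (ω2 t r))) volume s t ∧
    ‖∫ r in s..t, deriv S (t - r) (tensorEK E K (ω2 t r))‖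
      ≤ M * C * ‖E‖ * ‖K‖ / (2 * α) * (t - s) ^ (2 * α) := by
  have hα := d.pos
  refine intervalIntegrable_of_norm_le_sub_rpow hst (by positivity) ?_ fun r hr => ?_
  · refine (d.continuousOn_deriv_sub s t).clm_apply ?_
    exact (d.continuousOn_tensorEK ht E K).mono
      fun r hr => ⟨by linarith [hr.1], hr.2.le⟩
  · have h0 : 0 < t - r := sub_pos.2 hr.2
    have hM := d.bound.nonneg
    calc _ ≤ M / (t - r) * (‖E‖ * ‖K‖ * (C * (t - r) ^ (2 * α))) := by
          refine (deriv S (t - r)).le_of_opNorm_le_of_le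
            (d.bound.deriv_le _ h0 (by linarith [hr.1])) ?_
          refine (norm_tensorEK_apply_le E K _).trans ?_
          gcongr
          exact d.norm_area_le r t (by linarith [hr.1]) hr.2.le ht
      _ = _ := by rw [Real.rpow_sub_one h0.ne']; field_simp

theorem exists_norm_procC_le (d : RoughDriven S ω ω2 α M C T) :
    ∃ A : ℝ, 0 ≤ A ∧ ∀ (s t : ℝ) (E : W →L[ℝ] V →L[ℝ] W) (K : V →L[ℝ] W), 0 ≤ s → s ≤ t →
      t ≤ T → ‖procC S ω ω2 t s E K‖ ≤ A * (t - s) ^ (2 * α) * ‖E‖ * ‖K‖ := by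
  obtain ⟨B, hB, hbd⟩ := d.exists_norm_omegaS_apply_le
  have hM := d.bound.nonneg
  have hC := d.nonneg
  have hα := d.pos
  refine ⟨B * C + M * C + M * C / (2 * α), by positivity, fun s t E K hs hst ht => ?_⟩
  have h0 : 0 ≤ t - s := sub_nonneg.2 hst
  have b1 : ‖omegaS S ω t s (E (K (ω t - ω s)))‖
      ≤ B * (t - s) ^ α * (‖E‖ * (‖K‖ * (C * (t - s) ^ α))) := by
    refine (hbd s t _ hs hst ht).trans ?_
    gcongr
    exact E.le_of_opNorm_le_of_le le_rfl
      (K.le_of_opNorm_le_of_le le_rfl (d.holder s t hs hst ht))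
  have b2 : ‖S (t - s) (tensorEK E K (ω2 t s))‖ ≤ M * (‖E‖ * ‖K‖ * (C * (t - s) ^ (2 * α))) := by
    refine (S (t - s)).le_of_opNorm_le_of_le (d.bound.norm_le _ h0 (by linarith)) ?_
    refine (norm_tensorEK_apply_le E K _).trans ?_
    gcongr
    exact d.norm_area_le s t hs hst ht
  have b3 := (d.integrandC hs hst ht E K).2
  have e : (t - s) ^ (2 * α) = (t - s) ^ α * (t - s) ^ α := by
    rw [two_mul, Real.rpow_add_of_nonneg h0 hα.le hα.le]
  refine (norm_add_le _ _).trans ((add_le_add ((norm_sub_le _ _).trans (add_le_add b1 b2)) b3).trans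
    (le_of_eq ?_))
  rw [e]
  ring

theorem procC_sub (d : RoughDriven S ω ω2 α M C T) {s t : ℝ} (hs : 0 ≤ s) (hst : s ≤ t)
    (ht : t ≤ T) (E : W →L[ℝ] V →L[ℝ] W) (K K' : V →L[ℝ] W) :
    procC S ω ω2 t s E (K - K') = procC S ω ω2 t s E K - procC S ω ω2 t s E K' := by
  simp only [procC, tensorEK_sub, map_sub, sub_apply]
  rw [intervalIntegral.integral_sub (d.integrandC hs hst ht E K).1
    (d.integrandC hs hst ht E K').1]
  abel

/-- The additivity relation of `c`: its defect is `ω^S_{tm}(E K (ω_m - ω_s))`. -/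
theorem procC_add (d : RoughDriven S ω ω2 α M C T) {s m t : ℝ} (hs : 0 ≤ s) (hsm : s ≤ m)
    (hmt : m ≤ t) (ht : t ≤ T) (E : W →L[ℝ] V →L[ℝ] W) (K : V →L[ℝ] W) :
    procC S ω ω2 t s E K = procC S ω ω2 t m E K + S (t - m) (procC S ω ω2 m s E K)
      + omegaS S ω t m (E (K (ω m - ω s))) := by
  have hm0 : 0 ≤ m := hs.trans hsm
  rcases hmt.eq_or_lt with rfl | hlt
  · have : procC S ω ω2 m m E K = 0 := by
      simp [procC, omegaS_self d.semigroup, d.area_self hm0 ht]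
    rw [this, omegaS_self d.semigroup, sub_self, d.semigroup.zero_apply]
    simp
  have i1 := (d.integrandC hs (hsm.trans hmt) ht E K).1
  have i2 := (d.integrandC hm0 hmt ht E K).1
  have i3 := (d.integrandC hs hsm (hmt.trans ht) E K).1
  have i4 : IntervalIntegrable (fun r => deriv S (t - r) (tensorEK E K (ω2 t r))) volume s m :=
    i1.mono_set (by rw [uIcc_of_le hsm, uIcc_of_le (hsm.trans hmt)]; exact Icc_subset_Icc_right hmt)
  obtain ⟨j1, j2⟩ := d.semigroup.integral_deriv_sub hsm hlt
  set K' : V →L[ℝ] W := E (K (ω t - ω m)) with hK'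
  have i5 := d.integrable_kernel_apply hs hsm (hmt.trans ht) K'
  have e1 : ∫ r in s..m, deriv S (t - r) (tensorEK E K (ω2 t r))
      = S (t - m) (∫ r in s..m, deriv S (m - r) (tensorEK E K (ω2 m r)))
        + (S (t - s) - S (t - m)) (tensorEK E K (ω2 t m))
        + S (t - m) (∫ r in s..m, deriv S (m - r) (K' (ω m - ω r))) := by
    have comp : ∀ {f : ℝ → W} (B : W →L[ℝ] W), IntervalIntegrable f volume s m →
        IntervalIntegrable (fun r => B (f r)) volume s m := fun B hf =>
      (intervalIntegrable_iff_integrableOn_Ioc_of_le hsm).2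
        (B.integrable_comp ((intervalIntegrable_iff_integrableOn_Ioc_of_le hsm).1 hf))
    have j3 : IntervalIntegrable (fun r => deriv S (t - r) (tensorEK E K (ω2 t m))) volume s m :=
      (intervalIntegrable_iff_integrableOn_Ioc_of_le hsm).2
        ((ContinuousLinearMap.apply ℝ W (tensorEK E K (ω2 t m))).integrable_comp
          ((intervalIntegrable_iff_integrableOn_Ioc_of_le hsm).1 j1))
    rw [← j2, ContinuousLinearMap.intervalIntegral_apply j1,
      ← ContinuousLinearMap.intervalIntegral_comp_comm _ i3,
      ← ContinuousLinearMap.intervalIntegral_comp_comm _ i5,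
      ← intervalIntegral.integral_add (comp _ i3) j3,
      ← intervalIntegral.integral_add ((comp _ i3).add j3) (comp _ i5),
      intervalIntegral.integral_of_le hsm, intervalIntegral.integral_of_le hsm,
      integral_Ioc_eq_integral_Ioo, integral_Ioc_eq_integral_Ioo]
    refine setIntegral_congr_fun measurableSet_Ioo fun r hr => ?_
    have hS : ∀ x : W, S (t - m) (deriv S (m - r) x) = deriv S (t - r) x := fun x => by
      rw [← d.semigroup.deriv_add_apply (by linarith) (sub_pos.2 hr.2), sub_add_sub_cancel]
    simp only [hS, ← map_add, hK']
    rw [d.tensorEK_chen (hs.trans hr.1.le) hr.2.le hmt ht, map_add (tensorEK E K)]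
  have e2 := d.omegaS_apply hs hsm (hmt.trans ht) K'
  have e3 : (∫ r in s..m, deriv S (m - r) (K' (ω m - ω r)))
      = S (m - s) (K' (ω m - ω s)) - omegaS S ω m s K' := by rw [e2]; abel
  have e4 : omegaS S ω t s (E (K (ω t - ω s)))
      = omegaS S ω t m (E (K (ω m - ω s))) + S (t - m) (omegaS S ω m s (E (K (ω m - ω s))))
        + (omegaS S ω t m K' + S (t - m) (omegaS S ω m s K')) := by
    rw [← d.omegaS_add hs hsm hmt ht, ← d.omegaS_add hs hsm hmt ht, ← map_add, hK', ← map_add,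
      ← map_add]
    congr 3
    abel
  rw [procC, procC, procC, ← intervalIntegral.integral_add_adjacent_intervals i4 i2, e1, e3, e4,
    d.tensorEK_chen hs hsm hmt ht]
  clear_value K'
  subst hK'
  simp only [map_add, map_sub, sub_apply, d.semigroup.comp_apply hsm hmt]
  abel

end RoughDriven
end ProcessC

/-! ### The process `b` -/

section ProcessB

variable {V W : Type*} [NormedAddCommGroup V] [NormedSpace ℝ V]
  [NormedAddCommGroup W] [NormedSpace ℝ W] [CompleteSpace W] {S : ℝ → W →L[ℝ] W} {ω : ℝ → V}
  {ω2 : ℝ → ℝ → Tensor V}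

theorem rpow_mul_rpow_le {x y z a b : ℝ} (hx : 0 ≤ x) (hy : 0 ≤ y) (hxz : x ≤ z) (hyz : y ≤ z)
    (ha : 0 ≤ a) (hb : 0 ≤ b) : x ^ a * y ^ b ≤ z ^ (a + b) := by
  have hz := hx.trans hxz
  rw [Real.rpow_add_of_nonneg hz ha hb]
  gcongr

theorem rpow_add_le_mul_rpow {x z a b : ℝ} (hx : 0 ≤ x) (hxz : x ≤ z)
    (ha : 0 ≤ a) (hb : 0 ≤ b) : x ^ (a + b) ≤ z ^ b * x ^ a := by
  rw [Real.rpow_add_of_nonneg hx ha hb, mul_comm]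
  gcongr

omit [NormedSpace ℝ V] [CompleteSpace W] in
theorem Driven.isRegular_apply {α M C T γ N : ℝ} (d : Driven S ω α M C T) {x : W}
    (hx : IsRegular S γ T N x) {r : ℝ} (hr : 0 ≤ r) (hrT : r ≤ T) :
    IsRegular S γ T (M * N) (S r x) := by
  intro h hh hhT
  rw [← d.semigroup.deriv_add_apply' hr hh, add_comm, d.semigroup.deriv_add_apply hr hh, mul_assoc]
  exact (S r).le_of_opNorm_le_of_le (d.bound.norm_le r hr (by linarith)) (hx h hh hhT)

/-- The integrand whose rough integral over `[s,t]` is `b_{ts}(E, K)`. -/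
noncomputable def XiB (S : ℝ → W →L[ℝ] W) (ω : ℝ → V) (ω2 : ℝ → ℝ → Tensor V)
    (E : W →L[ℝ] V →L[ℝ] W) (K : V →L[ℝ] W) (s v u : ℝ) : W :=
  omegaS S ω v u (E (omegaS S ω u s K)) + procC S ω ω2 v u E K

namespace RoughDriven

variable {α β M C T : ℝ}

theorem defect_XiB (d : RoughDriven S ω ω2 α M C T) {s u m v : ℝ} (hs : 0 ≤ s)
    (hsu : s ≤ u) (hum : u ≤ m) (hmv : m ≤ v) (hv : v ≤ T) (E : W →L[ℝ] V →L[ℝ] W)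
    (K : V →L[ℝ] W) :
    defect S (XiB S ω ω2 E K s) v m u = omegaS S ω v m (E ((K (ω m - ω u) - omegaS S ω m u K)
      - (S (m - u) (omegaS S ω u s K) - omegaS S ω u s K))) := by
  have hu := hs.trans hsu
  simp only [defect, XiB]
  rw [d.procC_add hu hum hmv hv, d.omegaS_add hu hum hmv hv,
    d.omegaS_add hs hsu hum (hmv.trans hv)]
  simp only [map_add, map_sub]
  abel

/-- The defect of the integrand of `b` is of order `2α + β > 1` for `β`-regular `K`. -/
theorem exists_norm_defect_XiB_le (d : RoughDriven S ω ω2 α M C T) (hβ : 0 < β)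
    (hαβ : α + β < 1) :
    ∃ A : ℝ, 0 ≤ A ∧ ∀ (s u m v b N : ℝ) (E : W →L[ℝ] V →L[ℝ] W) (K : V →L[ℝ] W), 0 ≤ s →
      s ≤ u → u ≤ m → m ≤ v → v ≤ b → b ≤ T → 0 ≤ N → IsRegularOp S β (2 * T) N K →
      ‖S (b - v) (defect S (XiB S ω ω2 E K s) v m u)‖
        ≤ A * N * ‖E‖ * (v - u) ^ (2 * α + β) := by
  obtain ⟨A₀, hA₀, h₀⟩ := d.exists_norm_omegaS_apply_le
  obtain ⟨A₁, hA₁, h₁⟩ := d.exists_norm_sub_omegaS_le hβ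
  obtain ⟨A₂, hA₂, h₂⟩ := d.exists_isRegular_omegaS hβ.le hαβ
  have hM := d.bound.nonneg
  have hα := d.pos
  have hpos : 0 < α + β := by linarith
  refine ⟨M * A₀ * (A₁ + A₂ / (α + β)), by positivity,
    fun s u m v b N E K hs hsu hum hmv hvb hb hN hK => ?_⟩
  have hu := hs.trans hsu
  have hmu : 0 ≤ m - u := sub_nonneg.2 hum
  have hvm : 0 ≤ v - m := sub_nonneg.2 hmv
  rw [d.defect_XiB hs hsu hum hmv (hvb.trans hb)]
  have b1 := h₁ u m N K hu hum (by linarith) hN hK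
  have b2 := d.semigroup.norm_apply_sub_le hpos (mul_nonneg hA₂ hN) hmu
    fun r hr hrm => h₂ s u N K hs hsu (by linarith) hN hK r hr (by linarith)
  have b3 : ‖(K (ω m - ω u) - omegaS S ω m u K)
      - (S (m - u) (omegaS S ω u s K) - omegaS S ω u s K)‖
      ≤ (A₁ + A₂ / (α + β)) * N * (m - u) ^ (α + β) :=
    (norm_sub_le _ _).trans ((add_le_add b1 b2).trans (le_of_eq (by ring)))
  have b4 := rpow_mul_rpow_le hvm hmu (by linarith : v - m ≤ v - u) (by linarith : m - u ≤ v - u)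
    hα.le hpos.le
  rw [show α + (α + β) = 2 * α + β by ring] at b4
  calc _ ≤ M * (A₀ * (v - m) ^ α * (‖E‖ * ((A₁ + A₂ / (α + β)) * N * (m - u) ^ (α + β)))) := by
        refine (S (b - v)).le_of_opNorm_le_of_le
          (d.bound.norm_le _ (by linarith) (by linarith)) ?_
        refine (h₀ m v _ (hu.trans hum) hmv (hvb.trans hb)).trans ?_
        gcongr
        exact E.le_of_opNorm_le_of_le le_rfl b3
    _ = M * A₀ * (A₁ + A₂ / (α + β)) * N * ‖E‖ * ((v - m) ^ α * (m - u) ^ (α + β)) := by ring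
    _ ≤ _ := by gcongr

/-- For regular `K`, the sewing lemma yields the limit that defines `b_{ts}(E, K)`. -/
theorem hasRoughIntegral_procB (d : RoughDriven S ω ω2 α M C T) (hβ : 0 < β) (hαβ : α + β < 1)
    (h1 : 1 < 2 * α + β) {s t N : ℝ} (hs : 0 ≤ s) (hst : s ≤ t) (ht : t ≤ T) (hN : 0 ≤ N)
    (E : W →L[ℝ] V →L[ℝ] W) {K : V →L[ℝ] W} (hK : IsRegularOp S β (2 * T) N K) :
    HasRoughIntegral S (XiB S ω ω2 E K s) s t (procB S ω ω2 t s E K) := by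
  obtain ⟨A, hA, h⟩ := d.exists_norm_defect_XiB_le hβ hαβ
  obtain ⟨x, hx⟩ := exists_hasRoughIntegral (Ξ := XiB S ω ω2 E K s) (a := s) (b := t)
    d.semigroup h1 (by positivity : 0 ≤ A * N * ‖E‖) hst
    fun u m v hsu hum hmv hvt => h s u m v t N E K hs hsu hum hmv hvt ht hN hK
  rwa [← hx.roughIntegral_eq hst] at hx

theorem exists_norm_procB_le (d : RoughDriven S ω ω2 α M C T) (hβ : 0 < β) (hαβ : α + β < 1)
    (h1 : 1 < 2 * α + β) :
    ∃ A : ℝ, 0 ≤ A ∧ ∀ (s t N : ℝ) (E : W →L[ℝ] V →L[ℝ] W) (K : V →L[ℝ] W), 0 ≤ s → s ≤ t →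
      t ≤ T → ‖K‖ ≤ N → IsRegularOp S β (2 * T) N K →
      ‖procB S ω ω2 t s E K‖ ≤ A * N * ‖E‖ * (t - s) ^ (2 * α) := by
  obtain ⟨A, hA, h⟩ := d.exists_norm_defect_XiB_le hβ hαβ
  obtain ⟨B, hB, hbd⟩ := d.exists_norm_procC_le
  have hα := d.pos
  have hq : (2 : ℝ) ^ (1 - (2 * α + β)) < 1 :=
    Real.rpow_lt_one_of_one_lt_of_neg (by norm_num) (by linarith)
  set q := (2 : ℝ) ^ (1 - (2 * α + β))
  have hq' : 0 < 1 - q := by linarith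
  refine ⟨2 * A / (1 - q) * |T| ^ β + B, by positivity, fun s t N E K hs hst ht hKN hK => ?_⟩
  have hN : 0 ≤ N := (norm_nonneg K).trans hKN
  have h0 : 0 ≤ t - s := sub_nonneg.2 hst
  have e : XiB S ω ω2 E K s t s = procC S ω ω2 t s E K := by
    simp [XiB, omegaS_self d.semigroup]
  have b1 := (d.hasRoughIntegral_procB hβ hαβ h1 hs hst ht hN E hK).norm_sub_le
    (C := A * N * ‖E‖) d.semigroup h1 (by positivity) hst
    fun u m v hsu hum hmv hvt => h s u m v t N E K hs hsu hum hmv hvt ht hN hK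
  rw [e] at b1
  have b2 : (t - s) ^ (2 * α + β) ≤ |T| ^ β * (t - s) ^ (2 * α) :=
    rpow_add_le_mul_rpow h0 (by linarith [le_abs_self T]) (by positivity) hβ.le
  have b3 : ‖procC S ω ω2 t s E K‖ ≤ B * (t - s) ^ (2 * α) * ‖E‖ * N :=
    (hbd s t E K hs hst ht).trans (by gcongr)
  calc _ = ‖(procB S ω ω2 t s E K - procC S ω ω2 t s E K) + procC S ω ω2 t s E K‖ := by
        rw [sub_add_cancel]
    _ ≤ 2 * (A * N * ‖E‖) / (1 - q) * (t - s) ^ (2 * α + β) + B * (t - s) ^ (2 * α) * ‖E‖ * N :=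
        (norm_add_le _ _).trans (add_le_add b1 b3)
    _ ≤ 2 * (A * N * ‖E‖) / (1 - q) * (|T| ^ β * (t - s) ^ (2 * α))
          + B * (t - s) ^ (2 * α) * ‖E‖ * N := by gcongr
    _ = _ := by ring

theorem procB_sub (d : RoughDriven S ω ω2 α M C T) (hβ : 0 < β) (hαβ : α + β < 1)
    (h1 : 1 < 2 * α + β) {s t N N' : ℝ} (hs : 0 ≤ s) (hst : s ≤ t) (ht : t ≤ T) (hN : 0 ≤ N)
    (hN' : 0 ≤ N') (E : W →L[ℝ] V →L[ℝ] W) {K K' : V →L[ℝ] W} (hK : IsRegularOp S β (2 * T) N K)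
    (hK' : IsRegularOp S β (2 * T) N' K') :
    procB S ω ω2 t s E (K - K') = procB S ω ω2 t s E K - procB S ω ω2 t s E K' := by
  have h := (d.hasRoughIntegral_procB hβ hαβ h1 hs hst ht hN E hK).sub
    (d.hasRoughIntegral_procB hβ hαβ h1 hs hst ht hN' E hK')
  refine HasRoughIntegral.roughIntegral_eq hst (h.congr fun u v hsu huv hvt => ?_)
  simp only [XiB]
  rw [d.procC_sub (hs.trans hsu) huv (hvt.trans ht)]
  simp only [map_sub]
  abel

/-- The additivity relation of `b`: its defect is `a_{tm}(E, ω^S_{ms}(K))`. Both sides are rough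
integrals over `[m,t]` of `ω^S_{vu}(E (ω^S_{us} - ω^S_{um})(K)) = ω^S_{vu}(E S(u-m) ω^S_{ms}(K))`;
for `a` this holds since `ω^S_{ms}(K)` is `(α+β)`-regular. -/
theorem procB_add (d : RoughDriven S ω ω2 α M C T) (hβ : 0 < β) (hαβ : α + β < 1)
    (h1 : 1 < 2 * α + β) {s m t N : ℝ} (hs : 0 ≤ s) (hsm : s ≤ m) (hmt : m ≤ t) (ht : t ≤ T)
    (hN : 0 ≤ N) (E : W →L[ℝ] V →L[ℝ] W) {K : V →L[ℝ] W} (hK : IsRegularOp S β (2 * T) N K) :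
    procB S ω ω2 t s E K = procB S ω ω2 t m E K + S (t - m) (procB S ω ω2 m s E K)
      + procA S ω t m E (omegaS S ω m s K) := by
  have hm := hs.trans hsm
  have hα := d.pos
  have hM := d.bound.nonneg
  obtain ⟨A, hA, hreg⟩ := d.exists_isRegular_omegaS hβ.le hαβ
  obtain ⟨B, hB, hpa⟩ := d.exists_norm_procA_sub_omegaS_le (by linarith : 0 < α + β)
  have hx := hreg s m N K hs hsm (hmt.trans ht) hN hK
  set x := omegaS S ω m s K with hxdef
  have r1 := (d.hasRoughIntegral_procB hβ hαβ h1 hs (hsm.trans hmt) ht hN E hK).of_left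
    d.semigroup hsm (d.hasRoughIntegral_procB hβ hαβ h1 hs hsm (hmt.trans ht) hN E hK)
  have r2 := r1.sub (d.hasRoughIntegral_procB hβ hαβ h1 hm hmt ht hN E hK)
  have r3 : HasRoughIntegral S (fun v u => omegaS S ω v u (E (S (u - m) x))) m t
      (procA S ω t m E (S (m - m) x)) := by
    refine hasRoughIntegral_of_additive (C := B * (M * (A * N)) * ‖E‖)
      (Φ := fun v u => procA S ω v u E (S (u - m) x)) d.semigroup h1 hmt hM
      (fun r hr hrt => d.bound.norm_le r hr (by linarith)) (fun u p v hu hup hpv hv => ?_)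
      (by positivity) (fun u v hu huv hv => ?_)
    · rw [d.procA_add (hm.trans hu) hup hpv (hv.trans ht), d.semigroup.comp_apply hu hup]
    · rw [norm_sub_rev]
      refine (hpa u v _ E _ (hm.trans hu) huv (hv.trans ht) (by positivity)
        (d.isRegular_apply hx (sub_nonneg.2 hu) (by linarith))).trans
        (le_of_eq ?_)
      rw [show α + (α + β) = 2 * α + β by ring]
      ring
  have r4 := r3.unique hmt (r2.congr fun u v hmu huv hvt => by
    simp only [XiB]
    rw [d.omegaS_add hs hsm hmu ((huv.trans hvt).trans ht), map_add, map_add]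
    abel)
  rw [sub_self, d.semigroup.zero_apply] at r4
  rw [r4]
  abel

end RoughDriven
end ProcessB

/-! ### The coefficient -/

section Coefficient

variable {V W : Type*} [NormedAddCommGroup V] [NormedSpace ℝ V]
  [NormedAddCommGroup W] [NormedSpace ℝ W] {S : ℝ → W →L[ℝ] W}

/-- The bounds on the coefficient `g : W → L(V, W)` that enter the estimates: `g` is bounded and
Lipschitz with values in the `β`-regular operators, and its derivative is bounded and Lipschitz
with values in `L(V, W)`. -/
structure CoeffBound (S : ℝ → W →L[ℝ] W) (g : W → V →L[ℝ] W) (β L N : ℝ) : Prop where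
  nonneg : 0 ≤ N
  norm_le : ∀ x, ‖g x‖ ≤ N
  regular : ∀ x, IsRegularOp S β L N (g x)
  norm_sub_le : ∀ x x', ‖g x - g x'‖ ≤ N * ‖x - x'‖
  regular_sub : ∀ x x', IsRegularOp S β L (N * ‖x - x'‖) (g x - g x')
  norm_fderiv_le : ∀ x, ‖fderiv ℝ g x‖ ≤ N
  norm_fderiv_sub_le : ∀ x x', ‖fderiv ℝ g x - fderiv ℝ g x'‖ ≤ N * ‖x - x'‖
  taylor : ∀ x x', ‖g x' - g x - fderiv ℝ g x (x' - x)‖ ≤ N * ‖x' - x‖ ^ 2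

theorem IsAdmissibleCoeff.exists_bounds {D : Type*} [NormedAddCommGroup D] [NormedSpace ℝ D]
    {G : W → V →L[ℝ] D} (hG : IsAdmissibleCoeff G) :
    ∃ C : ℝ, 0 ≤ C ∧ Differentiable ℝ G ∧ (∀ x, ‖G x‖ ≤ C) ∧
      (∀ x x', ‖G x - G x'‖ ≤ C * ‖x - x'‖) ∧ (∀ x, ‖fderiv ℝ G x‖ ≤ C) ∧
      (∀ x x', ‖fderiv ℝ G x - fderiv ℝ G x'‖ ≤ C * ‖x - x'‖) ∧
      ∀ x x', ‖G x' - G x - fderiv ℝ G x (x' - x)‖ ≤ C * ‖x' - x‖ ^ 2 := by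
  have hcd : ContDiff ℝ (2 : ℕ) G := contDiff_of_differentiable_iteratedFDeriv fun k hk =>
    hG.differentiable k (by
      have : k ≤ 2 := by exact_mod_cast hk
      omega)
  have hd : Differentiable ℝ G := hcd.differentiable (by norm_num)
  have hd' : Differentiable ℝ (fderiv ℝ G) :=
    (hcd.fderiv_right (m := 1) (by norm_num)).differentiable (by norm_num)
  obtain ⟨C₀, h₀⟩ := hG.bounded 0 (by norm_num)
  obtain ⟨C₁, h₁⟩ := hG.bounded 1 (by norm_num)
  obtain ⟨C₂, h₂⟩ := hG.bounded 2 (by norm_num)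
  have k₀ : ∀ x, ‖G x‖ ≤ C₀ := fun x => by simpa using h₀ x
  have k₁ : ∀ x, ‖fderiv ℝ G x‖ ≤ C₁ := fun x => by
    simpa [norm_iteratedFDeriv_one] using h₁ x
  have k₂ : ∀ x, ‖fderiv ℝ (fderiv ℝ G) x‖ ≤ C₂ := fun x => by
    rw [← norm_iteratedFDeriv_one, norm_iteratedFDeriv_fderiv]
    exact h₂ x
  have hC₀ : 0 ≤ C₀ := (norm_nonneg _).trans (k₀ 0)
  have hC₁ : 0 ≤ C₁ := (norm_nonneg _).trans (k₁ 0)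
  have hC₂ : 0 ≤ C₂ := (norm_nonneg _).trans (k₂ 0)
  have l₁ : ∀ x x', ‖G x - G x'‖ ≤ C₁ * ‖x - x'‖ := fun x x' =>
    convex_univ.norm_image_sub_le_of_norm_fderiv_le (fun z _ => hd z) (fun z _ => k₁ z)
      (mem_univ x') (mem_univ x)
  have l₂ : ∀ x x', ‖fderiv ℝ G x - fderiv ℝ G x'‖ ≤ C₂ * ‖x - x'‖ := fun x x' =>
    convex_univ.norm_image_sub_le_of_norm_fderiv_le (fun z _ => hd' z) (fun z _ => k₂ z)
      (mem_univ x') (mem_univ x)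
  have l₃ : ∀ x x', ‖G x' - G x - fderiv ℝ G x (x' - x)‖ ≤ C₂ * ‖x' - x‖ ^ 2 := by
    intro x x'
    have := (convex_segment x x').norm_image_sub_le_of_norm_hasFDerivWithin_le'
      (f := G) (φ := fderiv ℝ G x) (C := C₂ * ‖x' - x‖)
      (fun z _ => (hd z).hasFDerivAt.hasFDerivWithinAt)
      (fun z hz => (l₂ z x).trans (by
        gcongr
        have h3 := norm_sub_le_of_mem_segment hz
        rwa [norm_sub_rev x' x, norm_sub_rev] at *))
      (left_mem_segment ℝ x x') (right_mem_segment ℝ x x')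
    rwa [mul_assoc, ← sq] at this
  refine ⟨C₀ + C₁ + C₂, by positivity, hd, fun x => (k₀ x).trans (by linarith),
    fun x x' => (l₁ x x').trans ?_, fun x => (k₁ x).trans (by linarith),
    fun x x' => (l₂ x x').trans ?_, fun x x' => (l₃ x x').trans ?_⟩ <;>
  · gcongr
    linarith

theorem IsAdmissibleCoeff.exists_coeffBound [CompleteSpace W] (hS : IsAnalyticSemigroup S)
    {lam β : ℝ} (hlam : IsExpStable lam S) (hβ : 0 < β) (hβ1 : β < 1)
    {G : W → V →L[ℝ] FracDomain S lam β} (hG : IsAdmissibleCoeff G) (L : ℝ) :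
    ∃ N : ℝ, CoeffBound S (fun x => (FracDomain.incl S lam β).comp (G x)) β L N := by
  obtain ⟨C, hC, hd, k₀, l₁, k₁, l₂, l₃⟩ := hG.exists_bounds
  obtain ⟨B, hB, hinc⟩ := FracDomain.exists_deriv_incl_le hS hlam hβ hβ1 L
  set J := FracDomain.incl S lam β
  set Λ : (V →L[ℝ] FracDomain S lam β) →L[ℝ] V →L[ℝ] W := ContinuousLinearMap.compL ℝ V _ W J
  have hΛ : ∀ P, ‖Λ P‖ ≤ ‖J‖ * ‖P‖ := fun P => ContinuousLinearMap.opNorm_comp_le J P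
  have hreg : ∀ P : V →L[ℝ] FracDomain S lam β, ∀ c, ‖P‖ ≤ c → IsRegularOp S β L (B * c) (Λ P) := by
    intro P c hP v h hh hhL
    refine (hinc h hh hhL (P v)).trans ?_
    calc _ ≤ B * h ^ (β - 1) * (c * ‖v‖) := by
          gcongr
          exact P.le_of_opNorm_le hP v
      _ = _ := by ring
  have hfd : ∀ x, fderiv ℝ (fun x => J.comp (G x)) x = Λ.comp (fderiv ℝ G x) := fun x =>
    (Λ.hasFDerivAt.comp x (hd x).hasFDerivAt).fderiv
  have mono : ∀ {K : V →L[ℝ] W} {c c' : ℝ}, c ≤ c' → IsRegularOp S β L c K →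
      IsRegularOp S β L c' K := by
    intro K c c' hcc hK v h hh hhL
    refine (hK v h hh hhL).trans ?_
    gcongr
  have hJ : ‖J‖ * C ≤ (‖J‖ + B) * C := by nlinarith [norm_nonneg J]
  have hBC : B * C ≤ (‖J‖ + B) * C := by nlinarith [norm_nonneg J]
  refine ⟨(‖J‖ + B) * C, by positivity, fun x => ?_, fun x => mono hBC (hreg _ _ (k₀ x)),
    fun x x' => ?_, fun x x' => ?_, fun x => ?_, fun x x' => ?_, fun x x' => ?_⟩
  · exact (hΛ (G x)).trans ((mul_le_mul_of_nonneg_left (k₀ x) (norm_nonneg J)).trans hJ)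
  · have : J.comp (G x) - J.comp (G x') = Λ (G x - G x') := (map_sub Λ _ _).symm
    rw [this]
    refine (hΛ _).trans ((mul_le_mul_of_nonneg_left (l₁ x x') (norm_nonneg J)).trans ?_)
    rw [← mul_assoc]
    gcongr
  · have : J.comp (G x) - J.comp (G x') = Λ (G x - G x') := (map_sub Λ _ _).symm
    rw [this]
    refine mono ?_ (hreg _ _ (l₁ x x'))
    rw [← mul_assoc]
    gcongr
  · rw [hfd]
    refine ContinuousLinearMap.opNorm_le_bound _ (by positivity) fun w => ?_
    refine (hΛ _).trans ?_
    calc _ ≤ ‖J‖ * (C * ‖w‖) := by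
          gcongr
          exact (fderiv ℝ G x).le_of_opNorm_le (k₁ x) w
      _ ≤ _ := by rw [← mul_assoc]; gcongr
  · rw [hfd, hfd]
    refine ContinuousLinearMap.opNorm_le_bound _ (by positivity) fun w => ?_
    have : (Λ.comp (fderiv ℝ G x) - Λ.comp (fderiv ℝ G x')) w
        = Λ ((fderiv ℝ G x - fderiv ℝ G x') w) := (map_sub Λ _ _).symm
    rw [this]
    refine (hΛ _).trans ?_
    calc _ ≤ ‖J‖ * (C * ‖x - x'‖ * ‖w‖) := by
          gcongr
          exact (fderiv ℝ G x - fderiv ℝ G x').le_of_opNorm_le (l₂ x x') w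
      _ = ‖J‖ * C * (‖x - x'‖ * ‖w‖) := by ring
      _ ≤ (‖J‖ + B) * C * (‖x - x'‖ * ‖w‖) := by gcongr
      _ = _ := by ring
  · rw [hfd]
    have : J.comp (G x') - J.comp (G x) - (Λ.comp (fderiv ℝ G x)) (x' - x)
        = Λ (G x' - G x - fderiv ℝ G x (x' - x)) := by
      rw [map_sub Λ, map_sub Λ]; rfl
    rw [this]
    refine (hΛ _).trans ((mul_le_mul_of_nonneg_left (l₃ x x') (norm_nonneg J)).trans ?_)
    rw [← mul_assoc]
    gcongr

end Coefficient

/-! ### Increments of solutions -/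

section Halving

/-- A quantity that changes by `O(l^γ)` when `l` is halved, and that vanishes as `l → 0`, is
`O(l^γ)`. -/
theorem le_of_halving {p : ℝ → ℝ} {L C γ : ℝ} (hγ : 0 < γ)
    (hp : ∀ l : ℝ, 0 < l → l ≤ L → p l ≤ p (l / 2) + C * l ^ γ)
    (hlim : Tendsto p (𝓝[>] 0) (𝓝 0)) {l : ℝ} (hl : 0 < l) (hlL : l ≤ L) :
    p l ≤ C / (1 - 2 ^ (-γ)) * l ^ γ := by
  have hq : (2 : ℝ) ^ (-γ) < 1 := Real.rpow_lt_one_of_one_lt_of_neg (by norm_num) (by linarith)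
  set q : ℝ := 2 ^ (-γ) with hqdef
  have hq1 : 1 - q ≠ 0 := by linarith
  have step : ∀ l : ℝ, 0 < l → l ≤ L →
      p l - C / (1 - q) * l ^ γ ≤ p (l / 2) - C / (1 - q) * (l / 2) ^ γ := by
    intro l hl hlL
    have e : (l / 2) ^ γ = l ^ γ * q := by
      rw [Real.div_rpow hl.le (by norm_num), hqdef, Real.rpow_neg (by norm_num), div_eq_mul_inv]
    have e2 : C / (1 - q) * l ^ γ - C / (1 - q) * (l ^ γ * q) = C * l ^ γ := by
      field_simp
    rw [e]
    linarith [hp l hl hlL]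
  have iter : ∀ n : ℕ, p l - C / (1 - q) * l ^ γ
      ≤ p (l / 2 ^ n) - C / (1 - q) * (l / 2 ^ n) ^ γ := by
    intro n
    induction n with
    | zero => simp
    | succ n ih =>
      refine ih.trans ?_
      have h1 : l / 2 ^ n ≤ l := div_le_self hl.le (one_le_pow₀ (by norm_num))
      refine (step (l / 2 ^ n) (by positivity) (h1.trans hlL)).trans (le_of_eq ?_)
      rw [pow_succ, div_div]
  have hseq : Tendsto (fun n : ℕ => l / 2 ^ n) atTop (𝓝[>] 0) := by
    refine tendsto_nhdsWithin_iff.2 ⟨?_, .of_forall fun n => by simp only [mem_Ioi]; positivity⟩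
    exact tendsto_const_nhds.div_atTop (tendsto_pow_atTop_atTop_of_one_lt one_lt_two)
  have hlim2 : Tendsto (fun n : ℕ => p (l / 2 ^ n) - C / (1 - q) * (l / 2 ^ n) ^ γ) atTop
      (𝓝 (0 - C / (1 - q) * 0 ^ γ)) := by
    refine (hlim.comp hseq).sub (Tendsto.const_mul _ (Tendsto.rpow_const ?_ (Or.inr hγ.le)))
    exact hseq.mono_right nhdsWithin_le_nhds
  rw [Real.zero_rpow hγ.ne', mul_zero, sub_zero] at hlim2
  have := ge_of_tendsto' hlim2 iter
  linarith

end Halving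

section Increments

variable {V W : Type*} [NormedAddCommGroup V] [NormedSpace ℝ V]
  [NormedAddCommGroup W] [NormedSpace ℝ W] {S : ℝ → W →L[ℝ] W} {ω : ℝ → V}
  {g : W → V →L[ℝ] W} {y : ℝ → W} {z : ℝ → ℝ → AreaSpace V W} {ξ : W}
  {α β M C T N Z : ℝ}

/-- The bounds in the definition of `X_{ω,T}`, with a common constant. -/
structure PairBound (α β T Z : ℝ) (y : ℝ → W) (z : ℝ → ℝ → AreaSpace V W) : Prop where
  nonneg : 0 ≤ Z
  norm_path_le : ∀ t : ℝ, 0 ≤ t → t ≤ T → ‖y t‖ ≤ Z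
  path : ∀ s t : ℝ, 0 < s → s ≤ t → t ≤ T → ‖y t - y s‖ ≤ Z * s ^ (-β) * (t - s) ^ β
  area : ∀ s t : ℝ, 0 ≤ s → s ≤ t → t ≤ T → ‖z t s‖ ≤ Z * (t - s) ^ α
  area_weighted : ∀ s t : ℝ, 0 < s → s ≤ t → t ≤ T →
    ‖z t s‖ ≤ Z * s ^ (-β) * (t - s) ^ (α + β)

theorem MemX.exists_pairBound (h : MemX α β S ω T y z) (hα : 0 < α) (hβ : 0 < β) :
    ∃ Z : ℝ, PairBound α β T Z y z := by
  obtain ⟨C₁, h₁⟩ := isCompact_Icc.exists_bound_of_continuousOn h.path.continuousOn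
  obtain ⟨C₂, h₂⟩ := h.path.holder
  obtain ⟨C₃, h₃⟩ := h.area.holder
  obtain ⟨C₄, h₄⟩ := h.area_weighted.holder
  set Z := |C₁| + |C₂| + |C₃| + |C₄|
  have k₁ : C₁ ≤ Z := by
    have := le_abs_self C₁; simp only [Z]; linarith [abs_nonneg C₂, abs_nonneg C₃, abs_nonneg C₄]
  have k₂ : C₂ ≤ Z := by
    have := le_abs_self C₂; simp only [Z]; linarith [abs_nonneg C₁, abs_nonneg C₃, abs_nonneg C₄]
  have k₃ : C₃ ≤ Z := by
    have := le_abs_self C₃; simp only [Z]; linarith [abs_nonneg C₁, abs_nonneg C₂, abs_nonneg C₄]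
  have k₄ : C₄ ≤ Z := by
    have := le_abs_self C₄; simp only [Z]; linarith [abs_nonneg C₁, abs_nonneg C₂, abs_nonneg C₃]
  have weight : ∀ {s a c e : ℝ}, 0 < s → 0 ≤ e → c ≤ Z → s ^ β * a ≤ c * e →
      a ≤ Z * s ^ (-β) * e := by
    intro s a c e hs he hc h
    have hsβ : 0 < s ^ β := Real.rpow_pos_of_pos hs β
    rw [Real.rpow_neg hs.le, mul_right_comm, ← div_eq_mul_inv, le_div_iff₀ hsβ, mul_comm]
    exact h.trans (by gcongr)
  have hZ : 0 ≤ Z := by positivity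
  refine ⟨Z, hZ, fun t ht htT => (h₁ t ⟨ht, htT⟩).trans k₁, fun s t hs hst ht => ?_,
    fun s t hs hst ht => ?_, fun s t hs hst ht => ?_⟩
  · rcases hst.eq_or_lt with rfl | hlt
    · simp [Real.zero_rpow hβ.ne']
    · exact weight hs (Real.rpow_nonneg (sub_nonneg.2 hst) _) k₂ (h₂ s t hs hlt ht)
  · rcases hst.eq_or_lt with rfl | hlt
    · rw [h.area.diag s ⟨hs, ht⟩]; simp [Real.zero_rpow hα.ne']
    · have := Real.rpow_nonneg (sub_nonneg.2 hst) α
      exact (h₃ s t hs hlt ht).trans (by gcongr)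
  · rcases hst.eq_or_lt with rfl | hlt
    · rw [h.area.diag s ⟨hs.le, ht⟩]; simp [Real.zero_rpow (add_pos hα hβ).ne']
    · exact weight hs (Real.rpow_nonneg (sub_nonneg.2 hst) _) k₄ (h₄ s t hs hlt ht)

variable [CompleteSpace W]

theorem MemX.defect_XiY (h : MemX α β S ω T y z) (d : Driven S ω α M C T) {u m v : ℝ}
    (hu : 0 ≤ u) (hum : u ≤ m) (hmv : m ≤ v) (hv : v ≤ T) :
    defect S (XiY S g ω y z) v m u
      = omegaS S ω v m (-(g (y m) - g (y u) - fderiv ℝ g (y u) (y m - y u)))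
        + z v m (fderiv ℝ g (y u) - fderiv ℝ g (y m)) := by
  have h1 := h.algebraic u m v hu hum hmv hv (fderiv ℝ g (y u))
  have h2 : z v u (fderiv ℝ g (y u)) = z v m (fderiv ℝ g (y u)) + S (v - m) (z m u
      (fderiv ℝ g (y u))) + omegaS S ω v m (fderiv ℝ g (y u) (y m - y u)) := by
    rw [← h1]; abel
  simp only [defect, XiY, h2, d.omegaS_add hu hum hmv hv, map_add, map_sub, map_neg]
  abel

/-- Away from the singularity at `0`, the increments of a solution are described by `Ξ^{(y)}`. -/
theorem exists_norm_increment_sub_XiY_le (d : Driven S ω α M C T) (hg : CoeffBound S g β (2 * T) N)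
    (h : MemX α β S ω T y z) (hZ : PairBound α β T Z y z) (hβ : 0 < β) (h1 : 1 < α + 2 * β)
    (hy : ∀ t ∈ Icc 0 T, HasRoughIntegral S (XiY S g ω y z) 0 t (y t - S t ξ)) :
    ∃ A : ℝ, 0 ≤ A ∧ ∀ s t : ℝ, 0 < s → s ≤ t → t ≤ T →
      ‖y t - S (t - s) (y s) - XiY S g ω y z t s‖
        ≤ A * (s ^ (-β) * s ^ (-β)) * (t - s) ^ (α + 2 * β) := by
  obtain ⟨B, hB, hbd⟩ := d.exists_norm_omegaS_apply_le
  have hM := d.bound.nonneg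
  have hα := d.pos
  have hN := hg.nonneg
  have hZ0 := hZ.nonneg
  have hq : (2 : ℝ) ^ (1 - (α + 2 * β)) < 1 :=
    Real.rpow_lt_one_of_one_lt_of_neg (by norm_num) (by linarith)
  set q := (2 : ℝ) ^ (1 - (α + 2 * β))
  have hq' : 0 < 1 - q := by linarith
  refine ⟨2 * (M * (B * N + N) * (Z * Z)) / (1 - q), by positivity, fun s t hs hst ht => ?_⟩
  have r1 := (hy t ⟨hs.le.trans hst, ht⟩).of_left d.semigroup hs.le (hy s ⟨hs.le, hst.trans ht⟩)
  have e : y t - S t ξ - S (t - s) (y s - S s ξ) = y t - S (t - s) (y s) := by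
    have := d.semigroup.comp_apply hs.le hst ξ
    rw [sub_zero, sub_zero] at this
    rw [map_sub, this]
    abel
  rw [e] at r1
  set w := s ^ (-β) with hw
  have hw0 : 0 ≤ w := Real.rpow_nonneg hs.le _
  refine (r1.norm_sub_le (C := M * (B * N + N) * (Z * Z) * (w * w)) d.semigroup h1 (by positivity)
    hst fun u m v hsu hum hmv hvt => ?_).trans (le_of_eq (by ring))
  have hu : 0 < u := hs.trans_le hsu
  have hm : 0 < m := hu.trans_le hum
  have hmu : 0 ≤ m - u := sub_nonneg.2 hum
  have hvm : 0 ≤ v - m := sub_nonneg.2 hmv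
  have dy : ‖y m - y u‖ ≤ Z * w * (m - u) ^ β := by
    refine (hZ.path u m hu hum (by linarith)).trans ?_
    gcongr
    exact Real.rpow_le_rpow_of_nonpos hs hsu (by linarith)
  have dz : ‖z v m‖ ≤ Z * w * (v - m) ^ (α + β) := by
    refine (hZ.area_weighted m v hm hmv (by linarith)).trans ?_
    gcongr
    exact Real.rpow_le_rpow_of_nonpos hs (hsu.trans hum) (by linarith)
  have b1 : ‖omegaS S ω v m (-(g (y m) - g (y u) - fderiv ℝ g (y u) (y m - y u)))‖
      ≤ B * N * (Z * Z) * (w * w) * (v - u) ^ (α + 2 * β) := by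
    refine (hbd m v _ hm.le hmv (by linarith)).trans ?_
    rw [norm_neg]
    have p := rpow_mul_rpow_le hvm hmu (by linarith : v - m ≤ v - u) (by linarith : m - u ≤ v - u)
      hα.le (by linarith : 0 ≤ 2 * β)
    calc _ ≤ B * (v - m) ^ α * (N * (Z * w * (m - u) ^ β) ^ 2) := by
          gcongr
          refine (hg.taylor (y u) (y m)).trans ?_
          gcongr
      _ = B * N * (Z * Z) * (w * w) * ((v - m) ^ α * (m - u) ^ (2 * β)) := by
          rw [two_mul β, Real.rpow_add_of_nonneg hmu hβ.le hβ.le]; ring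
      _ ≤ _ := by gcongr
  have b2 : ‖z v m (fderiv ℝ g (y u) - fderiv ℝ g (y m))‖
      ≤ N * (Z * Z) * (w * w) * (v - u) ^ (α + 2 * β) := by
    have p := rpow_mul_rpow_le hvm hmu (by linarith : v - m ≤ v - u) (by linarith : m - u ≤ v - u)
      (by linarith : 0 ≤ α + β) hβ.le
    rw [show α + β + β = α + 2 * β by ring] at p
    have hd : ‖fderiv ℝ g (y u) - fderiv ℝ g (y m)‖ ≤ N * (Z * w * (m - u) ^ β) := by
      refine (hg.norm_fderiv_sub_le _ _).trans ?_
      rw [norm_sub_rev]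
      gcongr
    calc _ ≤ Z * w * (v - m) ^ (α + β) * (N * (Z * w * (m - u) ^ β)) :=
          (z v m).le_of_opNorm_le_of_le dz hd
      _ = N * (Z * Z) * (w * w) * ((v - m) ^ (α + β) * (m - u) ^ β) := by ring
      _ ≤ _ := by gcongr
  rw [h.defect_XiY d hu.le hum hmv (hvt.trans ht)]
  calc _ ≤ M * (B * N * (Z * Z) * (w * w) * (v - u) ^ (α + 2 * β)
        + N * (Z * Z) * (w * w) * (v - u) ^ (α + 2 * β)) :=
        (S (t - v)).le_of_opNorm_le_of_le (d.bound.norm_le _ (by linarith) (by linarith))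
          ((norm_add_le _ _).trans (add_le_add b1 b2))
    _ = _ := by ring

theorem exists_norm_XiY_le (d : Driven S ω α M C T) (hg : CoeffBound S g β (2 * T) N)
    (hZ : PairBound α β T Z y z) :
    ∃ A : ℝ, 0 ≤ A ∧ ∀ s t : ℝ, 0 ≤ s → s ≤ t → t ≤ T →
      ‖XiY S g ω y z t s‖ ≤ A * (t - s) ^ α := by
  obtain ⟨B, hB, hbd⟩ := d.exists_norm_omegaS_apply_le
  have hN := hg.nonneg
  have hZ0 := hZ.nonneg
  refine ⟨B * N + Z * N, by positivity, fun s t hs hst ht => ?_⟩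
  have h0 : 0 ≤ t - s := sub_nonneg.2 hst
  have b1 : ‖omegaS S ω t s (g (y s))‖ ≤ B * (t - s) ^ α * N :=
    (hbd s t _ hs hst ht).trans (by gcongr; exact hg.norm_le _)
  have b2 : ‖z t s (fderiv ℝ g (y s))‖ ≤ Z * (t - s) ^ α * N :=
    (z t s).le_of_opNorm_le_of_le (hZ.area s t hs hst ht) (hg.norm_fderiv_le _)
  exact (norm_add_le _ _).trans ((add_le_add b1 b2).trans (le_of_eq (by ring)))

/-- The weight `s^(-β)` is harmless on intervals that are shorter than their distance to `0`. -/
theorem rpow_neg_mul_rpow_le {s l a b : ℝ} (hs : 0 < s) (hl : 0 ≤ l) (hls : l ≤ s) (ha : 0 ≤ a)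
    (hb : 0 ≤ b) : s ^ (-b) * l ^ (a + b) ≤ l ^ a := by
  have hsb : 0 < s ^ b := Real.rpow_pos_of_pos hs b
  rw [Real.rpow_neg hs.le, inv_mul_le_iff₀ hsb]
  exact rpow_add_le_mul_rpow hl hls ha hb

omit [NormedSpace ℝ V] [CompleteSpace W] in
theorem tendsto_norm_increment (d : Driven S ω α M C T) (hy : ContinuousOn y (Icc 0 T)) {s t : ℝ}
    (hs : 0 ≤ s) (hst : s < t) (ht : t ≤ T) :
    Tendsto (fun l => ‖S (t - (s + l)) (y (s + l) - S l (y s))‖) (𝓝[>] 0) (𝓝 0) := by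
  have hM := d.bound.nonneg
  have h1 : Tendsto (fun l : ℝ => s + l) (𝓝[>] 0) (𝓝[Icc 0 T] s) := by
    refine tendsto_nhdsWithin_iff.2 ⟨?_, ?_⟩
    · have : Tendsto (fun l : ℝ => s + l) (𝓝 0) (𝓝 (s + 0)) :=
        Continuous.tendsto (by fun_prop) 0
      rw [add_zero] at this
      exact this.mono_left nhdsWithin_le_nhds
    · filter_upwards [Ioo_mem_nhdsGT (sub_pos.2 hst)] with l hl
      exact ⟨by linarith [hl.1], by linarith [hl.2]⟩
  have h2 : Tendsto (fun l => y (s + l) - S l (y s)) (𝓝[>] 0) (𝓝 (y s - y s)) :=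
    ((hy s ⟨hs, by linarith⟩).tendsto.comp h1).sub (d.semigroup.tendsto_zero (y s))
  rw [sub_self] at h2
  have h3 : Tendsto (fun l => M * ‖y (s + l) - S l (y s)‖) (𝓝[>] 0) (𝓝 0) := by
    simpa using (h2.norm).const_mul M
  refine squeeze_zero' (.of_forall fun _ => norm_nonneg _) ?_ h3
  filter_upwards [Ioo_mem_nhdsGT (sub_pos.2 hst)] with l hl
  exact (S _).le_of_opNorm_le (d.bound.norm_le _ (by linarith [hl.2]) (by linarith [hl.1])) _

/-- The mild increments `y_t - S(t-s) y_s` of a solution are `O((t-s)^α)` up to time `0`: on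
`[(s+t)/2, t]` the singular weight is harmless, and `[s,t]` can be halved towards `s`. -/
theorem exists_norm_increment_le (d : Driven S ω α M C T) (hg : CoeffBound S g β (2 * T) N)
    (h : MemX α β S ω T y z) (hβ : 0 < β) (h1 : 1 < α + 2 * β)
    (hy : ∀ t ∈ Icc 0 T, HasRoughIntegral S (XiY S g ω y z) 0 t (y t - S t ξ)) :
    ∃ A : ℝ, 0 ≤ A ∧ ∀ s t : ℝ, 0 ≤ s → s ≤ t → t ≤ T →
      ‖y t - S (t - s) (y s)‖ ≤ A * (t - s) ^ α := by
  have hα := d.pos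
  have hM := d.bound.nonneg
  obtain ⟨Z, hZ⟩ := h.exists_pairBound hα hβ
  obtain ⟨A, hA, hinc⟩ := exists_norm_increment_sub_XiY_le d hg h hZ hβ h1 hy
  obtain ⟨B, hB, hXi⟩ := exists_norm_XiY_le d hg hZ
  have hq : (2 : ℝ) ^ (-α) < 1 := Real.rpow_lt_one_of_one_lt_of_neg (by norm_num) (by linarith)
  have hq' : 0 < 1 - (2 : ℝ) ^ (-α) := by linarith
  refine ⟨M * (A + B) / (1 - 2 ^ (-α)), by positivity, fun s t hs hst ht => ?_⟩
  rcases hst.eq_or_lt with rfl | hlt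
  · simp [d.semigroup.zero_apply, Real.zero_rpow hα.ne']
  set p : ℝ → ℝ := fun l => ‖S (t - (s + l)) (y (s + l) - S l (y s))‖ with hp
  have hhalf : ∀ l : ℝ, 0 < l → l ≤ t - s → p l ≤ p (l / 2) + M * (A + B) * l ^ α := by
    intro l hl hlt
    set m := s + l / 2 with hm
    have hm0 : 0 < m := by rw [hm]; positivity
    have hlm : l / 2 ≤ m := by rw [hm]; linarith
    have hll : s + l - m = l / 2 := by rw [hm]; ring
    have e : S (t - (s + l)) (y (s + l) - S l (y s))
        = S (t - (s + l)) (y (s + l) - S (s + l - m) (y m))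
          + S (t - m) (y m - S (l / 2) (y s)) := by
      have e1 : S (l / 2) (S (l / 2) (y s)) = S l (y s) := by
        rw [← d.semigroup.add_apply (by positivity) (by positivity), add_halves]
      rw [← d.semigroup.comp_apply (by linarith : m ≤ s + l) (by linarith : s + l ≤ t), ← map_add,
        hll, map_sub (S (l / 2)), e1]
      congr 1
      abel
    have b1 : ‖y (s + l) - S (s + l - m) (y m)‖ ≤ (A + B) * l ^ α := by
      have h2 := hinc m (s + l) hm0 (by linarith) (by linarith)
      have h3 := hXi m (s + l) hm0.le (by linarith) (by linarith)
      rw [hll] at h2 h3 ⊢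
      have h4 : m ^ (-β) * m ^ (-β) * (l / 2) ^ (α + 2 * β) ≤ (l / 2) ^ α := by
        rw [← Real.rpow_add hm0, show -β + -β = -(2 * β) by ring]
        exact rpow_neg_mul_rpow_le hm0 (by positivity) hlm hα.le (by positivity)
      have h5 : (l / 2) ^ α ≤ l ^ α := by
        gcongr
        linarith
      calc _ = ‖(y (s + l) - S (l / 2) (y m) - XiY S g ω y z (s + l) m)
            + XiY S g ω y z (s + l) m‖ := by rw [sub_add_cancel]
        _ ≤ A * (m ^ (-β) * m ^ (-β)) * (l / 2) ^ (α + 2 * β) + B * (l / 2) ^ α :=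
            (norm_add_le _ _).trans (add_le_add h2 h3)
        _ = A * (m ^ (-β) * m ^ (-β) * (l / 2) ^ (α + 2 * β)) + B * (l / 2) ^ α := by ring
        _ ≤ A * l ^ α + B * l ^ α := by
            gcongr
            exact h4.trans h5
        _ = _ := by ring
    have b2 := (S (t - (s + l))).le_of_opNorm_le_of_le
      (d.bound.norm_le _ (by linarith) (by linarith)) b1
    simp only [hp]
    rw [e, ← hm]
    refine (norm_add_le _ _).trans ?_
    linarith
  have := le_of_halving hα hhalf (tendsto_norm_increment d h.path.continuousOn hs hlt ht)
    (sub_pos.2 hlt) le_rfl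
  simpa [hp, d.semigroup.zero_apply] using this

end Increments

/-! ### The area component of solutions -/

section Area

variable {V W : Type*} [NormedAddCommGroup V] [NormedSpace ℝ V]
  [NormedAddCommGroup W] [NormedSpace ℝ W] [CompleteSpace W] {S : ℝ → W →L[ℝ] W} {ω : ℝ → V}
  {ω2 : ℝ → ℝ → Tensor V}
  {g : W → V →L[ℝ] W} {y : ℝ → W} {z : ℝ → ℝ → AreaSpace V W} {ξ : W}
  {α β M C T N Z : ℝ}

theorem RoughDriven.defect_XiZ (d : RoughDriven S ω ω2 α M C T)
    (hg : CoeffBound S g β (2 * T) N) (hβ : 0 < β) (hαβ : α + β < 1)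
    (h1 : 1 < 2 * α + β) {u m v : ℝ} (hu : 0 ≤ u) (hum : u ≤ m) (hmv : m ≤ v) (hv : v ≤ T)
    (E : W →L[ℝ] V →L[ℝ] W) (y : ℝ → W) :
    defect S (XiZ S g ω ω2 y y E) v m u = procB S ω ω2 v m E (g (y u) - g (y m))
      - procA S ω v m E (y m - S (m - u) (y u) - omegaS S ω m u (g (y u))) := by
  have hm := hu.trans hum
  simp only [defect, XiZ]
  rw [d.procB_add hβ hαβ h1 hu hum hmv hv hg.nonneg E (hg.regular _),
    d.procA_add hu hum hmv hv,
    d.procB_sub hβ hαβ h1 hm hmv hv hg.nonneg hg.nonneg E (hg.regular _) (hg.regular _),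
    d.procA_sub hm hmv hv, d.procA_sub hm hmv hv, map_add]
  abel

/-- The area component of a solution is described by `Ξ^{(z)}` on intervals that are shorter than
their distance to `0`. -/
theorem exists_norm_area_sub_XiZ_le (d : RoughDriven S ω ω2 α M C T)
    (hg : CoeffBound S g β (2 * T) N) (h : MemX α β S ω T y z) (hβ : 0 < β) (hβα : β < α)
    (hαβ : α + β < 1) (h1 : 1 < α + 2 * β) (hI : IsImage S g ω ω2 T ξ y z y z) :
    ∃ A : ℝ, 0 ≤ A ∧ ∀ (s t : ℝ) (E : W →L[ℝ] V →L[ℝ] W), 0 < s → s ≤ t → t ≤ T → t - s ≤ s →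
      ‖z t s E + omegaS S ω t s (E (y s)) - XiZ S g ω ω2 y y E t s‖
        ≤ A * ‖E‖ * (t - s) ^ (2 * α) := by
  have hα := d.pos
  have hM := d.bound.nonneg
  have hN := hg.nonneg
  have h2 : 1 < 2 * α + β := by linarith
  obtain ⟨Z, hZ⟩ := h.exists_pairBound hα hβ
  have hZ0 := hZ.nonneg
  obtain ⟨A, hA, hinc⟩ := exists_norm_increment_sub_XiY_le d.toDriven hg h hZ hβ h1 hI.path
  obtain ⟨B, hB, hpb⟩ := d.exists_norm_procB_le hβ hαβ h2
  obtain ⟨D, hD, hpa⟩ := d.exists_norm_procA_le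
  have hq : (2 : ℝ) ^ (1 - (2 * α + β)) < 1 :=
    Real.rpow_lt_one_of_one_lt_of_neg (by norm_num) (by linarith)
  set q := (2 : ℝ) ^ (1 - (2 * α + β))
  have hq' : 0 < 1 - q := by linarith
  set R := B * (N * Z) + D * (A + Z * N)
  have hR : 0 ≤ R := by positivity
  refine ⟨2 * (M * R) / (1 - q), by positivity, fun s t E hs hst ht hts => ?_⟩
  set w := s ^ (-β) with hw
  have hw0 : 0 ≤ w := Real.rpow_nonneg hs.le _
  have key := (hI.area s t hs.le hst ht E).norm_sub_le (C := M * R * (w * ‖E‖)) d.semigroup h2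
    (by positivity) hst fun u m v hsu hum hmv hvt => by
      have hu : 0 < u := hs.trans_le hsu
      have hm : 0 < m := hu.trans_le hum
      have hmu : 0 ≤ m - u := sub_nonneg.2 hum
      have hvm : 0 ≤ v - m := sub_nonneg.2 hmv
      have huw : u ^ (-β) ≤ w := Real.rpow_le_rpow_of_nonpos hs hsu (by linarith)
      have hu0 : 0 ≤ u ^ (-β) := Real.rpow_nonneg hu.le _
      have dy : ‖y u - y m‖ ≤ Z * w * (m - u) ^ β := by
        rw [norm_sub_rev]
        refine (hZ.path u m hu hum (by linarith)).trans ?_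
        gcongr
      have r1 : ‖y m - S (m - u) (y u) - XiY S g ω y z m u‖ ≤ A * w * (m - u) ^ (α + β) := by
        refine (hinc u m hu hum (by linarith)).trans ?_
        have := rpow_neg_mul_rpow_le hu hmu (by linarith) (by linarith : 0 ≤ α + β) hβ.le
        rw [show α + β + β = α + 2 * β by ring] at this
        calc _ = A * u ^ (-β) * (u ^ (-β) * (m - u) ^ (α + 2 * β)) := by ring
          _ ≤ A * w * (m - u) ^ (α + β) := by gcongr
      have r2 : ‖z m u (fderiv ℝ g (y u))‖ ≤ Z * w * (m - u) ^ (α + β) * N := by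
        refine (z m u).le_of_opNorm_le_of_le ?_ (hg.norm_fderiv_le _)
        refine (hZ.area_weighted u m hu hum (by linarith)).trans ?_
        gcongr
      have r3 : ‖y m - S (m - u) (y u) - omegaS S ω m u (g (y u))‖
          ≤ (A + Z * N) * (w * (m - u) ^ (α + β)) := by
        have e : y m - S (m - u) (y u) - omegaS S ω m u (g (y u))
            = (y m - S (m - u) (y u) - XiY S g ω y z m u) + z m u (fderiv ℝ g (y u)) := by
          rw [XiY]; abel
        rw [e]
        exact (norm_add_le _ _).trans ((add_le_add r1 r2).trans (le_of_eq (by ring)))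
      have b1 : ‖procB S ω ω2 v m E (g (y u) - g (y m))‖
          ≤ B * (N * Z) * (w * ‖E‖) * (v - u) ^ (2 * α + β) := by
        have p := rpow_mul_rpow_le hvm hmu (by linarith : v - m ≤ v - u)
          (by linarith : m - u ≤ v - u) (by linarith : 0 ≤ 2 * α) hβ.le
        calc _ ≤ B * (N * ‖y u - y m‖) * ‖E‖ * (v - m) ^ (2 * α) :=
              hpb m v _ E _ hm.le hmv (by linarith) (hg.norm_sub_le _ _) (hg.regular_sub _ _)
          _ ≤ B * (N * (Z * w * (m - u) ^ β)) * ‖E‖ * (v - m) ^ (2 * α) := by gcongr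
          _ = B * (N * Z) * (w * ‖E‖) * ((v - m) ^ (2 * α) * (m - u) ^ β) := by ring
          _ ≤ _ := by gcongr
      have b2 : ‖procA S ω v m E (y m - S (m - u) (y u) - omegaS S ω m u (g (y u)))‖
          ≤ D * (A + Z * N) * (w * ‖E‖) * (v - u) ^ (2 * α + β) := by
        have p := rpow_mul_rpow_le hvm hmu (by linarith : v - m ≤ v - u)
          (by linarith : m - u ≤ v - u) hα.le (by linarith : 0 ≤ α + β)
        rw [show α + (α + β) = 2 * α + β by ring] at p
        calc _ ≤ D * (v - m) ^ α * ‖E‖ * ((A + Z * N) * (w * (m - u) ^ (α + β))) :=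
              (hpa m v E _ hm.le hmv (by linarith)).trans (by gcongr)
          _ = D * (A + Z * N) * (w * ‖E‖) * ((v - m) ^ α * (m - u) ^ (α + β)) := by ring
          _ ≤ _ := by gcongr
      rw [d.defect_XiZ hg hβ hαβ h2 hu.le hum hmv (hvt.trans ht)]
      calc _ ≤ M * (B * (N * Z) * (w * ‖E‖) * (v - u) ^ (2 * α + β)
            + D * (A + Z * N) * (w * ‖E‖) * (v - u) ^ (2 * α + β)) :=
            (S (t - v)).le_of_opNorm_le_of_le (d.bound.norm_le _ (by linarith) (by linarith))
              ((norm_sub_le _ _).trans (add_le_add b1 b2))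
        _ = _ := by simp only [R]; ring
  have p := rpow_neg_mul_rpow_le hs (sub_nonneg.2 hst) hts (by linarith : 0 ≤ 2 * α) hβ.le
  calc _ ≤ 2 * (M * R * (w * ‖E‖)) / (1 - q) * (t - s) ^ (2 * α + β) := key
    _ = 2 * (M * R) / (1 - q) * ‖E‖ * (w * (t - s) ^ (2 * α + β)) := by ring
    _ ≤ _ := by gcongr

/-- If the path component of a solution is regular up to time `0`, then its area component is
`(α+β)`-Hölder up to time `0`. On `[(s+t)/2, t]`, where the singular weight is harmless, the term
`ω^S_{ts}(E y_s)` in the fixed point equation cancels the leading part of `a_{ts}(E, y_s)`; the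
algebraic relation then allows `[s,t]` to be halved towards `s`. -/
theorem exists_norm_area_le (d : RoughDriven S ω ω2 α M C T)
    (hg : CoeffBound S g β (2 * T) N) (h : MemX α β S ω T y z) (hβ : 0 < β) (hβα : β < α)
    (hαβ : α + β < 1) (h1 : 1 < α + 2 * β) (hI : IsImage S g ω ω2 T ξ y z y z) {R : ℝ}
    (hR : 0 ≤ R) (hreg : ∀ s : ℝ, 0 ≤ s → s ≤ T → IsRegular S α T R (y s))
    (hyβ : ∀ s t : ℝ, 0 ≤ s → s ≤ t → t ≤ T → ‖y t - y s‖ ≤ R * (t - s) ^ β) :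
    ∃ A : ℝ, 0 ≤ A ∧ ∀ s t : ℝ, 0 ≤ s → s ≤ t → t ≤ T → ‖z t s‖ ≤ A * (t - s) ^ (α + β) := by
  have hα := d.pos
  have hM := d.bound.nonneg
  have hN := hg.nonneg
  obtain ⟨Z, hZ⟩ := h.exists_pairBound hα hβ
  have hZ0 := hZ.nonneg
  obtain ⟨A, hA, hz⟩ := exists_norm_area_sub_XiZ_le d hg h hβ hβα hαβ h1 hI
  obtain ⟨B, hB, hpb⟩ := d.exists_norm_procB_le hβ hαβ (by linarith)
  obtain ⟨D, hD, hpa⟩ := d.exists_norm_procA_sub_omegaS_le hα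
  obtain ⟨F, hF, hbd⟩ := d.exists_norm_omegaS_apply_le
  have hγ : 0 < α + β := by linarith
  have hq : (2 : ℝ) ^ (-(α + β)) < 1 :=
    Real.rpow_lt_one_of_one_lt_of_neg (by norm_num) (by linarith)
  have hq' : 0 < 1 - (2 : ℝ) ^ (-(α + β)) := by linarith
  set Q := (A + B * N + D * R) * |T| ^ (α - β)
  have hQ : 0 ≤ Q := by positivity
  have hlocal : ∀ (s t : ℝ) (E : W →L[ℝ] V →L[ℝ] W), 0 < s → s ≤ t → t ≤ T → t - s ≤ s →
      ‖z t s E‖ ≤ Q * ‖E‖ * (t - s) ^ (α + β) := by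
    intro s t E hs hst ht hts
    have h0 : 0 ≤ t - s := sub_nonneg.2 hst
    have e : z t s E = (z t s E + omegaS S ω t s (E (y s)) - XiZ S g ω ω2 y y E t s)
        + procB S ω ω2 t s E (g (y s)) + (procA S ω t s E (y s) - omegaS S ω t s (E (y s))) := by
      rw [XiZ]; abel
    have b3 := hpa s t R E (y s) hs.le hst ht hR (hreg s hs.le (hst.trans ht))
    have p := rpow_add_le_mul_rpow (a := α + β) (b := α - β) h0
      (by linarith [le_abs_self T] : t - s ≤ |T|) hγ.le (by linarith)
    rw [show α + β + (α - β) = 2 * α by ring] at p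
    rw [← two_mul] at b3
    calc _ ≤ A * ‖E‖ * (t - s) ^ (2 * α) + B * N * ‖E‖ * (t - s) ^ (2 * α)
          + D * R * (t - s) ^ (2 * α) * ‖E‖ := by
          rw [e]
          exact norm_add₃_le.trans (add_le_add (add_le_add (hz s t E hs hst ht hts)
            (hpb s t N E _ hs.le hst ht (hg.norm_le _) (hg.regular _))) b3)
      _ = (A + B * N + D * R) * ‖E‖ * (t - s) ^ (2 * α) := by ring
      _ ≤ (A + B * N + D * R) * ‖E‖ * (|T| ^ (α - β) * (t - s) ^ (α + β)) := by gcongr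
      _ = _ := by simp only [Q]; ring
  refine ⟨M * (Q + F * R) / (1 - 2 ^ (-(α + β))), by positivity, fun s t hs hst ht => ?_⟩
  have h0 : 0 ≤ t - s := sub_nonneg.2 hst
  refine ContinuousLinearMap.opNorm_le_bound _ (by positivity) fun E => ?_
  rcases hst.eq_or_lt with rfl | hlt
  · rw [h.area.diag s ⟨hs, ht⟩]
    simp [Real.zero_rpow hγ.ne']
  set p : ℝ → ℝ := fun l => ‖S (t - (s + l)) (z (s + l) s E)‖ with hp
  have hhalf : ∀ l : ℝ, 0 < l → l ≤ t - s →
      p l ≤ p (l / 2) + M * (Q + F * R) * ‖E‖ * l ^ (α + β) := by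
    intro l hl hlt
    set m := s + l / 2 with hm
    have hm0 : 0 < m := by rw [hm]; positivity
    have hsm : s ≤ m := by rw [hm]; linarith
    have hml : m ≤ s + l := by rw [hm]; linarith
    have hlt' : s + l ≤ t := by linarith
    have hll : s + l - m = l / 2 := by rw [hm]; ring
    have hms : m - s = l / 2 := by rw [hm]; ring
    have halg := h.algebraic s m (s + l) hs hsm hml (by linarith) E
    have e : S (t - (s + l)) (z (s + l) s E) = S (t - (s + l))
        (z (s + l) m E + omegaS S ω (s + l) m (E (y m - y s))) + S (t - m) (z m s E) := by
      rw [← d.semigroup.comp_apply hml hlt', ← map_add, ← halg]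
      congr 1
      abel
    have b1 : ‖z (s + l) m E‖ ≤ Q * ‖E‖ * (l / 2) ^ (α + β) := by
      have := hlocal m (s + l) E hm0 hml (by linarith) (by rw [hll, hm]; linarith)
      rwa [hll] at this
    have b2 : ‖omegaS S ω (s + l) m (E (y m - y s))‖ ≤ F * R * ‖E‖ * (l / 2) ^ (α + β) := by
      have h3 := hbd m (s + l) (E (y m - y s)) hm0.le hml (by linarith)
      have h4 := hyβ s m hs hsm (by linarith)
      rw [hms] at h4
      rw [hll] at h3
      have h5 : ‖E (y m - y s)‖ ≤ ‖E‖ * (R * (l / 2) ^ β) :=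
        E.le_of_opNorm_le_of_le le_rfl h4
      rw [Real.rpow_add (by positivity)]
      calc _ ≤ F * (l / 2) ^ α * (‖E‖ * (R * (l / 2) ^ β)) := h3.trans (by gcongr)
        _ = _ := by ring
    have b3 : (l / 2) ^ (α + β) ≤ l ^ (α + β) := by
      gcongr
      linarith
    have b4 := (S (t - (s + l))).le_of_opNorm_le_of_le
      (d.bound.norm_le _ (by linarith) (by linarith)) ((norm_add_le _ _).trans (add_le_add b1 b2))
    have b5 : M * (Q * ‖E‖ * (l / 2) ^ (α + β) + F * R * ‖E‖ * (l / 2) ^ (α + β))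
        ≤ M * (Q + F * R) * ‖E‖ * l ^ (α + β) := by
      calc _ = M * (Q + F * R) * ‖E‖ * (l / 2) ^ (α + β) := by ring
        _ ≤ _ := by gcongr
    simp only [hp]
    rw [e, ← hm]
    refine (norm_add_le _ _).trans ?_
    linarith
  have hlim : Tendsto p (𝓝[>] 0) (𝓝 0) := by
    have h3 : Tendsto (fun l : ℝ => M * (Z * l ^ α * ‖E‖)) (𝓝[>] 0) (𝓝 0) := by
      have : Tendsto (fun l : ℝ => l ^ α) (𝓝[>] 0) (𝓝 (0 ^ α)) :=
        ((Real.continuousAt_rpow_const 0 α (Or.inr hα.le)).tendsto).mono_left nhdsWithin_le_nhds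
      have := ((this.const_mul Z).mul_const ‖E‖).const_mul M
      simpa [Real.zero_rpow hα.ne'] using this
    refine squeeze_zero' (.of_forall fun _ => norm_nonneg _) ?_ h3
    filter_upwards [Ioo_mem_nhdsGT (sub_pos.2 hlt)] with l hl
    refine (S _).le_of_opNorm_le_of_le
      (d.bound.norm_le _ (by linarith [hl.2]) (by linarith [hl.1])) ?_
    have := hZ.area s (s + l) hs (by linarith [hl.1]) (by linarith [hl.2])
    rw [add_sub_cancel_left] at this
    exact (z (s + l) s).le_of_opNorm_le this E
  have := le_of_halving hγ hhalf hlim (sub_pos.2 hlt) le_rfl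
  simp only [hp, add_sub_cancel, sub_self, d.semigroup.zero_apply] at this
  refine this.trans (le_of_eq (by ring))

end Area

/-! ### Shifts -/

section Shifts

variable {V W : Type*} [NormedAddCommGroup V] [NormedSpace ℝ V]
  [NormedAddCommGroup W] [NormedSpace ℝ W]

omit [NormedSpace ℝ V] in
theorem wienerShift_sub (τ : ℝ) (ω : ℝ → V) (t s : ℝ) :
    wienerShift τ ω t - wienerShift τ ω s = ω (t + τ) - ω (s + τ) :=
  sub_sub_sub_cancel_right _ _ _

theorem omegaS_wienerShift (S : ℝ → W →L[ℝ] W) (τ : ℝ) (ω : ℝ → V) (t s : ℝ) :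
    omegaS S (wienerShift τ ω) t s = omegaS S ω (t + τ) (s + τ) := by
  simp only [omegaS, wienerShift_sub]
  rw [← intervalIntegral.integral_comp_add_right _ τ]
  simp only [add_sub_add_right_eq_sub]

theorem procA_wienerShift (S : ℝ → W →L[ℝ] W) (τ : ℝ) (ω : ℝ → V) (t s : ℝ)
    (E : W →L[ℝ] V →L[ℝ] W) (x : W) :
    procA S (wienerShift τ ω) t s E x = procA S ω (t + τ) (s + τ) E x := by
  simp only [procA, omegaS_wienerShift]
  rw [← intervalIntegral.integral_comp_add_right _ τ]
  simp only [add_sub_add_right_eq_sub]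

variable [CompleteSpace W]

theorem procC_wienerShift (S : ℝ → W →L[ℝ] W) (τ : ℝ) (ω : ℝ → V) (ω2 : ℝ → ℝ → Tensor V)
    (t s : ℝ) (E : W →L[ℝ] V →L[ℝ] W) (K : V →L[ℝ] W) :
    procC S (wienerShift τ ω) (shift₂ τ ω2) t s E K = procC S ω ω2 (t + τ) (s + τ) E K := by
  simp only [procC, omegaS_wienerShift, shift₂, wienerShift_sub]
  rw [← intervalIntegral.integral_comp_add_right _ τ]
  simp only [add_sub_add_right_eq_sub]

theorem procB_wienerShift (S : ℝ → W →L[ℝ] W) (τ : ℝ) (ω : ℝ → V) (ω2 : ℝ → ℝ → Tensor V)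
    (t s : ℝ) (E : W →L[ℝ] V →L[ℝ] W) (K : V →L[ℝ] W) :
    procB S (wienerShift τ ω) (shift₂ τ ω2) t s E K = procB S ω ω2 (t + τ) (s + τ) E K := by
  simp only [procB, omegaS_wienerShift, procC_wienerShift]
  exact roughIntegral_shift S (fun v u => omegaS S ω v u (E (omegaS S ω u (s + τ) K))
    + procC S ω ω2 v u E K) s t τ

omit [CompleteSpace W] in
theorem SemigroupBound.mono {S : ℝ → W →L[ℝ] W} {M L L' : ℝ} (h : SemigroupBound S M L)
    (hL : L' ≤ L) : SemigroupBound S M L' :=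
  ⟨h.nonneg, fun t ht htL => h.norm_le t ht (htL.trans hL),
    fun t ht htL => h.deriv_le t ht (htL.trans hL)⟩

omit [CompleteSpace W] in
theorem RoughDriven.shift {S : ℝ → W →L[ℝ] W} {ω : ℝ → V} {ω2 : ℝ → ℝ → Tensor V}
    {α M C T : ℝ} (d : RoughDriven S ω ω2 α M C T) {τ T' : ℝ} (hτ : 0 ≤ τ) (hT : T' + τ ≤ T) :
    RoughDriven S (wienerShift τ ω) (shift₂ τ ω2) α M C T' where
  semigroup := d.semigroup
  bound := d.bound.mono (by linarith)
  pos := d.pos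
  lt_one := d.lt_one
  nonneg := d.nonneg
  holder s t hs hst ht := by
    have := d.holder (s + τ) (t + τ) (by linarith) (by linarith) (by linarith)
    rwa [wienerShift_sub, ← add_sub_add_right_eq_sub t s τ]
  norm_area_le s t hs hst ht := by
    have := d.norm_area_le (s + τ) (t + τ) (by linarith) (by linarith) (by linarith)
    rwa [add_sub_add_right_eq_sub] at this
  chen s u t hs hsu hut ht := by
    rw [wienerShift_sub, wienerShift_sub]
    exact d.chen (s + τ) (u + τ) (t + τ) (by linarith) (by linarith) (by linarith) (by linarith)

omit [CompleteSpace W] in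
theorem RoughDriven.mono {S : ℝ → W →L[ℝ] W} {ω : ℝ → V} {ω2 : ℝ → ℝ → Tensor V}
    {α M C T : ℝ} (d : RoughDriven S ω ω2 α M C T) {T' : ℝ} (hT : T' ≤ T) :
    RoughDriven S ω ω2 α M C T' where
  semigroup := d.semigroup
  bound := d.bound.mono (by linarith)
  pos := d.pos
  lt_one := d.lt_one
  nonneg := d.nonneg
  holder s t hs hst ht := d.holder s t hs hst (ht.trans hT)
  norm_area_le s t hs hst ht := d.norm_area_le s t hs hst (ht.trans hT)
  chen s u t hs hsu hut ht := d.chen s u t hs hsu hut (ht.trans hT)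

omit [CompleteSpace W] in
theorem IsRoughPath.exists_roughDriven {S : ℝ → W →L[ℝ] W} {ω : ℝ → V} {ω2 : ℝ → ℝ → Tensor V}
    {α M T : ℝ} (h : IsRoughPath α T ω ω2) (hS : IsAnalyticSemigroup S)
    (hM : SemigroupBound S M (2 * T)) (hα : 0 < α) (hα1 : α < 1) :
    ∃ C : ℝ, RoughDriven S ω ω2 α M C T := by
  obtain ⟨C₁, h₁⟩ := h.holder
  obtain ⟨C₂, h₂⟩ := h.area.holder
  have k₁ : C₁ ≤ |C₁| + |C₂| := by linarith [le_abs_self C₁, abs_nonneg C₂]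
  have k₂ : C₂ ≤ |C₁| + |C₂| := by linarith [le_abs_self C₂, abs_nonneg C₁]
  refine ⟨|C₁| + |C₂|, ⟨⟨hS, hM, hα, hα1, by positivity, fun s t hs hst ht => ?_⟩,
    fun s t hs hst ht => ?_, h.chen⟩⟩
  · have := Real.rpow_nonneg (sub_nonneg.2 hst) α
    exact (h₁ s t hs hst ht).trans (by gcongr)
  · rcases hst.eq_or_lt with rfl | hlt
    · rw [h.area.diag s ⟨hs, ht⟩]
      simp [Real.zero_rpow (by positivity : 2 * α ≠ 0)]
    · have := Real.rpow_nonneg (sub_nonneg.2 hst) (2 * α)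
      exact (h₂ s t hs hlt ht).trans (by gcongr)

end Shifts

/-! ### Concatenation -/

section Concatenation

variable {V W : Type*} [NormedAddCommGroup V] [NormedSpace ℝ V]
  [NormedAddCommGroup W] [NormedSpace ℝ W] {S : ℝ → W →L[ℝ] W} {ω : ℝ → V}
  {ω2 : ℝ → ℝ → Tensor V} {g : W → V →L[ℝ] W} {ξ : W}
  {y₁ y₂ y : ℝ → W} {z₁ z₂ z : ℝ → ℝ → AreaSpace V W}
  {α β M C T₁ T₂ N : ℝ}

/-- `(y, z)` is the concatenation at time `T₁` of `(y₁, z₁)` and of `(y₂, z₂)`. On intervals that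
contain `T₁`, the area component is the value that the algebraic relation imposes. -/
structure IsConcat (S : ℝ → W →L[ℝ] W) (ω : ℝ → V) (T₁ T₂ : ℝ) (y₁ : ℝ → W)
    (z₁ : ℝ → ℝ → AreaSpace V W) (y₂ : ℝ → W) (z₂ : ℝ → ℝ → AreaSpace V W) (y : ℝ → W)
    (z : ℝ → ℝ → AreaSpace V W) : Prop where
  path_left : ∀ t : ℝ, 0 ≤ t → t ≤ T₁ → y t = y₁ t
  path_right : ∀ t : ℝ, T₁ ≤ t → t ≤ T₁ + T₂ → y t = y₂ (t - T₁)
  area_left : ∀ s t : ℝ, 0 ≤ s → s ≤ t → t ≤ T₁ → z t s = z₁ t s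
  area_mid : ∀ s t : ℝ, 0 ≤ s → s ≤ T₁ → T₁ ≤ t → t ≤ T₁ + T₂ → ∀ E : W →L[ℝ] V →L[ℝ] W,
    z t s E = omegaS S ω t T₁ (E (y₁ T₁ - y₁ s)) + z₂ (t - T₁) 0 E + S (t - T₁) (z₁ T₁ s E)
  area_right : ∀ s t : ℝ, T₁ ≤ s → s ≤ t → t ≤ T₁ + T₂ → z t s = z₂ (t - T₁) (s - T₁)

theorem exists_isConcat (hS : IsAnalyticSemigroup S) (hy : y₂ 0 = y₁ T₁) (hT₁ : 0 ≤ T₁)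
    (hz₁ : z₁ T₁ T₁ = 0) (hz₂ : z₂ 0 0 = 0) :
    ∃ y z, IsConcat S ω T₁ T₂ y₁ z₁ y₂ z₂ y z := by
  classical
  refine ⟨fun t => if t ≤ T₁ then y₁ t else y₂ (t - T₁), fun t s => if t ≤ T₁ then z₁ t s else
    if T₁ ≤ s then z₂ (t - T₁) (s - T₁) else
      (omegaS S ω t T₁).comp (ContinuousLinearMap.apply ℝ _ (y₁ T₁ - y₁ s)) + z₂ (t - T₁) 0
        + (S (t - T₁)).comp (z₁ T₁ s), ⟨fun t _ ht => if_pos ht, fun t ht _ => ?_,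
        fun s t _ _ ht => if_pos ht, fun s t _ hs ht _ E => ?_, fun s t hs hst _ => ?_⟩⟩
  · rcases ht.eq_or_lt with rfl | hlt
    · simp [hy]
    · simp [hlt]
  · rcases ht.eq_or_lt with rfl | hlt
    · simp [omegaS_self hS, hz₂, hS.zero_apply]
    · rcases hs.eq_or_lt with rfl | hlt'
      · simp [hlt.not_ge, hz₁]
      · simp [hlt.not_ge, hlt'.not_ge]
  · rcases (hs.trans hst).eq_or_lt with rfl | hlt
    · obtain rfl : s = T₁ := le_antisymm hst hs
      simp [hz₁, hz₂]
    · simp [hlt.not_ge, hs]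

end Concatenation

/-! ### Estimates for the concatenation -/

section ConcatEstimates

variable {V W : Type*} [NormedAddCommGroup V] [NormedSpace ℝ V]
  [NormedAddCommGroup W] [NormedSpace ℝ W] {S : ℝ → W →L[ℝ] W} {ω : ℝ → V}
  {ω2 : ℝ → ℝ → Tensor V} {g : W → V →L[ℝ] W} {ξ : W}
  {y₁ y₂ y : ℝ → W} {z₁ z₂ z : ℝ → ℝ → AreaSpace V W}
  {α β M C T T₁ T₂ N : ℝ}

omit [NormedSpace ℝ V] in
/-- Mild increments of order `α` make a path regular at positive times, with a constant that
degenerates at time `0` because of the initial value only. -/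
theorem Driven.exists_norm_deriv_path_le (d : Driven S ω α M C T) {A : ℝ} (hA : 0 ≤ A)
    (hinc : ∀ s t : ℝ, 0 ≤ s → s ≤ t → t ≤ T → ‖y t - S (t - s) (y s)‖ ≤ A * (t - s) ^ α) :
    ∃ K : ℝ, 0 ≤ K ∧ ∀ h t : ℝ, 0 < h → 0 ≤ t → t ≤ T → h + t ≤ 2 * T →
      ‖deriv S h (y t)‖ ≤ K * h ^ (α - 1) + K / (h + t) := by
  have hM := d.bound.nonneg
  have hq : (2 : ℝ) ^ (α - 1) < 1 :=
    Real.rpow_lt_one_of_one_lt_of_neg (by norm_num) (by linarith [d.lt_one])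
  have hq' : 0 < 1 - (2 : ℝ) ^ (α - 1) := by linarith
  set K₁ := M * A / (1 - 2 ^ (α - 1))
  have hK₁ : 0 ≤ K₁ := by positivity
  refine ⟨K₁ + M * ‖y 0‖, by positivity, fun h t hh ht htT hhT => ?_⟩
  have key := d.semigroup.norm_deriv_apply_le d.bound (f := y) (a := 0) (T := T) (C := M * A)
    d.lt_one (by positivity) (fun h u t hh hhL hu hut htT htu => by
      have h0 : 0 ≤ t - u := sub_nonneg.2 hut
      calc _ ≤ M / h * (A * h ^ α) :=
            (deriv S h).le_of_opNorm_le_of_le (d.bound.deriv_le h hh hhL)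
              ((hinc u t hu hut htT).trans (by have := d.pos; gcongr))
        _ = _ := by rw [Real.rpow_sub_one hh.ne']; field_simp) hh ht htT (by linarith)
  rw [sub_zero] at key
  refine key.trans ?_
  have h1 : 0 ≤ M * ‖y 0‖ := by positivity
  gcongr
  · linarith
  · linarith

omit [NormedSpace ℝ V] in
/-- Mild increments of order `α` yield the weighted `β`-Hölder condition for `β < α`. -/
theorem Driven.exists_weighted_holder [CompleteSpace W] (d : Driven S ω α M C T) (hβ : 0 < β)
    (hβα : β < α) (hT : 0 < T) {A : ℝ} (hA : 0 ≤ A)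
    (hinc : ∀ s t : ℝ, 0 ≤ s → s ≤ t → t ≤ T → ‖y t - S (t - s) (y s)‖ ≤ A * (t - s) ^ α) :
    ∃ K : ℝ, 0 ≤ K ∧ ∀ s t : ℝ, 0 < s → s ≤ t → t ≤ T →
      s ^ β * ‖y t - y s‖ ≤ K * (t - s) ^ β := by
  obtain ⟨K, hK, hreg⟩ := d.exists_norm_deriv_path_le hA hinc
  have hα := d.pos
  have hα1 := d.lt_one
  refine ⟨T ^ β * (A * T ^ (α - β)) + (K * T ^ (α - β) * T ^ β + K) / β, by positivity,
    fun s t hs hst ht => ?_⟩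
  have h0 : 0 ≤ t - s := sub_nonneg.2 hst
  have hsβ : 0 < s ^ β := Real.rpow_pos_of_pos hs β
  have hsT : s ^ β ≤ T ^ β := Real.rpow_le_rpow hs.le (hst.trans ht) hβ.le
  have split : ∀ r : ℝ, 0 ≤ r → r ≤ T → r ^ α ≤ T ^ (α - β) * r ^ β := fun r hr hrT => by
    have := rpow_add_le_mul_rpow (a := β) (b := α - β) hr hrT hβ.le (by linarith)
    rwa [add_sub_cancel] at this
  have b1 : ‖y t - S (t - s) (y s)‖ ≤ A * (T ^ (α - β) * (t - s) ^ β) :=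
    (hinc s t hs.le hst ht).trans (by gcongr; exact split _ h0 (by linarith))
  have b2 : ‖S (t - s) (y s) - y s‖ ≤ (K * T ^ (α - β) + K / s ^ β) / β * (t - s) ^ β := by
    refine d.semigroup.norm_apply_sub_le hβ (by positivity) h0 fun r hr hrh => ?_
    refine (hreg r s hr hs.le (by linarith) (by linarith)).trans ?_
    have e1 : r ^ (α - 1) ≤ T ^ (α - β) * r ^ (β - 1) := by
      rw [Real.rpow_sub_one hr.ne', Real.rpow_sub_one hr.ne', ← mul_div_assoc]
      gcongr
      exact split r hr.le (by linarith)
    -- The sum `r + s` dominates the weighted geometric mean `r^(1-β) s^β`.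
    have e2 : K / (r + s) ≤ K / s ^ β * r ^ (β - 1) := by
      have hrs : r ^ (1 - β) * s ^ β ≤ r + s := by
        have := rpow_mul_rpow_le hr.le hs.le (by linarith : r ≤ r + s) (by linarith : s ≤ r + s)
          (by linarith : 0 ≤ 1 - β) hβ.le
        rwa [sub_add_cancel, Real.rpow_one] at this
      have hr1 : 0 < r ^ (1 - β) := Real.rpow_pos_of_pos hr _
      rw [show β - 1 = -(1 - β) by ring, Real.rpow_neg hr.le, ← div_eq_mul_inv, div_div,
        mul_comm (s ^ β)]
      gcongr
    calc _ ≤ K * (T ^ (α - β) * r ^ (β - 1)) + K / s ^ β * r ^ (β - 1) := by gcongr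
      _ = _ := by ring
  have e : y t - y s = (y t - S (t - s) (y s)) + (S (t - s) (y s) - y s) := by abel
  calc s ^ β * ‖y t - y s‖ ≤ s ^ β * (A * (T ^ (α - β) * (t - s) ^ β)
        + (K * T ^ (α - β) + K / s ^ β) / β * (t - s) ^ β) := by
        rw [e]
        gcongr
        exact (norm_add_le _ _).trans (add_le_add b1 b2)
    _ = s ^ β * (A * T ^ (α - β) * (t - s) ^ β)
        + (K * T ^ (α - β) * s ^ β + K) / β * (t - s) ^ β := by field_simp
    _ ≤ T ^ β * (A * T ^ (α - β) * (t - s) ^ β)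
        + (K * T ^ (α - β) * T ^ β + K) / β * (t - s) ^ β := by gcongr
    _ = _ := by ring

namespace IsConcat

theorem exists_norm_increment_le (hc : IsConcat S ω T₁ T₂ y₁ z₁ y₂ z₂ y z)
    (d : Driven S ω α M C (T₁ + T₂)) (hT₁ : 0 ≤ T₁)
    (h₁ : ∃ A : ℝ, 0 ≤ A ∧ ∀ s t : ℝ, 0 ≤ s → s ≤ t → t ≤ T₁ →
      ‖y₁ t - S (t - s) (y₁ s)‖ ≤ A * (t - s) ^ α)
    (h₂ : ∃ A : ℝ, 0 ≤ A ∧ ∀ s t : ℝ, 0 ≤ s → s ≤ t → t ≤ T₂ →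
      ‖y₂ t - S (t - s) (y₂ s)‖ ≤ A * (t - s) ^ α) :
    ∃ A : ℝ, 0 ≤ A ∧ ∀ s t : ℝ, 0 ≤ s → s ≤ t → t ≤ T₁ + T₂ →
      ‖y t - S (t - s) (y s)‖ ≤ A * (t - s) ^ α := by
  obtain ⟨A₁, hA₁, i₁⟩ := h₁
  obtain ⟨A₂, hA₂, i₂⟩ := h₂
  have hM := d.bound.nonneg
  have hα := d.pos
  have left : ∀ s t : ℝ, 0 ≤ s → s ≤ t → t ≤ T₁ → ‖y t - S (t - s) (y s)‖ ≤ A₁ * (t - s) ^ α := by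
    intro s t hs hst ht
    rw [hc.path_left t (hs.trans hst) ht, hc.path_left s hs (hst.trans ht)]
    exact i₁ s t hs hst ht
  have right : ∀ s t : ℝ, T₁ ≤ s → s ≤ t → t ≤ T₁ + T₂ →
      ‖y t - S (t - s) (y s)‖ ≤ A₂ * (t - s) ^ α := by
    intro s t hs hst ht
    rw [hc.path_right t (hs.trans hst) ht, hc.path_right s hs (hst.trans ht)]
    have := i₂ (s - T₁) (t - T₁) (by linarith) (by linarith) (by linarith)
    rwa [sub_sub_sub_cancel_right] at this
  refine ⟨A₁ + A₂ + M * A₁, by positivity, fun s t hs hst ht => ?_⟩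
  have hp : 0 ≤ (t - s) ^ α := Real.rpow_nonneg (sub_nonneg.2 hst) _
  rcases le_total t T₁ with htT | htT
  · refine (left s t hs hst htT).trans ?_
    gcongr
    nlinarith [mul_nonneg hM hA₁]
  rcases le_total T₁ s with hsT | hsT
  · refine (right s t hsT hst ht).trans ?_
    gcongr
    nlinarith [mul_nonneg hM hA₁]
  have e : y t - S (t - s) (y s)
      = (y t - S (t - T₁) (y T₁)) + S (t - T₁) (y T₁ - S (T₁ - s) (y s)) := by
    rw [map_sub, d.semigroup.comp_apply hsT htT]; abel
  have b1 : ‖y t - S (t - T₁) (y T₁)‖ ≤ A₂ * (t - s) ^ α :=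
    (right T₁ t le_rfl htT ht).trans (by gcongr)
  have b2 : ‖S (t - T₁) (y T₁ - S (T₁ - s) (y s))‖ ≤ M * (A₁ * (t - s) ^ α) :=
    (S (t - T₁)).le_of_opNorm_le_of_le (d.bound.norm_le _ (by linarith) (by linarith))
      ((left s T₁ hs hsT le_rfl).trans (by gcongr))
  rw [e]
  refine (norm_add_le _ _).trans ((add_le_add b1 b2).trans ?_)
  nlinarith [mul_nonneg hA₁ hp]

theorem continuousOn_path (hc : IsConcat S ω T₁ T₂ y₁ z₁ y₂ z₂ y z) (hT₁ : 0 ≤ T₁) (hT₂ : 0 ≤ T₂)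
    (h₁ : ContinuousOn y₁ (Icc 0 T₁)) (h₂ : ContinuousOn y₂ (Icc 0 T₂)) :
    ContinuousOn y (Icc 0 (T₁ + T₂)) := by
  rw [← Icc_union_Icc_eq_Icc hT₁ (by linarith : T₁ ≤ T₁ + T₂)]
  refine ContinuousOn.union_of_isClosed (h₁.congr fun t ht => hc.path_left t ht.1 ht.2) ?_
    isClosed_Icc isClosed_Icc
  have : ContinuousOn (fun t => y₂ (t - T₁)) (Icc T₁ (T₁ + T₂)) :=
    h₂.comp (by fun_prop) fun t ht => ⟨by linarith [ht.1], by linarith [ht.2]⟩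
  exact this.congr fun t ht => hc.path_right t ht.1 ht.2

/-- The algebraic relation passes to the concatenation; for `s ≤ T₁ ≤ t` it follows from the
relations of both pieces and from the additivity of `ω^S`. -/
theorem algebraic [CompleteSpace W] (hc : IsConcat S ω T₁ T₂ y₁ z₁ y₂ z₂ y z)
    (d : Driven S ω α M C (T₁ + T₂)) (hT₁ : 0 ≤ T₁) (hT₂ : 0 ≤ T₂)
    (h₁ : MemX α β S ω T₁ y₁ z₁) (h₂ : MemX α β S (wienerShift T₁ ω) T₂ y₂ z₂) (s τ t : ℝ)
    (hs : 0 ≤ s) (hsτ : s ≤ τ) (hτt : τ ≤ t) (ht : t ≤ T₁ + T₂) (E : W →L[ℝ] V →L[ℝ] W) :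
    z t s E - z t τ E - S (t - τ) (z τ s E) = omegaS S ω t τ (E (y τ - y s)) := by
  have hτ0 := hs.trans hsτ
  have hy : y₂ 0 = y₁ T₁ := by
    rw [← hc.path_left T₁ hT₁ le_rfl, hc.path_right T₁ le_rfl (by linarith), sub_self]
  have right : ∀ s τ t : ℝ, T₁ ≤ s → s ≤ τ → τ ≤ t → t ≤ T₁ + T₂ →
      z₂ (t - T₁) (s - T₁) E - z₂ (t - T₁) (τ - T₁) E - S (t - τ) (z₂ (τ - T₁) (s - T₁) E)
        = omegaS S ω t τ (E (y₂ (τ - T₁) - y₂ (s - T₁))) := by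
    intro s τ t hs hsτ hτt ht
    have := h₂.algebraic (s - T₁) (τ - T₁) (t - T₁) (by linarith) (by linarith) (by linarith)
      (by linarith) E
    rwa [omegaS_wienerShift, sub_add_cancel, sub_add_cancel, sub_sub_sub_cancel_right] at this
  rcases le_total t T₁ with htT | htT
  · rw [hc.area_left s t hs (hsτ.trans hτt) htT, hc.area_left τ t hτ0 hτt htT,
      hc.area_left s τ hs hsτ (hτt.trans htT), hc.path_left τ hτ0 (hτt.trans htT),
      hc.path_left s hs ((hsτ.trans hτt).trans htT)]
    exact h₁.algebraic s τ t hs hsτ hτt htT E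
  rcases le_total T₁ s with hsT | hsT
  · rw [hc.area_right s t hsT (hsτ.trans hτt) ht, hc.area_right τ t (hsT.trans hsτ) hτt ht,
      hc.area_right s τ hsT hsτ (hτt.trans ht), hc.path_right τ (hsT.trans hsτ) (hτt.trans ht),
      hc.path_right s hsT ((hsτ.trans hτt).trans ht)]
    exact right s τ t hsT hsτ hτt ht
  rcases le_total τ T₁ with hτT | hτT
  · have a1 := h₁.algebraic s τ T₁ hs hsτ hτT le_rfl E
    have a2 : z₁ T₁ s E = z₁ T₁ τ E + S (T₁ - τ) (z₁ τ s E)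
        + omegaS S ω T₁ τ (E (y₁ τ - y₁ s)) := by rw [← a1]; abel
    rw [hc.area_mid s t hs hsT htT ht, hc.area_mid τ t hτ0 hτT htT ht,
      hc.area_left s τ hs hsτ hτT, hc.path_left τ hτ0 hτT, hc.path_left s hs hsT, a2,
      d.omegaS_add hτ0 hτT htT ht]
    simp only [map_add, map_sub, d.semigroup.comp_apply hτT htT]
    abel
  · have a1 := right T₁ τ t le_rfl hτT hτt ht
    rw [sub_self, hy] at a1
    have a2 : z₂ (t - T₁) 0 E = z₂ (t - T₁) (τ - T₁) E + S (t - τ) (z₂ (τ - T₁) 0 E)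
        + omegaS S ω t τ (E (y₂ (τ - T₁) - y₁ T₁)) := by rw [← a1]; abel
    rw [hc.area_mid s t hs hsT htT ht, hc.area_right τ t hτT hτt ht,
      hc.area_mid s τ hs hsT hτT (hτt.trans ht), hc.path_right τ hτT (hτt.trans ht),
      hc.path_left s hs hsT, a2, d.omegaS_add hT₁ hτT hτt ht]
    simp only [map_add, map_sub, d.semigroup.comp_apply hτT hτt]
    abel

/-- On intervals that contain `T₁`, the bounds on the area components of both pieces add up. -/
theorem exists_norm_area_mid_le [CompleteSpace W] (hc : IsConcat S ω T₁ T₂ y₁ z₁ y₂ z₂ y z)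
    (d : Driven S ω α M C (T₁ + T₂)) (hT₁ : 0 ≤ T₁) :
    ∃ A : ℝ, 0 ≤ A ∧ ∀ s t Q P γ κ : ℝ, 0 ≤ s → s ≤ T₁ → T₁ ≤ t → t ≤ T₁ + T₂ → 0 ≤ Q → 0 ≤ P →
      0 ≤ κ → 0 ≤ γ → γ = α + κ → ‖y₁ T₁ - y₁ s‖ ≤ Q * (T₁ - s) ^ κ →
      ‖z₂ (t - T₁) 0‖ ≤ P * (t - T₁) ^ γ → ‖z₁ T₁ s‖ ≤ Q * (T₁ - s) ^ γ →
      ‖z t s‖ ≤ A * (Q + P) * (t - s) ^ γ := by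
  obtain ⟨F, hF, hbd⟩ := d.exists_norm_omegaS_apply_le
  have hM := d.bound.nonneg
  have hα := d.pos
  refine ⟨F + 1 + M, by positivity,
    fun s t Q P γ κ hs hsT htT ht hQ hP hκ hγ hγκ b1 b2 b3 => ?_⟩
  have h1 : 0 ≤ t - T₁ := sub_nonneg.2 htT
  have h2 : 0 ≤ T₁ - s := sub_nonneg.2 hsT
  have h3 : 0 ≤ t - s := by linarith
  have p1 : (t - T₁) ^ α * (T₁ - s) ^ κ ≤ (t - s) ^ γ := by
    rw [hγκ]
    exact rpow_mul_rpow_le h1 h2 (by linarith) (by linarith) hα.le hκ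
  have p2 : (t - T₁) ^ γ ≤ (t - s) ^ γ := by gcongr
  have p3 : (T₁ - s) ^ γ ≤ (t - s) ^ γ := by gcongr
  refine ContinuousLinearMap.opNorm_le_bound _ (by positivity) fun E => ?_
  have c1 : ‖omegaS S ω t T₁ (E (y₁ T₁ - y₁ s))‖ ≤ F * Q * ‖E‖ * (t - s) ^ γ := by
    calc _ ≤ F * (t - T₁) ^ α * (‖E‖ * (Q * (T₁ - s) ^ κ)) := by
          refine (hbd T₁ t _ hT₁ htT ht).trans ?_
          gcongr
          exact E.le_of_opNorm_le_of_le le_rfl b1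
      _ = F * Q * ‖E‖ * ((t - T₁) ^ α * (T₁ - s) ^ κ) := by ring
      _ ≤ _ := by gcongr
  have c2 : ‖z₂ (t - T₁) 0 E‖ ≤ P * (t - s) ^ γ * ‖E‖ :=
    (z₂ (t - T₁) 0).le_of_opNorm_le (b2.trans (by gcongr)) E
  have c3 : ‖S (t - T₁) (z₁ T₁ s E)‖ ≤ M * (Q * (t - s) ^ γ * ‖E‖) :=
    (S (t - T₁)).le_of_opNorm_le_of_le (d.bound.norm_le _ h1 (by linarith))
      ((z₁ T₁ s).le_of_opNorm_le (b3.trans (by gcongr)) E)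
  rw [hc.area_mid s t hs hsT htT ht]
  refine norm_add₃_le.trans ((add_le_add (add_le_add c1 c2) c3).trans ?_)
  have hp : 0 ≤ (t - s) ^ γ * ‖E‖ := by positivity
  calc _ = (F * Q + P + M * Q) * ((t - s) ^ γ * ‖E‖) := by ring
    _ ≤ ((F + 1 + M) * (Q + P)) * ((t - s) ^ γ * ‖E‖) := by
        gcongr
        nlinarith [mul_nonneg hF hP, mul_nonneg hM hP]
    _ = _ := by ring

end IsConcat

end ConcatEstimates

/-! ### The concatenation is a fixed point -/

/-- Adjacent rough integrals can be joined as soon as the integrand is of some positive Hölder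
order: inserting the common end point into a partition changes its sum by one small defect. -/
theorem HasRoughIntegral.join_of_norm_le {W : Type*} [NormedAddCommGroup W] [NormedSpace ℝ W]
    {S : ℝ → W →L[ℝ] W} {Ξ : ℝ → ℝ → W} {x x' : W} {M L A α a m b : ℝ}
    (hS : IsAnalyticSemigroup S) (hM : SemigroupBound S M L) (hL : b - a ≤ L) (hα : 0 < α)
    (hA : 0 ≤ A) (ham : a ≤ m) (hmb : m ≤ b)
    (hΞ : ∀ u v : ℝ, a ≤ u → u ≤ v → v ≤ b → ‖Ξ v u‖ ≤ A * (v - u) ^ α)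
    (h : HasRoughIntegral S Ξ a m x) (h' : HasRoughIntegral S Ξ m b x') :
    HasRoughIntegral S Ξ a b (S (b - m) x + x') := by
  refine h.join hS ham hmb h' fun ε hε => ?_
  have hM0 := hM.nonneg
  set c := M * (A + A + M * A) with hc
  have hc0 : 0 ≤ c := by positivity
  refine ⟨(ε / (c + 1)) ^ α⁻¹, by positivity, fun p q hap hpm hmq hqb hpq => ?_⟩
  have hqp : 0 ≤ q - p := by linarith
  have hr : (q - p) ^ α < ε / (c + 1) := by
    have := Real.rpow_lt_rpow hqp hpq hα
    rwa [Real.rpow_inv_rpow (by positivity) hα.ne'] at this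
  have b1 : ‖Ξ q p‖ ≤ A * (q - p) ^ α := hΞ p q hap (hpm.trans hmq) hqb
  have b2 : ‖Ξ q m‖ ≤ A * (q - p) ^ α := by
    refine (hΞ m q ham hmq hqb).trans ?_
    have : 0 ≤ q - m := by linarith
    gcongr
  have b3 : ‖S (q - m) (Ξ m p)‖ ≤ M * (A * (q - p) ^ α) := by
    refine (S _).le_of_opNorm_le_of_le (hM.norm_le _ (by linarith) (by linarith))
      ((hΞ p m hap hpm hmb).trans ?_)
    have : 0 ≤ m - p := by linarith
    gcongr
  have b4 : ‖defect S Ξ q m p‖ ≤ (A + A + M * A) * (q - p) ^ α := by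
    refine (norm_sub_le_of_le (norm_sub_le_of_le b1 b2) b3).trans (le_of_eq (by ring))
  calc _ ≤ M * ((A + A + M * A) * (q - p) ^ α) :=
        (S _).le_of_opNorm_le_of_le (hM.norm_le _ (by linarith) (by linarith)) b4
    _ = c * (q - p) ^ α := by rw [hc]; ring
    _ ≤ c * (ε / (c + 1)) := by gcongr
    _ < (c + 1) * (ε / (c + 1)) := by
        have : 0 < ε / (c + 1) := by positivity
        gcongr
        linarith
    _ = ε := by field_simp

section ConcatSolution

variable {V W : Type*} [NormedAddCommGroup V] [NormedSpace ℝ V]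
  [NormedAddCommGroup W] [NormedSpace ℝ W] [CompleteSpace W] {S : ℝ → W →L[ℝ] W} {ω : ℝ → V}
  {ω2 : ℝ → ℝ → Tensor V} {g : W → V →L[ℝ] W} {ξ : W}
  {y₁ y₂ y : ℝ → W} {z₁ z₂ z : ℝ → ℝ → AreaSpace V W}
  {α β M C T T₁ T₂ N : ℝ}

omit [CompleteSpace W] in
theorem CoeffBound.mono {L L' : ℝ} (h : CoeffBound S g β L N) (hL : L' ≤ L) :
    CoeffBound S g β L' N where
  nonneg := h.nonneg
  norm_le := h.norm_le
  regular x v l hl hlL := h.regular x v l hl (hlL.trans hL)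
  norm_sub_le := h.norm_sub_le
  regular_sub x x' v l hl hlL := h.regular_sub x x' v l hl (hlL.trans hL)
  norm_fderiv_le := h.norm_fderiv_le
  norm_fderiv_sub_le := h.norm_fderiv_sub_le
  taylor := h.taylor

namespace IsConcat

theorem exists_norm_area_le (hc : IsConcat S ω T₁ T₂ y₁ z₁ y₂ z₂ y z)
    (d : Driven S ω α M C (T₁ + T₂)) (hβ : 0 < β) (hT₁ : 0 ≤ T₁)
    (m₁ : MemX α β S ω T₁ y₁ z₁) (m₂ : MemX α β S (wienerShift T₁ ω) T₂ y₂ z₂) :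
    ∃ A : ℝ, 0 ≤ A ∧ ∀ s t : ℝ, 0 ≤ s → s ≤ t → t ≤ T₁ + T₂ → ‖z t s‖ ≤ A * (t - s) ^ α := by
  have hα := d.pos
  obtain ⟨Z₁, hZ₁⟩ := m₁.exists_pairBound hα hβ
  obtain ⟨Z₂, hZ₂⟩ := m₂.exists_pairBound hα hβ
  obtain ⟨F, hF, hmid⟩ := hc.exists_norm_area_mid_le d hT₁
  have hZ₁0 := hZ₁.nonneg
  have hZ₂0 := hZ₂.nonneg
  refine ⟨Z₁ + Z₂ + F * (2 * Z₁ + Z₂), by positivity, fun s t hs hst ht => ?_⟩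
  have hp : 0 ≤ (t - s) ^ α := Real.rpow_nonneg (sub_nonneg.2 hst) α
  have hF' : 0 ≤ F * (2 * Z₁ + Z₂) := by positivity
  rcases le_total t T₁ with htT | htT
  · rw [hc.area_left s t hs hst htT]
    refine (hZ₁.area s t hs hst htT).trans ?_
    gcongr
    linarith
  rcases le_total T₁ s with hsT | hsT
  · rw [hc.area_right s t hsT hst ht]
    have := hZ₂.area (s - T₁) (t - T₁) (by linarith) (by linarith) (by linarith)
    rw [sub_sub_sub_cancel_right] at this
    refine this.trans ?_
    gcongr
    linarith
  have k1 : ‖y₁ T₁ - y₁ s‖ ≤ 2 * Z₁ * (T₁ - s) ^ (0 : ℝ) := by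
    rw [Real.rpow_zero, mul_one, two_mul]
    exact norm_sub_le_of_le (hZ₁.norm_path_le T₁ hT₁ le_rfl) (hZ₁.norm_path_le s hs hsT)
  have k2 : ‖z₂ (t - T₁) 0‖ ≤ Z₂ * (t - T₁) ^ α := by
    simpa using hZ₂.area 0 (t - T₁) le_rfl (by linarith) (by linarith)
  have k3 : ‖z₁ T₁ s‖ ≤ 2 * Z₁ * (T₁ - s) ^ α := by
    refine (hZ₁.area s T₁ hs hsT le_rfl).trans ?_
    have := Real.rpow_nonneg (sub_nonneg.2 hsT) α
    gcongr
    linarith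
  refine (hmid s t (2 * Z₁) Z₂ α 0 hs hsT htT ht (by positivity) hZ₂0 le_rfl hα.le
    (add_zero α).symm k1 k2 k3).trans ?_
  gcongr
  linarith

/-- Since the area component of the second piece has no singularity at its initial time, the
weight is needed at time `0` only. -/
theorem exists_weighted_norm_area_le (hc : IsConcat S ω T₁ T₂ y₁ z₁ y₂ z₂ y z)
    (d : Driven S ω α M C (T₁ + T₂)) (hβ : 0 < β) (hT₁ : 0 ≤ T₁) (hT₂ : 0 ≤ T₂)
    (m₁ : MemX α β S ω T₁ y₁ z₁)
    (hz₂ : ∃ A : ℝ, 0 ≤ A ∧ ∀ s t : ℝ, 0 ≤ s → s ≤ t → t ≤ T₂ →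
      ‖z₂ t s‖ ≤ A * (t - s) ^ (α + β)) :
    ∃ A : ℝ, ∀ s t : ℝ, 0 < s → s ≤ t → t ≤ T₁ + T₂ →
      s ^ β * ‖z t s‖ ≤ A * (t - s) ^ (α + β) := by
  have hα := d.pos
  obtain ⟨Z₁, hZ₁⟩ := m₁.exists_pairBound hα hβ
  obtain ⟨A, hA, hz₂⟩ := hz₂
  obtain ⟨F, hF, hmid⟩ := hc.exists_norm_area_mid_le d hT₁
  have hZ₁0 := hZ₁.nonneg
  have hT : 0 ≤ T₁ + T₂ := by positivity
  refine ⟨Z₁ + (T₁ + T₂) ^ β * A + F * (Z₁ + (T₁ + T₂) ^ β * A), fun s t hs hst ht => ?_⟩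
  have hp : 0 ≤ (t - s) ^ (α + β) := Real.rpow_nonneg (sub_nonneg.2 hst) _
  have hsβ : 0 < s ^ β := Real.rpow_pos_of_pos hs β
  have hsT' : s ^ β ≤ (T₁ + T₂) ^ β := Real.rpow_le_rpow hs.le (hst.trans ht) hβ.le
  have hw : s ^ β * s ^ (-β) = 1 := by rw [← Real.rpow_add hs, add_neg_cancel, Real.rpow_zero]
  have hE : 0 ≤ (T₁ + T₂) ^ β * A := by positivity
  have hF' : 0 ≤ F * (Z₁ + (T₁ + T₂) ^ β * A) := by positivity
  rcases le_total t T₁ with htT | htT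
  · rw [hc.area_left s t hs.le hst htT]
    calc _ ≤ s ^ β * (Z₁ * s ^ (-β) * (t - s) ^ (α + β)) := by
          gcongr
          exact hZ₁.area_weighted s t hs hst htT
      _ = s ^ β * s ^ (-β) * Z₁ * (t - s) ^ (α + β) := by ring
      _ ≤ _ := by
          rw [hw, one_mul]
          gcongr
          linarith
  rcases le_total T₁ s with hsT | hsT
  · rw [hc.area_right s t hsT hst ht]
    have := hz₂ (s - T₁) (t - T₁) (by linarith) (by linarith) (by linarith)
    rw [sub_sub_sub_cancel_right] at this
    calc _ ≤ (T₁ + T₂) ^ β * (A * (t - s) ^ (α + β)) := by gcongr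
      _ = (T₁ + T₂) ^ β * A * (t - s) ^ (α + β) := by ring
      _ ≤ _ := by
          gcongr
          linarith
  have k2 : ‖z₂ (t - T₁) 0‖ ≤ A * (t - T₁) ^ (α + β) := by
    simpa using hz₂ 0 (t - T₁) le_rfl (by linarith) (by linarith)
  have hs0 : 0 ≤ s ^ (-β) := Real.rpow_nonneg hs.le _
  have key := hmid s t (Z₁ * s ^ (-β)) A (α + β) β hs.le hsT htT ht (by positivity) hA hβ.le
    (by positivity) rfl (hZ₁.path s T₁ hs hsT le_rfl) k2 (hZ₁.area_weighted s T₁ hs hsT le_rfl)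
  calc _ ≤ s ^ β * (F * (Z₁ * s ^ (-β) + A) * (t - s) ^ (α + β)) := by gcongr
    _ = F * (s ^ β * s ^ (-β) * Z₁ + s ^ β * A) * (t - s) ^ (α + β) := by ring
    _ ≤ F * (Z₁ + (T₁ + T₂) ^ β * A) * (t - s) ^ (α + β) := by
        rw [hw, one_mul]
        gcongr
    _ ≤ _ := by
        gcongr
        linarith

/-- The area component of the second piece has no singularity at its initial time: that piece
starts at a value which the evolution on `[0, T₁]` has made regular, so that its path component is
regular and Hölder continuous up to the initial time. -/
theorem exists_norm_area_right_le (hc : IsConcat S ω T₁ T₂ y₁ z₁ y₂ z₂ y z)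
    (d : RoughDriven S ω ω2 α M C (T₁ + T₂)) (hg : CoeffBound S g β (2 * T₂) N) (hβ : 0 < β)
    (hβα : β < α) (hαβ : α + β < 1) (h1 : 1 < α + 2 * β) (hT₁ : 0 < T₁) (hT₂ : 0 < T₂)
    (m₂ : MemX α β S (wienerShift T₁ ω) T₂ y₂ z₂)
    (I₂ : IsImage S g (wienerShift T₁ ω) (shift₂ T₁ ω2) T₂ (y₁ T₁) y₂ z₂ y₂ z₂)
    (hinc : ∃ A : ℝ, 0 ≤ A ∧ ∀ s t : ℝ, 0 ≤ s → s ≤ t → t ≤ T₁ + T₂ →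
      ‖y t - S (t - s) (y s)‖ ≤ A * (t - s) ^ α) :
    ∃ A : ℝ, 0 ≤ A ∧ ∀ s t : ℝ, 0 ≤ s → s ≤ t → t ≤ T₂ → ‖z₂ t s‖ ≤ A * (t - s) ^ (α + β) := by
  obtain ⟨B, hB, hinc⟩ := hinc
  have hα1 := d.lt_one
  obtain ⟨K, hK, hder⟩ := d.toDriven.exists_norm_deriv_path_le hB hinc
  obtain ⟨K', hK', hhol⟩ := d.toDriven.exists_weighted_holder hβ hβα (by positivity) hB hinc
  have hy : ∀ s : ℝ, 0 ≤ s → s ≤ T₂ → y₂ s = y (s + T₁) := fun s hs hsT => by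
    rw [hc.path_right (s + T₁) (by linarith) (by linarith), add_sub_cancel_right]
  have hT₁β : 0 < T₁ ^ β := Real.rpow_pos_of_pos hT₁ β
  refine RoughEvolution.exists_norm_area_le (R := K + K / T₁ * T₂ ^ (1 - α) + K' / T₁ ^ β)
    (d.shift hT₁.le (by linarith : T₂ + T₁ ≤ T₁ + T₂)) hg m₂ hβ hβα hαβ h1 I₂ (by positivity)
    (fun s hs hsT h hh hhT => ?_) (fun s t hs hst ht => ?_)
  · have hhα : 0 < h ^ (α - 1) := Real.rpow_pos_of_pos hh _
    -- `1 ≤ (T₂ / h)^(1-α)` turns the bounded contribution of the initial value into `O(h^(α-1))`.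
    have e1 : 1 ≤ T₂ ^ (1 - α) * h ^ (α - 1) := by
      have : h ^ (1 - α) ≤ T₂ ^ (1 - α) := Real.rpow_le_rpow hh.le hhT (by linarith)
      calc (1 : ℝ) = h ^ (1 - α) * h ^ (α - 1) := by
            rw [← Real.rpow_add hh, sub_add_sub_cancel', sub_self, Real.rpow_zero]
        _ ≤ _ := by gcongr
    rw [hy s hs hsT]
    calc _ ≤ K * h ^ (α - 1) + K / (h + (s + T₁)) :=
          hder h (s + T₁) hh (by linarith) (by linarith) (by linarith)
      _ ≤ K * h ^ (α - 1) + K / T₁ * (T₂ ^ (1 - α) * h ^ (α - 1)) := by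
          have : K / (h + (s + T₁)) ≤ K / T₁ := by
            gcongr
            linarith
          have h2 : 0 ≤ K / T₁ := by positivity
          nlinarith
      _ = (K + K / T₁ * T₂ ^ (1 - α)) * h ^ (α - 1) := by ring
      _ ≤ _ := by
          refine mul_le_mul_of_nonneg_right ?_ hhα.le
          exact le_add_of_nonneg_right (by positivity)
  · have h0 : 0 ≤ (t - s) ^ β := Real.rpow_nonneg (sub_nonneg.2 hst) β
    rw [hy s hs (hst.trans ht), hy t (hs.trans hst) ht]
    have := hhol (s + T₁) (t + T₁) (by linarith) (by linarith) (by linarith)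
    rw [add_sub_add_right_eq_sub] at this
    have h2 : T₁ ^ β ≤ (s + T₁) ^ β := Real.rpow_le_rpow hT₁.le (by linarith) hβ.le
    calc _ ≤ K' / T₁ ^ β * (t - s) ^ β := by
          rw [div_mul_eq_mul_div, le_div_iff₀ hT₁β, mul_comm]
          refine le_trans ?_ this
          gcongr
      _ ≤ _ := by
          refine mul_le_mul_of_nonneg_right ?_ h0
          exact le_add_of_nonneg_left (by positivity)

theorem memX (hc : IsConcat S ω T₁ T₂ y₁ z₁ y₂ z₂ y z)
    (d : RoughDriven S ω ω2 α M C (T₁ + T₂)) (hg : CoeffBound S g β (2 * (T₁ + T₂)) N)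
    (hβ : 0 < β) (hβα : β < α) (hαβ : α + β < 1) (h1 : 1 < α + 2 * β) (hT₁ : 0 < T₁)
    (hT₂ : 0 < T₂) (m₁ : MemX α β S ω T₁ y₁ z₁)
    (m₂ : MemX α β S (wienerShift T₁ ω) T₂ y₂ z₂)
    (I₁ : IsImage S g ω ω2 T₁ ξ y₁ z₁ y₁ z₁)
    (I₂ : IsImage S g (wienerShift T₁ ω) (shift₂ T₁ ω2) T₂ (y₁ T₁) y₂ z₂ y₂ z₂) :
    MemX α β S ω (T₁ + T₂) y z := by
  have hα := d.pos
  have hg₁ : CoeffBound S g β (2 * T₁) N := hg.mono (by linarith)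
  have hg₂ : CoeffBound S g β (2 * T₂) N := hg.mono (by linarith)
  have hinc := hc.exists_norm_increment_le d.toDriven hT₁.le
    (RoughEvolution.exists_norm_increment_le (d.mono (by linarith)).toDriven hg₁ m₁ hβ h1 I₁.path)
    (RoughEvolution.exists_norm_increment_le
      (d.shift hT₁.le (by linarith : T₂ + T₁ ≤ T₁ + T₂)).toDriven hg₂ m₂ hβ h1 I₂.path)
  have hz₂ := hc.exists_norm_area_right_le d hg₂ hβ hβα hαβ h1 hT₁ hT₂ m₂ I₂ hinc
  obtain ⟨A, hA, hz⟩ := hc.exists_norm_area_le d.toDriven hβ hT₁.le m₁ m₂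
  obtain ⟨A', hz'⟩ := hc.exists_weighted_norm_area_le d.toDriven hβ hT₁.le hT₂.le m₁ hz₂
  obtain ⟨B, hB, hinc⟩ := hinc
  obtain ⟨K, -, hhol⟩ := d.toDriven.exists_weighted_holder hβ hβα (by positivity) hB hinc
  have diag : ∀ t ∈ Icc 0 (T₁ + T₂), z t t = 0 := fun t ht => by
    simpa [Real.zero_rpow hα.ne'] using hz t t ht.1 le_rfl ht.2
  have bounded : ∃ D : ℝ, ∀ t ∈ Icc 0 (T₁ + T₂), ‖z t 0‖ ≤ D := by
    refine ⟨A * (T₁ + T₂) ^ α, fun t ht => (hz 0 t le_rfl ht.1 ht.2).trans ?_⟩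
    rw [sub_zero]
    have := ht.1
    gcongr
    exact ht.2
  exact ⟨⟨hc.continuousOn_path hT₁.le hT₂.le m₁.path.continuousOn m₂.path.continuousOn,
      K, fun s t hs hst ht => hhol s t hs hst.le ht⟩,
    ⟨diag, bounded, A, fun s t hs hst ht => hz s t hs hst.le ht⟩,
    ⟨diag, bounded, A', fun s t hs hst ht => hz' s t hs hst.le ht⟩,
    hc.algebraic d.toDriven hT₁.le hT₂.le m₁ m₂⟩

end IsConcat

theorem exists_norm_XiZ_le (d : RoughDriven S ω ω2 α M C T) (hg : CoeffBound S g β (2 * T) N)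
    (hβ : 0 < β) (hαβ : α + β < 1) (h1 : 1 < 2 * α + β) {R : ℝ} (hR : 0 ≤ R)
    (hy : ∀ s : ℝ, 0 ≤ s → s ≤ T → ‖y s‖ ≤ R) (E : W →L[ℝ] V →L[ℝ] W) :
    ∃ A : ℝ, 0 ≤ A ∧ ∀ s t : ℝ, 0 ≤ s → s ≤ t → t ≤ T →
      ‖XiZ S g ω ω2 y y E t s‖ ≤ A * (t - s) ^ α := by
  obtain ⟨A, hA, hb⟩ := d.exists_norm_procB_le hβ hαβ h1
  obtain ⟨B, hB, ha⟩ := d.toDriven.exists_norm_procA_le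
  have hα := d.pos
  have hN := hg.nonneg
  refine ⟨A * N * ‖E‖ * |T| ^ α + B * ‖E‖ * R, by positivity, fun s t hs hst ht => ?_⟩
  have h0 : 0 ≤ t - s := sub_nonneg.2 hst
  have hT : t - s ≤ |T| := (by linarith : t - s ≤ T).trans (le_abs_self T)
  have b1 : ‖procB S ω ω2 t s E (g (y s))‖ ≤ A * N * ‖E‖ * (|T| ^ α * (t - s) ^ α) := by
    refine (hb s t N E (g (y s)) hs hst ht (hg.norm_le _) (hg.regular _)).trans ?_
    rw [two_mul]
    gcongr
    exact rpow_add_le_mul_rpow h0 hT hα.le hα.le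
  have b2 : ‖procA S ω t s E (y s)‖ ≤ B * (t - s) ^ α * ‖E‖ * R := by
    refine (ha s t E (y s) hs hst ht).trans ?_
    gcongr
    exact hy s hs (hst.trans ht)
  exact (norm_add_le _ _).trans ((add_le_add b1 b2).trans (le_of_eq (by ring)))

namespace IsConcat

omit [CompleteSpace W] in
/-- Rough integrals along the second piece are rough integrals over subintervals of
`[T₁, T₁ + T₂]`. -/
theorem hasRoughIntegral_right {Ξ Ξ' : ℝ → ℝ → W} {s t : ℝ} {x : W} (hs : T₁ ≤ s)
    (ht : t ≤ T₁ + T₂)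
    (hΞ : ∀ u v : ℝ, 0 ≤ u → u ≤ v → v ≤ T₂ → Ξ' v u = Ξ (v + T₁) (u + T₁))
    (h : HasRoughIntegral S Ξ' (s - T₁) (t - T₁) x) : HasRoughIntegral S Ξ s t x := by
  have := (h.congr fun u v hu huv hv => hΞ u v (by linarith) huv (by linarith)).shift
  rwa [sub_add_cancel, sub_add_cancel] at this

/-- The fixed point equations hold for the concatenation: on the pieces they are those of the two
given fixed points, and on intervals that contain `T₁` the rough integrals are joined at `T₁`. -/
theorem isImage (hc : IsConcat S ω T₁ T₂ y₁ z₁ y₂ z₂ y z)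
    (d : RoughDriven S ω ω2 α M C (T₁ + T₂)) (hg : CoeffBound S g β (2 * (T₁ + T₂)) N)
    (hβ : 0 < β) (hαβ : α + β < 1) (h1 : 1 < 2 * α + β) (hT₁ : 0 ≤ T₁) (hT₂ : 0 ≤ T₂)
    (m : MemX α β S ω (T₁ + T₂) y z)
    (I₁ : IsImage S g ω ω2 T₁ ξ y₁ z₁ y₁ z₁)
    (I₂ : IsImage S g (wienerShift T₁ ω) (shift₂ T₁ ω2) T₂ (y₁ T₁) y₂ z₂ y₂ z₂) :
    IsImage S g ω ω2 (T₁ + T₂) ξ y z y z := by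
  have hα := d.pos
  obtain ⟨Z, hZ⟩ := m.exists_pairBound hα hβ
  have hy₀ : y T₁ = y₁ T₁ := hc.path_left T₁ hT₁ le_rfl
  have hy₂ : y₂ 0 = y₁ T₁ := by
    rw [← hy₀, hc.path_right T₁ le_rfl (by linarith), sub_self]
  have right_path : ∀ s : ℝ, 0 ≤ s → s ≤ T₂ → y₂ s = y (s + T₁) := fun s hs hsT => by
    rw [hc.path_right (s + T₁) (by linarith) (by linarith), add_sub_cancel_right]
  have XiY_right : ∀ u v : ℝ, 0 ≤ u → u ≤ v → v ≤ T₂ →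
      XiY S g (wienerShift T₁ ω) y₂ z₂ v u = XiY S g ω y z (v + T₁) (u + T₁) := by
    intro u v hu huv hv
    rw [XiY, XiY, omegaS_wienerShift, right_path u hu (huv.trans hv),
      hc.area_right (u + T₁) (v + T₁) (by linarith) (by linarith) (by linarith),
      add_sub_cancel_right, add_sub_cancel_right]
  have XiZ_right : ∀ E : W →L[ℝ] V →L[ℝ] W, ∀ u v : ℝ, 0 ≤ u → u ≤ v → v ≤ T₂ →
      XiZ S g (wienerShift T₁ ω) (shift₂ T₁ ω2) y₂ y₂ E v u
        = XiZ S g ω ω2 y y E (v + T₁) (u + T₁) := by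
    intro E u v hu huv hv
    rw [XiZ, XiZ, procB_wienerShift, procA_wienerShift, right_path u hu (huv.trans hv)]
  have path_left : ∀ t : ℝ, 0 ≤ t → t ≤ T₁ →
      HasRoughIntegral S (XiY S g ω y z) 0 t (y t - S t ξ) := by
    intro t ht htT
    rw [hc.path_left t ht htT]
    refine (I₁.path t ⟨ht, htT⟩).congr fun u v hu huv hv => ?_
    rw [XiY, XiY, hc.path_left u hu (by linarith), hc.area_left u v hu huv (by linarith)]
  have area_left : ∀ (E : W →L[ℝ] V →L[ℝ] W) (s t : ℝ), 0 ≤ s → s ≤ t → t ≤ T₁ →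
      HasRoughIntegral S (XiZ S g ω ω2 y y E) s t (z t s E + omegaS S ω t s (E (y s))) := by
    intro E s t hs hst htT
    rw [hc.path_left s hs (hst.trans htT), hc.area_left s t hs hst htT]
    refine (I₁.area s t hs hst htT E).congr fun u v hu huv hv => ?_
    rw [XiZ, XiZ, hc.path_left u (hs.trans hu) (by linarith)]
  have area_right : ∀ (E : W →L[ℝ] V →L[ℝ] W) (s t : ℝ), T₁ ≤ s → s ≤ t → t ≤ T₁ + T₂ →
      HasRoughIntegral S (XiZ S g ω ω2 y y E) s t (z t s E + omegaS S ω t s (E (y s))) := by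
    intro E s t hs hst ht
    have := I₂.area (s - T₁) (t - T₁) (by linarith) (by linarith) (by linarith) E
    rw [omegaS_wienerShift, sub_add_cancel, sub_add_cancel] at this
    rw [hc.area_right s t hs hst ht, hc.path_right s hs (hst.trans ht)]
    exact hasRoughIntegral_right hs ht (XiZ_right E) this
  refine ⟨fun t ⟨ht0, ht⟩ => ?_, fun s t hs hst ht E => ?_⟩
  · rcases le_total t T₁ with htT | htT
    · exact path_left t ht0 htT
    obtain ⟨A, hA, hXi⟩ := exists_norm_XiY_le d.toDriven hg hZ
    have r : HasRoughIntegral S (XiY S g ω y z) T₁ t (y₂ (t - T₁) - S (t - T₁) (y₁ T₁)) := by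
      refine hasRoughIntegral_right le_rfl ht XiY_right ?_
      rw [sub_self]
      exact I₂.path (t - T₁) ⟨by linarith, by linarith⟩
    have := HasRoughIntegral.join_of_norm_le d.semigroup d.bound (by linarith) hα hA hT₁ htT
      (fun u v hu huv hv => hXi u v hu huv (hv.trans ht)) (path_left T₁ hT₁ le_rfl) r
    convert this using 1
    have e : S (t - T₁) (S T₁ ξ) = S t ξ := by
      simpa using d.semigroup.comp_apply hT₁ htT ξ
    rw [map_sub, e, hc.path_right t htT ht, hy₀]
    abel
  · rcases le_total t T₁ with htT | htT
    · exact area_left E s t hs hst htT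
    rcases le_total T₁ s with hsT | hsT
    · exact area_right E s t hsT hst ht
    obtain ⟨A, hA, hXi⟩ := exists_norm_XiZ_le d hg hβ hαβ h1 hZ.nonneg hZ.norm_path_le E
    have := HasRoughIntegral.join_of_norm_le d.semigroup d.bound (by linarith) hα hA hsT htT
      (fun u v hu huv hv => hXi u v (hs.trans hu) huv (hv.trans ht))
      (area_left E s T₁ hs hsT le_rfl) (area_right E T₁ t le_rfl htT ht)
    convert this using 1
    rw [hc.area_mid s t hs hsT htT ht, hc.area_right T₁ t le_rfl htT ht, sub_self,
      hc.area_left s T₁ hs hsT le_rfl, hy₀, hc.path_left s hs hsT,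
      d.toDriven.omegaS_add hs hsT htT ht]
    simp only [map_add, map_sub]
    abel

end IsConcat

end ConcatSolution
end RoughEvolution

theorem mainTheorem8 {V W : Type*}
    [NormedAddCommGroup V] [InnerProductSpace ℝ V] [CompleteSpace V]
    [NormedAddCommGroup W] [NormedSpace ℝ W] [CompleteSpace W] [TopologicalSpace.SeparableSpace W]
    (α β lam T₁ T₂ : ℝ) (hα : 1 / 3 < α) (hα' : α ≤ 1 / 2) (hβ : 0 < β) (hβα : β < α)
    (hαβ : 1 < α + 2 * β) (hT₁ : 0 < T₁) (hT₂ : 0 < T₂)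
    (S : ℝ → W →L[ℝ] W) (hS : RoughEvolution.IsAnalyticSemigroup S)
    (hlam : RoughEvolution.IsExpStable lam S)
    (G : W → V →L[ℝ] RoughEvolution.FracDomain S lam β)
    (hG : RoughEvolution.IsAdmissibleCoeff G)
    (ω : ℝ → V) (ω2 : ℝ → ℝ → RoughEvolution.Tensor V)
    (hω : RoughEvolution.IsRoughPath α (T₁ + T₂) ω ω2) (ξ : W)
    (y₁ y₂ : ℝ → W) (z₁ z₂ : ℝ → ℝ → RoughEvolution.AreaSpace V W)
    (h₁ : RoughEvolution.IsFixedPoint α β lam S G ω ω2 T₁ ξ y₁ z₁)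
    (h₂ : RoughEvolution.IsFixedPoint α β lam S G (RoughEvolution.wienerShift T₁ ω)
      (RoughEvolution.shift₂ T₁ ω2) T₂ (y₁ T₁) y₂ z₂) :
    ∃ (y : ℝ → W) (z : ℝ → ℝ → RoughEvolution.AreaSpace V W),
      (∀ t : ℝ, 0 ≤ t → t ≤ T₁ → y t = y₁ t) ∧
      (∀ t : ℝ, T₁ ≤ t → t ≤ T₁ + T₂ → y t = y₂ (t - T₁)) ∧
      (∀ s t : ℝ, 0 ≤ s → s ≤ t → t ≤ T₁ → z t s = z₁ t s) ∧
      (∀ s t : ℝ, 0 ≤ s → s ≤ T₁ → T₁ ≤ t → t ≤ T₁ + T₂ → ∀ E : W →L[ℝ] V →L[ℝ] W,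
        z t s E = RoughEvolution.omegaS S ω t T₁ (E (y₁ T₁ - y₁ s)) + z₂ (t - T₁) 0 E
          + S (t - T₁) (z₁ T₁ s E)) ∧
      (∀ s t : ℝ, T₁ ≤ s → s ≤ t → t ≤ T₁ + T₂ → z t s = z₂ (t - T₁) (s - T₁)) ∧
      RoughEvolution.IsFixedPoint α β lam S G ω ω2 (T₁ + T₂) ξ y z := by
  obtain ⟨M, hM⟩ := hS.exists_semigroupBound hlam (2 * (T₁ + T₂))
  obtain ⟨C, d⟩ := hω.exists_roughDriven hS hM (by linarith) (by linarith)
  obtain ⟨N, hg⟩ := hG.exists_coeffBound hS hlam hβ (by linarith) (2 * (T₁ + T₂))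
  have hy : y₂ 0 = y₁ T₁ := by
    have := (h₂.fixed.path 0 ⟨le_rfl, hT₂.le⟩).eq_zero
    rwa [hS.zero_apply, sub_eq_zero] at this
  obtain ⟨y, z, hc⟩ := RoughEvolution.exists_isConcat (ω := ω) (T₂ := T₂) hS hy hT₁.le
    (h₁.mem.area.diag T₁ ⟨hT₁.le, le_rfl⟩) (h₂.mem.area.diag 0 ⟨le_rfl, hT₂.le⟩)
  have hmem := hc.memX d hg hβ hβα (by linarith) hαβ hT₁ hT₂ h₁.mem h₂.mem h₁.fixed h₂.fixed
  exact ⟨y, z, hc.path_left, hc.path_right, hc.area_left, hc.area_mid, hc.area_right, hmem,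
    hc.isImage d hg hβ (by linarith) (by linarith) hT₁.le hT₂.le hmem h₁.fixed h₂.fixed⟩
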